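/- An arithmetical semigroup is a commutative monoid $\mathcal G$ that is freely generated by a countable set $\mathcal P$ of primes (every element is a product of primes, uniquely up to order), together with a multiplicative norm $|\cdot|:\mathcal G\to(0,\infty)$ such that $\mathcal N(x):=\#\{g\in\mathcal G: |g|\le x\}$ is finite for every real $x$. It satisfies Axiom A with exponent $\theta\in(0,1)$ if there are constants $\kappa>0$ and $A$ with $|\mathcal N(x)-\kappa(x-1)|\le A x^{\theta}$ for all $x\ge1$. In that case its Beurling zeta function $\zeta(s)=\sum_{g\in\mathcal G}|g|^{-s}$ $(\Re s>1)$ continues analytically to $\{\Re s>\theta\}\setminus\{1\}$, and "zero of $\zeta$" refers to this continuation. Let $\Lambda(g):=\log|p|$ if $g=p^k$ with $p\in\mathcal P$ and an integer $k\ge1$, let $\Lambda(g):=0$ for all other $g$, and put $\psi(x):=\sum_{|g|\le x}\Lambda(g)$ and $\Delta(x):=\psi(x)-x$. **Theorem.** Let $\varepsilon>0$, $\beta_0\in(1/2,1)$ and $1/2<r<\beta_0$. Then there exists an arithmetical semigroup $\mathcal G$ which satisfies Axiom A with $\theta=r$, but with no $\theta<r$ (for any choice of $\kappa$ and $A$),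 and whose Beurling zeta function has a zero $\rho_0=\beta_0+i\gamma_0$ with $\gamma_0\neq0$ such that $$|\Delta(x)|\le\left(\frac{\pi}{2}+\varepsilon\right)\frac{x^{\beta_0}}{|\rho_0|}\qquad\text{for all sufficiently large } x.$$ -/

import Mathlib

/-- An arithmetical semigroup (Beurling number system) on the commutative monoid `G`: a countable
set of primes freely generating `G`, and a positive multiplicative norm such that only finitely
many elements have norm below any given bound. -/
structure ArithmeticalSemigroup (G : Type*) [CommMonoid G] where
  /-- The set of primes. -/
  primes : Set G
  countable_primes : primes.Countable
  /-- Every element is the product of exactly one finite multiset of primes. -/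
  freely_generates :
    Function.Bijective fun m : Multiset primes => (m.map (fun p => (p : G))).prod
  /-- The norm. -/
  norm : G →* ℝ
  norm_pos : ∀ g, 0 < norm g
  finite_norm_le : ∀ x : ℝ, {g : G | norm g ≤ x}.Finite

namespace ArithmeticalSemigroup

variable {G : Type*} [CommMonoid G] (S : ArithmeticalSemigroup G)

/-- The counting function `N(x) = #{g : |g| ≤ x}`. -/
noncomputable def count (x : ℝ) : ℕ := {g : G | S.norm g ≤ x}.ncard

/-- Axiom `A(κ, θ)`: `κ > 0`, `0 < θ < 1` and `|N(x) - κ (x - 1)| ≤ A x ^ θ` for all `x ≥ 1`,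
with some constant `A`. -/
def AxiomA (κ θ : ℝ) : Prop :=
  0 < κ ∧ 0 < θ ∧ θ < 1 ∧
    ∃ A : ℝ, ∀ x : ℝ, 1 ≤ x → |(S.count x : ℝ) - κ * (x - 1)| ≤ A * x ^ θ

/-- `Z` is the Beurling zeta function of `S` on `{Re s > θ} \ {1}`: it is holomorphic there, and
for `Re s > 1` it is the sum of the absolutely convergent series `∑ |g| ^ (-s)` over all `g`.
For `θ < 1` the domain is connected, so these conditions determine `Z` on it. -/
def IsZeta (θ : ℝ) (Z : ℂ → ℂ) : Prop :=
  DifferentiableOn ℂ Z {s : ℂ | θ < s.re ∧ s ≠ 1} ∧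
    ∀ s : ℂ, 1 < s.re → HasSum (fun g : G => (S.norm g : ℂ) ^ (-s)) (Z s)

/-- `ρ` is a zero, in the half-plane `Re s > θ`, of the analytically continued zeta function. -/
def IsZetaZero (θ : ℝ) (ρ : ℂ) : Prop :=
  θ < ρ.re ∧ ρ ≠ 1 ∧ ∃ Z : ℂ → ℂ, S.IsZeta θ Z ∧ Z ρ = 0

open Classical in
/-- The von Mangoldt function: `log |p|` if `g = p ^ k` with a prime `p` and `k ≥ 1` (then `p` is
unique, by free generation), and `0` otherwise. -/
noncomputable def vonMangoldt (g : G) : ℝ :=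
  if h : ∃ p : G, p ∈ S.primes ∧ ∃ k : ℕ, 1 ≤ k ∧ g = p ^ k then
    Real.log (S.norm h.choose)
  else 0

/-- The summatory function `ψ(x) = ∑_{|g| ≤ x} Λ(g)`. -/
noncomputable def psi (x : ℝ) : ℝ := ∑ g ∈ (S.finite_norm_le x).toFinset, S.vonMangoldt g

/-- The error term `Δ(x) = ψ(x) - x` in the prime number formula. -/
noncomputable def Delta (x : ℝ) : ℝ := S.psi x - x

end ArithmeticalSemigroup

/-! The oscillation in `Δ` is governed by the zeros of zeta, each conjugate pair `ρ, conj ρ`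
contributing `-2 Re (x ^ ρ / ρ)`. Put zeros at `β₀ ± (2 n + 1) γ i` for `n` in a finite set `A`
containing `0`. For large `γ` one may replace `1 / ρ` by `1 / (i Im ρ)`, and the total becomes `-(2
x ^ β₀ / γ) ∑ sin ((2 n + 1) γ log x) / (2 n + 1)`. The full odd sine series is a square wave of
height `π / 4`, which gives the constant `π / 2` since `|ρ₀|` is close to `γ`. Partial sums
overshoot by the Gibbs phenomenon, so `A` has to be chosen differently: damping by `Q ^ (2 n + 1)`
keeps the sum within `π / 4`, and a derandomized rounding turns the damped weights with `n ≥ K` into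
weights `0` or `1`, as required of simple zeros, at a small uniform cost
(`exists_odd_sine_polynomial`).

It remains to realize prescribed zeros by a semigroup. By Frullani's integral the density `((e ^ τ -
1) + (e ^ (r τ) - 1) - ∑ 2 Re (e ^ (ρ τ) - 1)) / τ` of primes on the logarithmic scale has as
exponentiated Laplace transform a function with poles at `1` and `r` and zeros at the `ρ` and their
conjugates. It is positive from some `L` on, and deleting `[0, L]` only changes the transform by the
exponential of an entire function. The half-line is cut into intervals of mass one, and one prime is
placed in each. Wherever the primes are placed, the quotient of zeta by its template is holomorphic
and nonvanishing for `Re s > 1 / 2`, and the prime sums follow the density; this yields the zeros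
and the explicit formula for `Δ` up to `O(x ^ r)`.

The delicate point is Axiom A, which needs control of zeta on a line `Re s = σ` with `1 / 2 < σ <
r`. A prime distributed in its interval according to the density makes the first-order term of the
local factor have mean zero, so exponential moments of any order on that line grow only by factors
`exp (O(e ^ (-2 σ y_j)))`, whose product converges. Choosing the primes greedily keeps one weighted
moment bounded (`UnitPartition.exists_lam`). A smoothed Perron formula, shifted to `Re s = σ` and
unsmoothed, gives `N(x) = κ x + c x ^ r + O(x ^ (σ + η))` with `σ + η < r` and `c ≠ 0`: Axiom A
holds with exponent `r`, and the secondary term from the pole at `r` excludes any smaller exponent.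
-/

section

/-! ### Semigroups on the positive integers with reweighted primes -/

namespace BeurlingConstruction

/-- The logarithmic size of a positive integer whose prime divisors `p` carry weights `w p`. -/
noncomputable def logSize (w : Nat.Primes → ℝ) (n : ℕ+) : ℝ :=
  (Multiset.map w (PNat.factorMultiset n)).sum

lemma logSize_one (w : Nat.Primes → ℝ) : logSize w 1 = 0 := by
  rw [logSize, PNat.factorMultiset_one]
  exact Multiset.sum_zero

lemma logSize_mul (w : Nat.Primes → ℝ) (m n : ℕ+) :
    logSize w (m * n) = logSize w m + logSize w n := by
  rw [logSize, PNat.factorMultiset_mul]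
  exact (congrArg Multiset.sum (Multiset.map_add w _ _)).trans (Multiset.sum_add _ _)

lemma logSize_prime (w : Nat.Primes → ℝ) (p : Nat.Primes) : logSize w p = w p := by
  rw [logSize, PNat.factorMultiset_ofPrime]
  change (Multiset.map w {p}).sum = w p
  simp

lemma logSize_pow (w : Nat.Primes → ℝ) (n : ℕ+) (k : ℕ) :
    logSize w (n ^ k) = k * logSize w n := by
  induction k with
  | zero => simp [logSize_one]
  | succ k ih => rw [pow_succ, logSize_mul, ih]; push_cast; ring

/-- An integer of size at most `y` has at most `y / δ` prime factors, all of weight at most `y`. Its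
factor multiset therefore lies below one fixed finite multiset. -/
lemma finite_logSize_le {w : Nat.Primes → ℝ} {δ : ℝ} (hδ : 0 < δ) (hw : ∀ p, δ ≤ w p)
    (hfin : ∀ y, {p | w p ≤ y}.Finite) (y : ℝ) : {n : ℕ+ | logSize w n ≤ y}.Finite := by
  classical
  set M : Multiset Nat.Primes := ⌊y / δ⌋₊ • (hfin y).toFinset.val with hM
  refine Set.Finite.subset
    ((Set.finite_Iic M).preimage (f := fun n : ℕ+ => (PNat.factorMultiset n : Multiset Nat.Primes))
      (PNat.factorMultisetEquiv.injective.injOn)) ?_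
  intro n hn
  simp only [Set.mem_ofPred_eq, logSize] at hn
  change (PNat.factorMultiset n : Multiset Nat.Primes) ≤ M
  set m : Multiset Nat.Primes := PNat.factorMultiset n with hm
  have hpos : ∀ x ∈ Multiset.map w m, 0 ≤ x := by
    intro x hx
    obtain ⟨p, -, rfl⟩ := Multiset.mem_map.1 hx
    exact hδ.le.trans (hw p)
  have hcard : m.card ≤ ⌊y / δ⌋₊ := by
    apply Nat.le_floor
    rw [le_div_iff₀ hδ]
    have := Multiset.card_nsmul_le_sum (s := Multiset.map w m) (a := δ) (by
      intro x hx
      obtain ⟨p, -, rfl⟩ := Multiset.mem_map.1 hx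
      exact hw p)
    rw [Multiset.card_map, nsmul_eq_mul] at this
    exact this.trans hn
  refine (Multiset.le_iff_count (s := m) (t := M)).2 ?_
  intro p
  by_cases hp : p ∈ m
  · have h1 : w p ≤ y := (Multiset.single_le_sum hpos _ (Multiset.mem_map_of_mem w hp)).trans hn
    rw [hM, Multiset.count_nsmul, Multiset.count_eq_one_of_mem (hfin y).toFinset.nodup
      (by simpa using h1), mul_one]
    exact (Multiset.count_le_card p m).trans hcard
  · rw [Multiset.count_eq_zero_of_notMem hp]
    exact Nat.zero_le _

/-- The primes of the semigroup `ℕ+`. -/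
def pnatPrimes : Set ℕ+ := Set.range fun p : Nat.Primes => (p : ℕ+)

lemma bijective_prod_pnatPrimes :
    Function.Bijective fun m : Multiset pnatPrimes => (m.map (fun p => (p : ℕ+))).prod := by
  let e : Nat.Primes ≃ pnatPrimes := Equiv.ofInjective _ Nat.Primes.coe_pnat_injective
  have h : (fun m : Multiset pnatPrimes => (m.map (fun p => (p : ℕ+))).prod) =
      PNat.factorMultisetEquiv.symm ∘ (Multiset.map e.symm) := by
    funext m
    change (Multiset.map (fun p : ℕ+ => p) (Multiset.bind m fun a => {(a : ℕ+)})).prod =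
      (Multiset.map (fun p : Nat.Primes => (p : ℕ+)) (Multiset.map e.symm m)).prod
    rw [Multiset.map_map, Multiset.bind_singleton, Multiset.map_map]
    congr 1
    refine Multiset.map_congr rfl fun p _ => ?_
    exact (congrArg Subtype.val (e.apply_symm_apply p)).symm
  rw [h]
  refine (Equiv.bijective _).comp ⟨Multiset.map_injective e.symm.injective, ?_⟩
  exact Multiset.map_surjective_of_surjective e.symm.surjective

/-- The arithmetical semigroup on `ℕ+` in which the prime `p` has norm `exp (w p)`. -/
noncomputable def semigroup (w : Nat.Primes → ℝ) {δ : ℝ} (hδ : 0 < δ) (hw : ∀ p, δ ≤ w p)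
    (hfin : ∀ y, {p | w p ≤ y}.Finite) : ArithmeticalSemigroup ℕ+ where
  primes := pnatPrimes
  countable_primes := Set.countable_range _
  freely_generates := bijective_prod_pnatPrimes
  norm :=
    { toFun := fun n => Real.exp (logSize w n)
      map_one' := by rw [logSize_one, Real.exp_zero]
      map_mul' := fun m n => by rw [logSize_mul, Real.exp_add] }
  norm_pos := fun g => Real.exp_pos _
  finite_norm_le := fun x => by
    refine (finite_logSize_le hδ hw hfin (Real.log x)).subset fun n hn => ?_
    have hn : Real.exp (logSize w n) ≤ x := hn
    exact (Real.le_log_iff_exp_le ((Real.exp_pos _).trans_le hn)).2 hn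

section semigroup

variable {w : Nat.Primes → ℝ} {δ : ℝ} (hδ : 0 < δ) (hw : ∀ p, δ ≤ w p)
  (hfin : ∀ y, {p | w p ≤ y}.Finite)

lemma semigroup_norm (n : ℕ+) : (semigroup w hδ hw hfin).norm n = Real.exp (logSize w n) := rfl

lemma prime_pow_inj {p q : Nat.Primes} {k l : ℕ} (hk : 1 ≤ k)
    (h : (p : ℕ+) ^ k = (q : ℕ+) ^ l) : p = q ∧ k = l := by
  have h' : (p : ℕ) ^ k = (q : ℕ) ^ l := by
    have := congrArg (fun n : ℕ+ => (n : ℕ)) h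
    simp only [PNat.pow_coe] at this
    exact this
  have hpq : p = q := by
    have h1 : (p : ℕ) ∣ (q : ℕ) ^ l := h' ▸ dvd_pow_self _ (by omega)
    exact Subtype.ext ((Nat.prime_dvd_prime_iff_eq p.2 q.2).1 (p.2.dvd_of_dvd_pow h1))
  subst hpq
  exact ⟨rfl, Nat.pow_right_injective p.2.two_le h'⟩

lemma vonMangoldt_prime_pow (p : Nat.Primes) {k : ℕ} (hk : 1 ≤ k) :
    (semigroup w hδ hw hfin).vonMangoldt ((p : ℕ+) ^ k) = w p := by
  have h : ∃ q : ℕ+, q ∈ (semigroup w hδ hw hfin).primes ∧ ∃ l : ℕ, 1 ≤ l ∧ (p : ℕ+) ^ k = q ^ l :=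
    ⟨p, ⟨p, rfl⟩, k, hk, rfl⟩
  rw [ArithmeticalSemigroup.vonMangoldt, dif_pos h]
  obtain ⟨⟨q, hq⟩, l, hl, hpq⟩ := h.choose_spec
  rw [← hq] at hpq ⊢
  obtain ⟨rfl, -⟩ := prime_pow_inj hk hpq
  change Real.log (Real.exp (logSize w p)) = _
  rw [Real.log_exp, logSize_prime]

/-- Prime powers are grouped by their prime: `p ^ k` counts exactly when `k * w p ≤ log x`, and each
such power contributes `w p`. -/
lemma psi_eq_sum {x : ℝ} (hx : 0 < x) :
    (semigroup w hδ hw hfin).psi x =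
      ∑ p ∈ (hfin (Real.log x)).toFinset, ⌊Real.log x / w p⌋₊ * w p := by
  classical
  have hle : ∀ n, (semigroup w hδ hw hfin).norm n ≤ x ↔ logSize w n ≤ Real.log x := fun n =>
    (Real.le_log_iff_exp_le hx).symm
  have hpow : ∀ (p : Nat.Primes) (k : ℕ), 1 ≤ k →
      ((semigroup w hδ hw hfin).norm ((p : ℕ+) ^ k) ≤ x ↔ k ≤ ⌊Real.log x / w p⌋₊) := by
    intro p k hk
    have hwp : 0 < w p := hδ.trans_le (hw p)
    rw [hle, logSize_pow, logSize_prime, ← le_div_iff₀ hwp, Nat.le_floor_iff' (by omega)]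
  let D : Finset (Σ _ : Nat.Primes, ℕ) :=
    (hfin (Real.log x)).toFinset.sigma fun p => Finset.Icc 1 ⌊Real.log x / w p⌋₊
  have hinj : Set.InjOn (fun a : Σ _ : Nat.Primes, ℕ => (a.1 : ℕ+) ^ a.2) D := by
    rintro ⟨p, k⟩ hpk ⟨q, l⟩ - h
    obtain ⟨rfl, rfl⟩ := prime_pow_inj (Finset.mem_Icc.1 (Finset.mem_sigma.1 hpk).2).1 h
    rfl
  have h1 : (semigroup w hδ hw hfin).psi x =
      ∑ g ∈ D.image (fun a : Σ _ : Nat.Primes, ℕ => (a.1 : ℕ+) ^ a.2),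
        (semigroup w hδ hw hfin).vonMangoldt g := by
    symm
    refine Finset.sum_subset ?_ ?_
    · intro g hg
      obtain ⟨⟨p, k⟩, hpk, rfl⟩ := Finset.mem_image.1 hg
      obtain ⟨hk1, hk2⟩ := Finset.mem_Icc.1 (Finset.mem_sigma.1 hpk).2
      simpa using (hpow p k hk1).2 hk2
    · intro g hg hg'
      rw [ArithmeticalSemigroup.vonMangoldt, dif_neg]
      rintro ⟨_, ⟨p, rfl⟩, k, hk, rfl⟩
      apply hg'
      have hk2 := (hpow p k hk).1 (by simpa using hg)
      refine Finset.mem_image.2 ⟨⟨p, k⟩, Finset.mem_sigma.2 ⟨?_, Finset.mem_Icc.2 ⟨hk, hk2⟩⟩, rfl⟩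
      have := (hpow p 1 le_rfl).2 (hk.trans hk2)
      rw [hle, pow_one, logSize_prime] at this
      simpa using this
  rw [h1, Finset.sum_image hinj, Finset.sum_sigma]
  refine Finset.sum_congr rfl fun p _ => ?_
  rw [Finset.sum_congr rfl fun k hk => vonMangoldt_prime_pow hδ hw hfin p (Finset.mem_Icc.1 hk).1]
  simp

/-- A prime of weight above `log x / 2` enters `ψ` through its first power only and cancels. Each
remaining prime contributes at most `log x`. -/
lemma abs_psi_sub_theta_le {x : ℝ} (hx : 1 ≤ x) :
    |(semigroup w hδ hw hfin).psi x - ∑ p ∈ (hfin (Real.log x)).toFinset, w p| ≤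
      (hfin (Real.log x / 2)).toFinset.card * Real.log x := by
  have hx0 : 0 < x := by linarith
  have hy : 0 ≤ Real.log x := Real.log_nonneg hx
  rw [psi_eq_sum hδ hw hfin hx0, ← Finset.sum_sub_distrib]
  set y := Real.log x
  have hsub : (hfin (y / 2)).toFinset ⊆ (hfin y).toFinset := by
    intro p hp
    simp only [Set.Finite.mem_toFinset, Set.mem_ofPred_eq] at hp ⊢
    linarith
  have hwp : ∀ p, 0 < w p := fun p => hδ.trans_le (hw p)
  rw [← Finset.sum_subset hsub]
  · refine (Finset.abs_sum_le_sum_abs _ _).trans ?_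
    rw [← nsmul_eq_mul]
    refine Finset.sum_le_card_nsmul _ _ _ fun p hp => ?_
    have hp' : w p ≤ y := by simpa using hsub hp
    have h1 : (1 : ℝ) ≤ ⌊y / w p⌋₊ := by
      exact_mod_cast Nat.le_floor (by rw [Nat.cast_one, one_le_div (hwp p)]; exact hp')
    have h2 : (⌊y / w p⌋₊ : ℝ) * w p ≤ y := by
      rw [← le_div_iff₀ (hwp p)]
      exact Nat.floor_le (by have := hwp p; positivity)
    rw [abs_of_nonneg (by nlinarith [hwp p])]
    linarith [hwp p]
  · intro p hp hp'
    simp only [Set.Finite.mem_toFinset, Set.mem_ofPred_eq, not_le] at hp hp'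
    have h1 : ⌊y / w p⌋₊ = 1 := by
      rw [Nat.floor_eq_iff (by have := hwp p; positivity)]
      constructor
      · rw [Nat.cast_one, one_le_div (hwp p)]; exact hp
      · rw [div_lt_iff₀ (hwp p)]; push_cast; linarith
    rw [h1]; simp

end semigroup

/-- The completely multiplicative function `n ↦ exp (-s * logSize w n)`. -/
noncomputable def expLogSize (w : Nat.Primes → ℝ) (s : ℂ) : ℕ →*₀ ℂ where
  toFun n := if h : 0 < n then Complex.exp (-s * logSize w ⟨n, h⟩) else 0
  map_zero' := by simp
  map_one' := by
    simp [logSize_one]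
  map_mul' m n := by
    rcases Nat.eq_zero_or_pos m with rfl | hm
    · simp
    rcases Nat.eq_zero_or_pos n with rfl | hn
    · simp
    have : logSize w ⟨m * n, Nat.mul_pos hm hn⟩ = logSize w ⟨m, hm⟩ + logSize w ⟨n, hn⟩ :=
      logSize_mul w ⟨m, hm⟩ ⟨n, hn⟩
    simp only [hm, hn, Nat.mul_pos hm hn, dif_pos, this, ← Complex.exp_add]
    congr 1
    push_cast
    ring

lemma expLogSize_pnat (w : Nat.Primes → ℝ) (s : ℂ) (n : ℕ+) :
    expLogSize w s n = Complex.exp (-s * logSize w n) :=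
  dif_pos n.pos

lemma expLogSize_prime (w : Nat.Primes → ℝ) (s : ℂ) (p : Nat.Primes) :
    expLogSize w s p = Complex.exp (-s * w p) := by
  have := expLogSize_pnat w s p
  rwa [logSize_prime] at this

/-- Makes sums of norms accessible to the complex Euler product, taken at the real exponent `s.re`.
-/
lemma norm_expLogSize (w : Nat.Primes → ℝ) (s : ℂ) (n : ℕ) :
    (‖expLogSize w s n‖ : ℂ) = expLogSize w s.re n := by
  rcases Nat.eq_zero_or_pos n with rfl | hn
  · simp
  · have h1 := expLogSize_pnat w s ⟨n, hn⟩
    have h2 := expLogSize_pnat w s.re ⟨n, hn⟩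
    simp only [PNat.mk_coe] at h1 h2
    rw [h1, h2, Complex.norm_exp]
    simp

/-- Supplies the absolute convergence that the full Euler product presupposes. A finite sum of norms
is dominated by the Euler product over small primes, for smooth numbers, and these products are
bounded because the logarithms of the factors are summable. -/
lemma summable_norm_expLogSize {w : Nat.Primes → ℝ} (hw : ∀ p, 0 < w p) {s : ℂ} (hs : 0 < s.re)
    (hsum : Summable fun p => Real.exp (-s.re * w p)) :
    Summable fun n => ‖expLogSize w s n‖ := by
  have hlt : ∀ p : Nat.Primes, Real.exp (-s.re * w p) < 1 := fun p => by
    rw [Real.exp_lt_one_iff]; nlinarith [hw p]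
  have hlog : Summable fun p : Nat.Primes => Real.log (1 - Real.exp (-s.re * w p)) := by
    have := Real.summable_log_one_add_of_summable hsum.neg
    simpa [sub_eq_add_neg] using this
  classical
  refine summable_of_sum_le (c := Real.exp (∑' p : Nat.Primes, -Real.log (1 - Real.exp (-s.re * w p))))
    (fun _ => norm_nonneg _) fun u => ?_
  -- Beyond all elements of `u`, so that every nonzero element is `N`-smooth.
  obtain ⟨N, hN⟩ : ∃ N : ℕ, ∀ n ∈ u, n < N := ⟨u.sup id + 1, fun n hn =>
    Nat.lt_succ_of_le (Finset.le_sup (f := id) hn)⟩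
  have key := EulerProduct.summable_and_hasSum_smoothNumbers_prod_primesBelow_geometric
    (f := (expLogSize w s.re : ℕ →* ℂ)) (by
      intro p hp
      have := expLogSize_prime w s.re ⟨p, hp⟩
      simp only [MonoidHom.coe_coe] at this ⊢
      rw [this, Complex.norm_exp]
      simpa using hlt ⟨p, hp⟩) N
  simp only [MonoidHom.coe_coe] at key
  have hsum2 := key.2
  have hprod : (∏ p ∈ N.primesBelow, (1 - expLogSize w s.re p)⁻¹ : ℂ) =
      ((∏ p ∈ N.primesBelow.subtype Nat.Prime,
        (1 - Real.exp (-s.re * w p))⁻¹ : ℝ) : ℂ) := by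
    push_cast
    rw [← Finset.prod_subtype_of_mem (p := Nat.Prime) (f := fun p : ℕ => (1 - expLogSize w s.re p)⁻¹)]
    · refine Finset.prod_congr rfl fun p _ => ?_
      rw [expLogSize_prime w s.re p]
    · intro p hp; exact Nat.prime_of_mem_primesBelow hp
  rw [hprod] at hsum2
  have hsum3 : HasSum (fun m : N.smoothNumbers => ‖expLogSize w s m‖)
      (∏ p ∈ N.primesBelow.subtype Nat.Prime, (1 - Real.exp (-s.re * w p))⁻¹ : ℝ) := by
    rw [← Complex.hasSum_ofReal]
    simpa only [norm_expLogSize] using hsum2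
  calc ∑ n ∈ u, ‖expLogSize w s n‖
      = ∑ n ∈ u.filter (· ∈ N.smoothNumbers), ‖expLogSize w s n‖ := by
        symm
        refine Finset.sum_filter_of_ne (p := (· ∈ N.smoothNumbers)) fun n hn hne => ?_
        have hn0 : n ≠ 0 := by rintro rfl; simp at hne
        exact Nat.mem_smoothNumbers_of_lt (Nat.pos_of_ne_zero hn0) (hN n hn)
    _ = ∑ n ∈ u.subtype (· ∈ N.smoothNumbers), ‖expLogSize w s n‖ :=
        (Finset.sum_subtype_eq_sum_filter (s := u) (p := (· ∈ N.smoothNumbers))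
          (fun n => ‖expLogSize w s n‖)).symm
    _ ≤ ∏ p ∈ N.primesBelow.subtype Nat.Prime, (1 - Real.exp (-s.re * w p))⁻¹ :=
        sum_le_hasSum _ (fun _ _ => norm_nonneg _) hsum3
    _ = Real.exp (∑ p ∈ N.primesBelow.subtype Nat.Prime, -Real.log (1 - Real.exp (-s.re * w p))) := by
        rw [Real.exp_sum]
        refine Finset.prod_congr rfl fun p _ => ?_
        rw [Real.exp_neg, Real.exp_log (by linarith [hlt p])]
    _ ≤ _ := by
        apply Real.exp_le_exp.2
        refine Summable.sum_le_tsum (L := SummationFilter.unconditional Nat.Primes)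
          (f := fun p => -Real.log (1 - Real.exp (-s.re * w p))) _ (fun p _ => ?_) hlog.neg
        have := Real.log_nonpos (by linarith [hlt p] : 0 ≤ 1 - Real.exp (-s.re * w p))
          (by linarith [Real.exp_pos (-s.re * w p)])
        linarith

/-- The Euler product of a weighted semigroup of positive integers. -/
lemma hasSum_exp_logSize {w : Nat.Primes → ℝ} (hw : ∀ p, 0 < w p) {s : ℂ} (hs : 0 < s.re)
    (hsum : Summable fun p => Real.exp (-s.re * w p)) :
    HasSum (fun n : ℕ+ => Complex.exp (-s * logSize w n))
      (Complex.exp (∑' p, -Complex.log (1 - Complex.exp (-s * w p)))) := by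
  have hS := summable_norm_expLogSize hw hs hsum
  have h1 := EulerProduct.eulerProduct_completely_multiplicative_hasProd hS
  have hz : Summable fun p : Nat.Primes => -Complex.exp (-s * w p) := by
    refine Summable.neg (Summable.of_norm ?_)
    simpa [Complex.norm_exp] using hsum
  have hlog : Summable fun p : Nat.Primes => -Complex.log (1 - Complex.exp (-s * w p)) := by
    have := (Complex.summable_log_one_add_of_summable hz).neg
    simpa [sub_eq_add_neg] using this
  have h2 := hlog.hasSum.cexp
  have h3 : (∑' n, expLogSize w s n) =
      Complex.exp (∑' p, -Complex.log (1 - Complex.exp (-s * w p))) := by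
    have h1' : HasProd (fun p : Nat.Primes => (1 - expLogSize w s p)⁻¹) _ := h1
    have h2' : HasProd (fun p : Nat.Primes => (1 - expLogSize w s p)⁻¹)
        (Complex.exp (∑' p, -Complex.log (1 - Complex.exp (-s * w p)))) := by
      refine h2.congr_fun fun p => ?_
      rw [expLogSize_prime, Function.comp_apply, Complex.exp_neg, Complex.exp_log]
      intro h
      have h4 : ‖Complex.exp (-s * w p)‖ = 1 := by rw [← sub_eq_zero.1 h, norm_one]
      rw [Complex.norm_exp] at h4
      have : Real.exp (-s.re * w p) < 1 := by rw [Real.exp_lt_one_iff]; nlinarith [hw p]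
      simp at h4
      rcases h4 with h4 | h4
      · exact hs.ne' h4
      · exact (hw p).ne' h4
    exact h1'.unique h2'
  rw [← h3]
  have h4 : HasSum (expLogSize w s) (∑' n, expLogSize w s n) := hS.of_norm.hasSum
  have h5 := (Function.Injective.hasSum_iff (f := (expLogSize w s : ℕ → ℂ)) PNat.coe_injective (by
    intro n hn
    have : n = 0 := by
      by_contra h
      exact hn ⟨⟨n, Nat.pos_of_ne_zero h⟩, rfl⟩
    rw [this, map_zero])).2 h4
  convert! h5 using 2 with n
  exact (expLogSize_pnat w s n).symm

end BeurlingConstruction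

end

/-! ### Contour shifts and the inverse Laplace transform -/

section

open MeasureTheory Filter Topology Complex

namespace BeurlingConstruction

/-- A holomorphic function on a vertical strip that decays quadratically has the same integral
along both edges. -/
lemma integral_vertical_eq {H : ℂ → ℂ} {a b B : ℝ} (hab : a ≤ b)
    (hH : DifferentiableOn ℂ H {s | a ≤ s.re ∧ s.re ≤ b})
    (hB : ∀ s : ℂ, a ≤ s.re → s.re ≤ b → ‖H s‖ ≤ B * (1 + s.im ^ 2)⁻¹) :
    Integrable (fun t : ℝ => H (a + t * I)) ∧ Integrable (fun t : ℝ => H (b + t * I)) ∧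
      ∫ t : ℝ, H (a + t * I) = ∫ t : ℝ, H (b + t * I) := by
  have hint : ∀ c : ℝ, a ≤ c → c ≤ b → Integrable (fun t : ℝ => H (c + t * I)) := by
    intro c hac hcb
    refine (integrable_inv_one_add_sq.const_mul B).mono' ?_ ?_
    · have : Continuous fun t : ℝ => H (c + t * I) := by
        refine hH.continuousOn.comp_continuous (by fun_prop) fun t => ?_
        simp [hac, hcb]
      exact this.aestronglyMeasurable
    · refine Eventually.of_forall fun t => ?_
      have := hB (c + t * I) (by simpa using hac) (by simpa using hcb)
      simpa using this
  have ha := hint a le_rfl hab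
  have hb := hint b hab le_rfl
  refine ⟨ha, hb, ?_⟩
  have hrect : ∀ T : ℝ, I • (∫ y in (-T)..T, H (b + y * I)) - I • ∫ y in (-T)..T, H (a + y * I) =
      (∫ x in a..b, H (x + T * I)) - ∫ x in a..b, H (x + (-T : ℝ) * I) := by
    intro T
    have := Complex.integral_boundary_rect_eq_zero_of_differentiableOn H (a + (-T : ℝ) * I)
      (b + T * I) (hH.mono ?_)
    · simp only [add_re, ofReal_re, mul_re, I_re, mul_zero, ofReal_im, I_im, mul_one, sub_self,
        add_zero, add_im, mul_im, zero_add] at this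
      linear_combination this
    · intro s hs
      simp only [add_re, ofReal_re, mul_re, I_re, mul_zero, ofReal_im, I_im, mul_one, sub_self,
        add_zero, add_im, mul_im, zero_add] at hs
      have := hs.1
      rw [Set.mem_preimage, Set.uIcc_of_le hab] at this
      exact this
  have hB0 : 0 ≤ B := by
    have := (norm_nonneg _).trans (hB a (by simp) (by simpa using hab))
    simpa using this
  -- The sign `ε = ±1` treats the top and the bottom edge at once; the decay of `H` makes both
  -- vanish.
  have hhor : ∀ ε : ℝ, |ε| = 1 →
      Tendsto (fun T : ℝ => ∫ x in a..b, H (x + (ε * T : ℝ) * I)) atTop (𝓝 0) := by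
    intro ε hε
    have hε2 : ε ^ 2 = 1 := by rw [← sq_abs, hε, one_pow]
    have hlim : Tendsto (fun T : ℝ => B * (1 + T ^ 2)⁻¹ * |b - a|) atTop (𝓝 0) := by
      have h1 : Tendsto (fun T : ℝ => 1 + T ^ 2) atTop atTop :=
        tendsto_atTop_add_const_left _ _ (tendsto_pow_atTop (by norm_num))
      have := ((tendsto_inv_atTop_zero.comp h1).const_mul B).mul_const |b - a|
      simpa using this
    refine squeeze_zero_norm (fun T => ?_) hlim
    refine intervalIntegral.norm_integral_le_of_norm_le_const fun x hx => ?_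
    rw [Set.uIoc_of_le hab] at hx
    have := hB (x + (ε * T : ℝ) * I) (by simpa using hx.1.le) (by simpa using hx.2)
    simpa [mul_pow, hε2] using this
  have hL := ((intervalIntegral_tendsto_integral hb tendsto_neg_atTop_atBot tendsto_id).const_smul I).sub
    ((intervalIntegral_tendsto_integral ha tendsto_neg_atTop_atBot tendsto_id).const_smul I)
  have hR := (hhor 1 (by simp)).sub (hhor (-1) (by simp))
  have h0 := tendsto_nhds_unique hL (by
    refine hR.congr fun T => ?_
    have := (hrect T).symm
    simpa using this)
  rw [sub_zero, sub_eq_zero] at h0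
  simpa using h0.symm

lemma inv_sq_add_sq_le {d : ℝ} (hd : 0 < d) (t : ℝ) :
    (d ^ 2 + t ^ 2)⁻¹ ≤ (1 + (d ^ 2)⁻¹) * (1 + t ^ 2)⁻¹ := by
  have hp : 0 < d ^ 2 + t ^ 2 := by positivity
  rw [inv_eq_one_div, div_le_iff₀ hp, ← div_eq_mul_inv, div_mul_eq_mul_div,
    le_div_iff₀ (by positivity)]
  have : (d ^ 2)⁻¹ * d ^ 2 = 1 := inv_mul_cancel₀ (by positivity)
  have h4 : 0 ≤ (d ^ 2)⁻¹ := by positivity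
  nlinarith [sq_nonneg t, mul_nonneg h4 (sq_nonneg t), sq_nonneg d]

lemma norm_inv_sq_sub_sq_le {a : ℝ} (ha : 0 < a) {s : ℂ} (hs : 0 ≤ s.re) (hne : s.re ≠ a) :
    ‖(s ^ 2 - a ^ 2 : ℂ)⁻¹‖ ≤ ((s.re - a) ^ 2 + s.im ^ 2)⁻¹ := by
  have hp : 0 < (s.re - a) ^ 2 + s.im ^ 2 := by
    have := sub_ne_zero.2 hne
    positivity
  rw [norm_inv]
  refine inv_anti₀ hp ?_
  have e : s ^ 2 - (a : ℂ) ^ 2 = (s - a) * (s + a) := by ring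
  rw [e, norm_mul]
  have k1 : √((s.re - a) ^ 2 + s.im ^ 2) ≤ ‖s - a‖ := by
    apply Real.sqrt_le_iff.2 ⟨norm_nonneg _, ?_⟩
    rw [← Complex.normSq_eq_norm_sq, Complex.normSq_apply]
    simp; nlinarith
  have k2 : √((s.re - a) ^ 2 + s.im ^ 2) ≤ ‖s + a‖ := by
    apply Real.sqrt_le_iff.2 ⟨norm_nonneg _, ?_⟩
    rw [← Complex.normSq_eq_norm_sq, Complex.normSq_apply]
    simp; nlinarith
  calc (s.re - a) ^ 2 + s.im ^ 2 = √((s.re - a) ^ 2 + s.im ^ 2) * √((s.re - a) ^ 2 + s.im ^ 2) :=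
        (Real.mul_self_sqrt hp.le).symm
    _ ≤ _ := mul_le_mul k1 k2 (Real.sqrt_nonneg _) (norm_nonneg _)

/-- The line can be moved to the imaginary axis without meeting the pole `a`; there the integrand is
the real function `-(a ^ 2 + t ^ 2)⁻¹`. -/
lemma integral_inv_sq_sub_sq_of_lt {a σ : ℝ} (ha : 0 < a) (hσ : 0 ≤ σ) (hσa : σ < a) :
    ∫ t : ℝ, ((σ + t * I : ℂ) ^ 2 - a ^ 2)⁻¹ = -(Real.pi / a : ℝ) := by
  have hne : ∀ s : ℂ, 0 ≤ s.re → s.re ≤ σ → s ^ 2 - a ^ 2 ≠ 0 := by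
    intro s h0 h1 h
    have : (s - a) * (s + a) = 0 := by linear_combination h
    rcases mul_eq_zero.1 this with h2 | h2
    · have := congrArg Complex.re h2
      simp at this; linarith
    · have := congrArg Complex.re h2
      simp at this; linarith
  have hd : 0 < a - σ := by linarith
  obtain ⟨-, -, h⟩ := integral_vertical_eq (H := fun s => (s ^ 2 - a ^ 2)⁻¹)
    (B := 1 + ((a - σ) ^ 2)⁻¹) hσ
    (by
      refine DifferentiableOn.inv (by fun_prop) fun s hs => hne s hs.1 hs.2)
    (by
      intro s h0 h1
      refine (norm_inv_sq_sub_sq_le ha h0 (by linarith)).trans ?_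
      refine le_trans (inv_anti₀ (by positivity) ?_) (inv_sq_add_sq_le hd s.im)
      nlinarith)
  rw [← h]
  have h3 : ∀ t : ℝ, (((0 : ℝ) + t * I : ℂ) ^ 2 - a ^ 2)⁻¹ =
      ((-(a ^ 2)⁻¹ * (1 + (a⁻¹ * t) ^ 2)⁻¹ : ℝ) : ℂ) := by
    intro t
    have : (((0 : ℝ) + t * I : ℂ) ^ 2 - a ^ 2) = ((-(a ^ 2 * (1 + (a⁻¹ * t) ^ 2)) : ℝ) : ℂ) := by
      have ha' : (a : ℂ) ≠ 0 := by exact_mod_cast ha.ne'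
      push_cast
      field_simp
      rw [zero_add, mul_pow, I_sq]; ring
    rw [this, ← ofReal_inv]
    congr 1
    rw [inv_neg, mul_inv]; ring
  simp_rw [h3]
  rw [integral_complex_ofReal, integral_const_mul,
    Measure.integral_comp_mul_left (fun x => (1 + x ^ 2)⁻¹), integral_univ_inv_one_add_sq]
  rw [inv_inv, abs_of_pos ha, smul_eq_mul, ← ofReal_neg]
  congr 1
  field_simp

/-- No pole lies to the right of the line, so it can be pushed to infinity, where the integral is
`O((R - a)⁻¹)`. -/
lemma integral_inv_sq_sub_sq_of_gt {a σ : ℝ} (ha : 0 < a) (hσa : a < σ) :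
    ∫ t : ℝ, ((σ + t * I : ℂ) ^ 2 - a ^ 2)⁻¹ = 0 := by
  have key : ∀ R : ℝ, σ ≤ R → ∫ t : ℝ, ((σ + t * I : ℂ) ^ 2 - a ^ 2)⁻¹ =
      ∫ t : ℝ, ((R + t * I : ℂ) ^ 2 - a ^ 2)⁻¹ := by
    intro R hR
    have hd : 0 < σ - a := by linarith
    refine (integral_vertical_eq (H := fun s => (s ^ 2 - a ^ 2)⁻¹)
      (B := 1 + ((σ - a) ^ 2)⁻¹) hR ?_ ?_).2.2
    · refine DifferentiableOn.inv (by fun_prop) fun s hs h => ?_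
      have : (s - a) * (s + a) = 0 := by linear_combination h
      rcases mul_eq_zero.1 this with h2 | h2
      · have := congrArg Complex.re h2
        simp at this; linarith [hs.1]
      · have := congrArg Complex.re h2
        simp at this; linarith [hs.1]
    · intro s h0 h1
      refine (norm_inv_sq_sub_sq_le ha (by linarith) (by linarith)).trans ?_
      refine le_trans (inv_anti₀ (by positivity) ?_) (inv_sq_add_sq_le hd s.im)
      nlinarith
  have hbound : ∀ R : ℝ, σ ≤ R →
      ‖∫ t : ℝ, ((σ + t * I : ℂ) ^ 2 - a ^ 2)⁻¹‖ ≤ (R - a)⁻¹ * Real.pi := by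
    intro R hR
    have hd : 0 < R - a := by linarith
    rw [key R hR]
    have hi : Integrable fun t : ℝ => ((R - a) ^ 2)⁻¹ * (1 + ((R - a)⁻¹ * t) ^ 2)⁻¹ :=
      (integrable_inv_one_add_sq.comp_mul_left' (inv_ne_zero hd.ne')).const_mul _
    refine (norm_integral_le_of_norm_le hi (Eventually.of_forall fun t => ?_)).trans ?_
    · refine (norm_inv_sq_sub_sq_le ha (by simp; linarith) (by simp; linarith)).trans (le_of_eq ?_)
      simp only [add_re, ofReal_re, mul_re, I_re, mul_zero, ofReal_im, I_im, mul_one, sub_self,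
        add_zero, add_im, mul_im, zero_add]
      rw [← mul_inv]
      congr 1
      field_simp
    · rw [integral_const_mul,
        Measure.integral_comp_mul_left (fun x => (1 + x ^ 2)⁻¹), integral_univ_inv_one_add_sq,
        inv_inv, abs_of_pos hd, smul_eq_mul]
      refine le_of_eq ?_
      field_simp
  have hlim : Tendsto (fun R : ℝ => (R - a)⁻¹ * Real.pi) atTop (𝓝 0) := by
    have h1 : Tendsto (fun R : ℝ => R - a) atTop atTop := tendsto_atTop_add_const_right _ _ tendsto_id
    have := (tendsto_inv_atTop_zero.comp h1).mul_const Real.pi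
    simpa using this
  rw [← norm_le_zero_iff]
  exact ge_of_tendsto hlim ((eventually_ge_atTop σ).mono fun R hR => hbound R hR)

/-- The residue theorem for a bounded function divided by `(s - 1) (s - r)`, on a strip. -/
lemma integral_div_sub_integral_div {P : ℂ → ℂ} {c σ r B : ℝ} (hc : c < σ) (hσ : 0 < σ)
    (hσr : σ < r) (hr : r < 1) (hP : DifferentiableOn ℂ P {s | c < s.re})
    (hB : ∀ s : ℂ, σ ≤ s.re → s.re ≤ 2 → ‖P s‖ ≤ B) :
    (∫ t : ℝ, P (2 + t * I) / ((2 + t * I - 1) * (2 + t * I - r))) =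
      (∫ t : ℝ, P (σ + t * I) / ((σ + t * I - 1) * (σ + t * I - r))) +
        2 * Real.pi * ((P 1 - P r) / (1 - r)) := by
  have hr0 : 0 < r := hσ.trans hσr
  have hB0 : 0 ≤ B := (norm_nonneg _).trans (hB 2 (by simp; linarith) (by simp))
  have hr1 : (1 - r : ℂ) ≠ 0 := by
    intro h
    have := congrArg Complex.re h
    simp at this; linarith
  have hre : ∀ s : ℂ, 0 < s.re → ∀ x : ℝ, 0 < x → s + x ≠ 0 := by
    intro s hs x hx h
    have := congrArg Complex.re h
    simp at this; linarith
  -- The subtracted terms interpolate `P` at `1` and `r`. Divided by `(s - 1) (s - r)` they become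
  -- multiples of `1 / (s ^ 2 - 1)` and `1 / (s ^ 2 - r ^ 2)`, which decay quadratically and have
  -- known line integrals; these carry both residues.
  set P₀ : ℂ → ℂ := fun s => P s - P 1 * ((s - r) / (1 - r) * (2 / (s + 1))) -
    P r * ((s - 1) / (r - 1) * (2 * r / (s + r))) with hP₀
  set c' := max c 0
  have hc' : c' < σ := max_lt hc hσ
  have hopen : IsOpen {s : ℂ | c' < s.re} := isOpen_lt continuous_const Complex.continuous_re
  have hP₀d : DifferentiableOn ℂ P₀ {s | c' < s.re} := by
    have hs0 : ∀ s ∈ {s : ℂ | c' < s.re}, 0 < s.re := fun s hs =>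
      (le_max_right c 0).trans_lt hs
    refine ((hP.mono fun s hs => (le_max_left c 0).trans_lt hs).sub ?_).sub ?_
    · refine DifferentiableOn.const_mul (DifferentiableOn.mul (by fun_prop) ?_) _
      refine DifferentiableOn.div (by fun_prop) (by fun_prop) fun s hs => ?_
      exact_mod_cast hre s (hs0 s hs) 1 one_pos
    · refine DifferentiableOn.const_mul (DifferentiableOn.mul (by fun_prop) ?_) _
      refine DifferentiableOn.div (by fun_prop) (by fun_prop) fun s hs => ?_
      exact hre s (hs0 s hs) r hr0
  have hP₀1 : P₀ 1 = 0 := by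
    simp only [hP₀]
    field_simp
    norm_num
  have hP₀r : P₀ r = 0 := by
    have h1 : (r : ℂ) - 1 ≠ 0 := by rw [← neg_sub]; exact neg_ne_zero.2 hr1
    have h2 : (r : ℂ) ≠ 0 := by exact_mod_cast hr0.ne'
    have h3 : (r : ℂ) + r ≠ 0 := by rw [← two_mul]; exact mul_ne_zero two_ne_zero h2
    simp only [hP₀, sub_self, zero_div, zero_mul, mul_zero, sub_zero]
    rw [div_self h1, ← two_mul, div_self (mul_ne_zero two_ne_zero h2)]
    ring
  -- The quotient `P₀ / ((s - 1) (s - r))` with its two removable singularities filled in.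
  set H : ℂ → ℂ := dslope (dslope P₀ 1) r with hH
  have h1mem : {s : ℂ | c' < s.re} ∈ 𝓝 (1 : ℂ) := hopen.mem_nhds (by
    change c' < (1 : ℂ).re
    simp; linarith)
  have hrmem : {s : ℂ | c' < s.re} ∈ 𝓝 (r : ℂ) := hopen.mem_nhds (by
    change c' < (r : ℂ).re
    simp; linarith)
  have hHd : DifferentiableOn ℂ H {s | c' < s.re} :=
    (Complex.differentiableOn_dslope hrmem).2 ((Complex.differentiableOn_dslope h1mem).2 hP₀d)
  have hr1' : (r : ℂ) ≠ 1 := fun h => hr1 (by rw [h, sub_self])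
  have hHeq : ∀ s : ℂ, s ≠ 1 → s ≠ r → H s = P₀ s / ((s - 1) * (s - r)) := by
    intro s hs1 hsr
    rw [hH, dslope_of_ne _ hsr, slope_def_field, dslope_of_ne _ hs1, dslope_of_ne _ hr1',
      slope_def_field, slope_def_field, hP₀1, hP₀r]
    rw [sub_zero, sub_zero, zero_div, sub_zero, div_div]
  obtain ⟨B₀, hB₀⟩ : ∃ B₀ : ℝ, ∀ s : ℂ, σ ≤ s.re → s.re ≤ 2 → ‖P₀ s‖ ≤ B₀ := by
    have hq : ∀ (s : ℂ) (x y : ℝ), σ ≤ s.re → 0 < x → ‖(s - y) * (1 / (s + x))‖ ≤ 1 + (x + |y|) / σ := by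
      intro s x y hs hx
      have hne := hre s (by linarith) x hx
      have e : (s - y) * (1 / (s + x)) = 1 - (x + y) / (s + x) := by
        field_simp; ring
      rw [e]
      refine (norm_sub_le _ _).trans ?_
      rw [norm_one, norm_div]
      have h1 : σ ≤ ‖s + x‖ := by
        refine le_trans ?_ (Complex.re_le_norm _)
        simp; linarith
      have h2 : ‖(x + y : ℂ)‖ ≤ x + |y| := by
        refine (norm_add_le _ _).trans ?_
        simp [abs_of_pos hx]
      gcongr
    refine ⟨B + ‖P 1‖ * (‖(2 / (1 - r) : ℂ)‖ * (1 + (1 + |r|) / σ)) +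
      ‖P r‖ * (‖(2 * r / (r - 1) : ℂ)‖ * (1 + (r + |1|) / σ)), fun s h1 h2 => ?_⟩
    have e : P₀ s = P s - P 1 * (2 / (1 - r) * ((s - r) * (1 / (s + (1 : ℝ))))) -
        P r * (2 * r / (r - 1) * ((s - (1 : ℝ)) * (1 / (s + r)))) := by
      simp only [hP₀]; push_cast; ring
    rw [e]
    refine (norm_sub_le _ _).trans (add_le_add ((norm_sub_le _ _).trans (add_le_add (hB s h1 h2) ?_)) ?_)
    · rw [norm_mul, norm_mul]
      gcongr
      exact hq s 1 r h1 one_pos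
    · rw [norm_mul, norm_mul]
      gcongr
      exact hq s r 1 h1 hr0
  -- Compactness bounds `H` for `|Im s| ≤ 1`; elsewhere the denominator is at least `(Im s) ^ 2`.
  obtain ⟨B₁, hB₁⟩ : ∃ B₁ : ℝ, ∀ s : ℂ, σ ≤ s.re → s.re ≤ 2 → ‖H s‖ ≤ B₁ * (1 + s.im ^ 2)⁻¹ := by
    have hcomp : IsCompact {s : ℂ | (σ ≤ s.re ∧ s.re ≤ 2) ∧ (-1 ≤ s.im ∧ s.im ≤ 1)} := by
      have := (isCompact_Icc (a := σ) (b := 2)).reProdIm (isCompact_Icc (a := (-1 : ℝ)) (b := 1))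
      exact this
    obtain ⟨B₂, hB₂⟩ := hcomp.exists_bound_of_continuousOn (f := H)
      (hHd.continuousOn.mono fun s hs => hc'.trans_le hs.1.1)
    have hB₀0 : 0 ≤ B₀ := (norm_nonneg _).trans (hB₀ 2 (by simp; linarith) (by simp))
    have hB₂0 : 0 ≤ B₂ := (norm_nonneg _).trans (hB₂ 1 (by simp; linarith))
    refine ⟨2 * B₂ + 2 * B₀, fun s h1 h2 => ?_⟩
    rw [← div_eq_mul_inv, le_div_iff₀ (by positivity)]
    by_cases h : |s.im| ≤ 1
    · have := hB₂ s ⟨⟨h1, h2⟩, abs_le.1 h⟩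
      have h3 : s.im ^ 2 ≤ 1 := by rw [← sq_abs]; nlinarith [abs_nonneg s.im]
      have h4 : ‖H s‖ * (1 + s.im ^ 2) ≤ B₂ * 2 := by gcongr; linarith
      linarith
    · push Not at h
      have him : s.im ≠ 0 := by intro h0; rw [h0] at h; simp at h; linarith
      rw [hHeq s (by rintro rfl; simp at him) (by rintro rfl; simp at him), norm_div, norm_mul]
      have h3 : |s.im| ≤ ‖s - 1‖ := by simpa using Complex.abs_im_le_norm (s - 1)
      have h4 : |s.im| ≤ ‖s - r‖ := by simpa using Complex.abs_im_le_norm (s - r)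
      have h5 : s.im ^ 2 ≤ ‖s - 1‖ * ‖s - r‖ := by
        rw [← sq_abs, sq]; gcongr
      have h6 : 1 < s.im ^ 2 := by rw [← sq_abs]; nlinarith
      rw [div_mul_eq_mul_div, div_le_iff₀ (by linarith)]
      calc ‖P₀ s‖ * (1 + s.im ^ 2) ≤ B₀ * (2 * s.im ^ 2) := by
            gcongr
            · exact hB₀ s h1 h2
            · linarith
        _ ≤ (2 * B₂ + 2 * B₀) * s.im ^ 2 := by nlinarith
        _ ≤ _ := by gcongr
  obtain ⟨hiσ, hi2, heq⟩ := integral_vertical_eq (H := H) (by linarith : σ ≤ 2)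
    (hHd.mono fun s hs => hc'.trans_le hs.1) hB₁
  have hinv : ∀ (a ρ : ℝ), 0 < a → 0 < ρ → a ≠ ρ →
      Integrable fun t : ℝ => ((ρ + t * I : ℂ) ^ 2 - a ^ 2)⁻¹ := by
    intro a ρ ha hρ hne
    have hd : 0 < |ρ - a| := abs_pos.2 (sub_ne_zero.2 hne.symm)
    have hb : ∀ t : ℝ, ‖((ρ + t * I : ℂ) ^ 2 - a ^ 2)⁻¹‖ ≤
        (1 + (|ρ - a| ^ 2)⁻¹) * (1 + t ^ 2)⁻¹ := by
      intro t
      refine le_trans ?_ (inv_sq_add_sq_le hd t)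
      have := norm_inv_sq_sub_sq_le ha (s := ρ + t * I) (by simpa using hρ.le)
        (by simpa using hne.symm)
      simpa using this
    refine (integrable_inv_one_add_sq.const_mul _).mono' ?_ (Eventually.of_forall hb)
    exact (Measurable.inv (by fun_prop)).aestronglyMeasurable
  have hdecomp : ∀ ρ : ℝ, σ ≤ ρ → ρ ≠ 1 → ρ ≠ r →
      Integrable (fun t : ℝ => H (ρ + t * I)) →
      (∫ t : ℝ, P (ρ + t * I) / ((ρ + t * I - 1) * (ρ + t * I - r))) =
      (∫ t : ℝ, H (ρ + t * I)) +
        (P 1 * (2 / (1 - r))) * (∫ t : ℝ, ((ρ + t * I : ℂ) ^ 2 - (1 : ℝ) ^ 2)⁻¹) +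
        (P r * (2 * r / (r - 1))) * (∫ t : ℝ, ((ρ + t * I : ℂ) ^ 2 - r ^ 2)⁻¹) := by
    intro ρ hρ hρ1 hρr hi
    have hρ0 : 0 < ρ := by linarith
    have i1 := (hinv 1 ρ one_pos hρ0 hρ1.symm).const_mul (P 1 * (2 / (1 - r)))
    have i2 := (hinv r ρ hr0 hρ0 hρr.symm).const_mul (P r * (2 * r / (r - 1)))
    have i3 : Integrable fun t : ℝ => H (ρ + t * I) +
        P 1 * (2 / (1 - r)) * ((ρ + t * I : ℂ) ^ 2 - (1 : ℝ) ^ 2)⁻¹ := hi.add i1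
    rw [← integral_const_mul, ← integral_const_mul, ← integral_add hi i1, ← integral_add i3 i2]
    refine integral_congr_ae (Eventually.of_forall fun t => ?_)
    have n1 : (ρ + t * I : ℂ) - 1 ≠ 0 := by
      intro h
      have := congrArg Complex.re h
      simp at this; exact hρ1 (by linarith)
    have n2 : (ρ + t * I : ℂ) - r ≠ 0 := by
      intro h
      have := congrArg Complex.re h
      simp at this; exact hρr (by linarith)
    have n3 := hre (ρ + t * I) (by simpa using hρ0) 1 one_pos
    have n4 := hre (ρ + t * I) (by simpa using hρ0) r hr0
    dsimp only
    rw [hHeq _ (sub_ne_zero.1 n1) (sub_ne_zero.1 n2)]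
    simp only [hP₀]
    have e1 : (ρ + t * I : ℂ) ^ 2 - (1 : ℝ) ^ 2 = (ρ + t * I - 1) * (ρ + t * I + (1 : ℝ)) := by
      push_cast; ring
    have e2 : (ρ + t * I : ℂ) ^ 2 - r ^ 2 = (ρ + t * I - r) * (ρ + t * I + r) := by ring
    rw [e1, e2]
    have n5 : (r : ℂ) - 1 ≠ 0 := sub_ne_zero.2 hr1'
    push_cast at n3 ⊢
    generalize (ρ + t * I : ℂ) = s at *
    field_simp
    ring
  have d2 := hdecomp 2 (by linarith) (by norm_num) (by linarith) hi2
  have dσ := hdecomp σ le_rfl (by linarith) (by linarith) hiσ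
  rw [integral_inv_sq_sub_sq_of_gt one_pos (by norm_num : (1 : ℝ) < 2),
    integral_inv_sq_sub_sq_of_gt hr0 (by linarith : r < 2)] at d2
  rw [integral_inv_sq_sub_sq_of_lt one_pos hσ.le (by linarith : σ < 1),
    integral_inv_sq_sub_sq_of_lt hr0 hσ.le hσr, heq] at dσ
  push_cast at d2 dσ
  rw [d2, dσ]
  have n5 : (r : ℂ) - 1 ≠ 0 := sub_ne_zero.2 hr1'
  have n6 : (r : ℂ) ≠ 0 := by exact_mod_cast hr0.ne'
  have e3 : (r : ℂ) - 1 = -(1 - r) := by ring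
  rw [e3]
  generalize (∫ t : ℝ, H (2 + t * I)) = Y
  field_simp
  ring

lemma integral_mul_exp_neg {z : ℂ} (hz : 0 < z.re) :
    IntegrableOn (fun t : ℝ => (t : ℂ) * exp (-z * t)) (Set.Ioi 0) ∧
      ∫ t in Set.Ioi (0 : ℝ), (t : ℂ) * exp (-z * t) = (z ^ 2)⁻¹ := by
  have hz0 : z ≠ 0 := by rintro rfl; simp at hz
  have hderiv : ∀ t : ℝ, HasDerivAt (fun t : ℝ => -((t : ℂ) / z + (z ^ 2)⁻¹) * exp (-z * t))
      ((t : ℂ) * exp (-z * t)) t := by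
    intro t
    have h1 : HasDerivAt (fun t : ℝ => (t : ℂ)) 1 t := Complex.ofRealCLM.hasDerivAt
    have h2 := (((h1.div_const z).add_const (z ^ 2)⁻¹).neg).mul ((h1.const_mul (-z)).cexp)
    refine h2.congr_deriv ?_
    simp only [Pi.neg_apply]
    field_simp
    ring
  have hlimr : Tendsto (fun t : ℝ => t * Real.exp (-z.re * t)) atTop (𝓝 0) := by
    have := Real.tendsto_pow_mul_exp_neg_atTop_nhds_zero 1
    have h2 := (this.comp (tendsto_id.const_mul_atTop hz)).const_mul z.re⁻¹
    rw [mul_zero] at h2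
    refine h2.congr fun t => ?_
    simp only [Function.comp, id, pow_one]
    field_simp
  have hexpr : Tendsto (fun t : ℝ => Real.exp (-z.re * t)) atTop (𝓝 0) := by
    refine Real.tendsto_exp_atBot.comp ?_
    exact tendsto_id.const_mul_atTop_of_neg (by linarith)
  have hlim : Tendsto (fun t : ℝ => -((t : ℂ) / z + (z ^ 2)⁻¹) * exp (-z * t)) atTop (𝓝 0) := by
    have h3 := (hlimr.const_mul ‖z‖⁻¹).add (hexpr.const_mul ‖(z ^ 2)⁻¹‖)
    simp only [mul_zero, add_zero] at h3
    refine squeeze_zero_norm' ((eventually_ge_atTop 0).mono fun t ht => ?_) h3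
    rw [norm_mul, norm_neg, Complex.norm_exp]
    have : (-z * t).re = -z.re * t := by simp
    rw [this]
    calc _ ≤ (‖(t : ℂ) / z‖ + ‖(z ^ 2)⁻¹‖) * Real.exp (-z.re * t) := by
          gcongr; exact norm_add_le _ _
      _ = _ := by
          rw [norm_div, Complex.norm_real, Real.norm_of_nonneg ht]; ring
  have hint : IntegrableOn (fun t : ℝ => (t : ℂ) * exp (-z * t)) (Set.Ioi 0) := by
    have hr : IntegrableOn (fun t : ℝ => t * Real.exp (-z.re * t)) (Set.Ioi 0) := by
      have := Real.GammaIntegral_convergent (s := 2) (by norm_num)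
      have h2 := (integrableOn_Ioi_comp_mul_left_iff
        (fun x => Real.exp (-x) * x ^ ((2 : ℝ) - 1)) 0 hz).2 (by simpa using this)
      refine IntegrableOn.congr_fun (h2.const_mul z.re⁻¹) (fun t _ => ?_) measurableSet_Ioi
      have e : (2 : ℝ) - 1 = 1 := by norm_num
      simp only [e, Real.rpow_one]
      field_simp
    refine Integrable.mono' hr ?_ ?_
    · exact (by fun_prop : Continuous fun t : ℝ => (t : ℂ) * exp (-z * t)).aestronglyMeasurable
    · refine (ae_restrict_mem measurableSet_Ioi).mono fun t ht => ?_
      rw [norm_mul, Complex.norm_exp, Complex.norm_real, Real.norm_of_nonneg (le_of_lt ht)]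
      simp
  refine ⟨hint, ?_⟩
  rw [integral_Ioi_of_hasDerivAt_of_tendsto (hderiv 0).continuousAt.continuousWithinAt
    (fun t _ => hderiv t) hint hlim]
  simp

open FourierTransform in
/-- The inverse Laplace transform of `1 / s ^ 2`. -/
lemma integral_exp_div_sq (y : ℝ) :
    Integrable (fun t : ℝ => exp ((2 + t * I) * y) / (2 + t * I) ^ 2) ∧
      ∫ t : ℝ, exp ((2 + t * I) * y) / (2 + t * I) ^ 2 = ((2 * Real.pi * max y 0 : ℝ) : ℂ) := by
  -- The Fourier transform of `φ` is `u ↦ (2 + 2 π i u) ^ (-2)`, so the claim is Fourier inversion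
  -- for `φ` after rescaling `t = 2 π u`.
  set φ : ℝ → ℂ := fun v => (max v 0 : ℝ) * exp (-2 * v) with hφ
  have hφc : Continuous φ := by fun_prop
  have hφ_ind : ∀ (g : ℝ → ℂ), (fun v => g v * φ v) =
      Set.indicator (Set.Ioi 0) fun v => g v * ((v : ℂ) * exp (-2 * v)) := by
    intro g
    funext v
    by_cases hv : 0 < v
    · rw [Set.indicator_of_mem (Set.mem_Ioi.2 hv)]
      simp [hφ, max_eq_left hv.le]
    · rw [Set.indicator_of_notMem (by simpa using hv)]
      simp [hφ, max_eq_right (not_lt.1 hv)]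
  have hφi : Integrable φ := by
    have h1 := hφ_ind fun _ => 1
    simp only [one_mul] at h1
    change Integrable (fun v => φ v)
    rw [h1, integrable_indicator_iff measurableSet_Ioi]
    exact (integral_mul_exp_neg (z := 2) (by simp)).1
  have hF : 𝓕 φ = fun u : ℝ => ((2 + (2 * Real.pi * u : ℝ) * I) ^ 2)⁻¹ := by
    funext u
    rw [Real.fourier_real_eq_integral_exp_smul]
    simp only [smul_eq_mul]
    rw [hφ_ind, integral_indicator measurableSet_Ioi,
      ← (integral_mul_exp_neg (z := 2 + (2 * Real.pi * u : ℝ) * I) (by simp)).2]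
    refine integral_congr_ae (Eventually.of_forall fun v => ?_)
    dsimp only
    rw [mul_left_comm, ← exp_add]
    congr 2
    push_cast
    ring
  have hbase : Integrable fun t : ℝ => ((2 + t * I : ℂ) ^ 2)⁻¹ := by
    refine integrable_inv_one_add_sq.mono' ?_ (Eventually.of_forall fun t => ?_)
    · exact (Measurable.inv (by fun_prop)).aestronglyMeasurable
    · rw [norm_inv, norm_pow, ← Complex.normSq_eq_norm_sq, Complex.normSq_apply]
      refine inv_anti₀ (by positivity) ?_
      simp
      nlinarith
  have hFi : Integrable (𝓕 φ) := by
    rw [hF]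
    exact hbase.comp_mul_left' (by positivity : 2 * Real.pi ≠ 0)
  have hinv := congrFun (hφc.fourierInv_fourier_eq hφi hFi) y
  rw [Real.fourierInv_eq', hF] at hinv
  have hsc : (∫ t : ℝ, exp (t * I * y) * ((2 + t * I) ^ 2)⁻¹) = 2 * Real.pi * φ y := by
    have h := Measure.integral_comp_mul_left
      (fun t : ℝ => exp (t * I * y) * ((2 + t * I) ^ 2)⁻¹) (2 * Real.pi)
    rw [abs_of_pos (by positivity)] at h
    have h2 : (∫ u : ℝ, exp ((2 * Real.pi * u : ℝ) * I * y) *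
        ((2 + (2 * Real.pi * u : ℝ) * I) ^ 2)⁻¹) = φ y := by
      rw [← hinv]
      refine integral_congr_ae (Eventually.of_forall fun v => ?_)
      simp only [smul_eq_mul]
      congr 2
      simp
      ring
    rw [h2] at h
    rw [h]
    generalize (∫ t : ℝ, exp (t * I * y) * ((2 + t * I) ^ 2)⁻¹) = Y
    simp only [real_smul]
    push_cast
    have : (Real.pi : ℂ) ≠ 0 := by exact_mod_cast Real.pi_ne_zero
    field_simp
  have hfun : (fun t : ℝ => exp ((2 + t * I) * y) / (2 + t * I) ^ 2) =
      fun t : ℝ => exp (2 * y) * (exp (t * I * y) * ((2 + t * I) ^ 2)⁻¹) := by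
    funext t
    rw [add_mul, exp_add]
    ring
  rw [hfun]
  constructor
  · refine Integrable.const_mul ?_ _
    refine hbase.norm.mono' (by fun_prop) (Eventually.of_forall fun t => ?_)
    rw [norm_mul, Complex.norm_exp]
    simp
  · rw [integral_const_mul, hsc, hφ]
    dsimp only
    push_cast
    have : exp (2 * y) * exp (-2 * y) = 1 := by rw [← exp_add]; simp
    linear_combination 2 * Real.pi * ((max y 0 : ℝ) : ℂ) * this

end BeurlingConstruction

end

/-! ### Unit partitions of a density and convergence of the local factors -/

section

open MeasureTheory Filter Topology Complex

namespace BeurlingConstruction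

/-- The (truncated) Laplace transform of an integrable function is entire. -/
lemma differentiable_integral_exp_mul {g : ℝ → ℂ} {a b : ℝ} (hg : IntervalIntegrable g volume a b) :
    Differentiable ℂ fun s : ℂ => ∫ τ in a..b, exp (-s * τ) * g τ := by
  intro s₀
  have hexp : ∀ s : ℂ, Continuous fun τ : ℝ => exp (-s * τ) := fun s => by fun_prop
  have hmeas : ∀ s : ℂ, AEStronglyMeasurable (fun τ : ℝ => exp (-s * τ) * g τ)
      (volume.restrict (Set.uIoc a b)) := fun s =>
    (hexp s).aestronglyMeasurable.mul hg.def'.aestronglyMeasurable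
  set M := max |a| |b|
  have hM : ∀ τ ∈ Set.uIoc a b, |τ| ≤ M := by
    intro τ hτ
    rcases Set.mem_uIoc.1 hτ with h | h
    · exact abs_le_max_abs_abs h.1.le h.2
    · rw [show M = max |b| |a| from max_comm _ _]
      exact abs_le_max_abs_abs h.1.le h.2
  have := intervalIntegral.hasDerivAt_integral_of_dominated_loc_of_deriv_le (𝕜 := ℂ) (μ := volume)
    (a := a) (b := b) (F := fun s τ => exp (-s * τ) * g τ)
    (F' := fun s τ => (-τ : ℂ) * (exp (-s * τ) * g τ)) (x₀ := s₀)
    (bound := fun τ => M * Real.exp ((‖s₀‖ + 1) * M) * ‖g τ‖)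
    (Metric.ball_mem_nhds s₀ one_pos)
    (Eventually.of_forall hmeas)
    (by
      exact hg.continuousOn_mul (hexp s₀).continuousOn)
    ((by fun_prop : Continuous fun τ : ℝ => (-τ : ℂ)).aestronglyMeasurable.mul (hmeas s₀))
    (by
      refine Eventually.of_forall fun τ hτ s hs => ?_
      rw [norm_mul, norm_mul, norm_neg, Complex.norm_real, Complex.norm_exp, ← mul_assoc]
      gcongr
      · exact hM τ hτ
      · have h1 : ‖s‖ ≤ ‖s₀‖ + 1 := by
          have := norm_le_norm_add_norm_sub' s s₀
          have h2 : ‖s - s₀‖ < 1 := by simpa [dist_eq_norm] using hs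
          linarith
        have h3 : (-s * (τ : ℂ)).re ≤ ‖-s * (τ : ℂ)‖ := Complex.re_le_norm _
        rw [norm_mul, norm_neg, Complex.norm_real] at h3
        refine h3.trans ?_
        gcongr
        exact hM τ hτ)
    (hg.norm.const_mul _)
    (by
      refine Eventually.of_forall fun τ _ s _ => ?_
      have h1 : HasDerivAt (fun s : ℂ => -s * τ) (-τ : ℂ) s := by
        simpa using (hasDerivAt_id s).neg.mul_const (τ : ℂ)
      refine (h1.cexp.mul_const (g τ)).congr_deriv ?_
      ring)
  exact this.2.differentiableAt

/-- A density `q` on `[y 0, ∞)` of growth at most `C exp τ`, cut by `y` into intervals of mass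
one. -/
structure UnitPartition (q : ℝ → ℝ) (y : ℕ → ℝ) (C : ℝ) : Prop where
  two_le : 2 ≤ y 0
  strictMono : StrictMono y
  measurable : Measurable q
  continuousOn : ContinuousOn q (Set.Ici (y 0))
  nonneg : ∀ τ, y 0 ≤ τ → 0 ≤ q τ
  le_exp : ∀ τ, y 0 ≤ τ → q τ ≤ C * Real.exp τ
  integral_eq_one : ∀ j, ∫ τ in (y j)..(y (j + 1)), q τ = 1

/-- The Laplace transform of `q` on the `j`-th interval. -/
noncomputable def block (q : ℝ → ℝ) (y : ℕ → ℝ) (j : ℕ) (s : ℂ) : ℂ :=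
  ∫ τ in (y j)..(y (j + 1)), exp (-s * τ) * q τ

/-- The logarithm of the local factor comparing a prime of logarithmic size `l` with the `j`-th
interval of the density `q`. -/
noncomputable def localLog (q : ℝ → ℝ) (y : ℕ → ℝ) (j : ℕ) (l : ℝ) (s : ℂ) : ℂ :=
  -log (1 - exp (-s * l)) - block q y j s

lemma norm_exp_neg_mul (s : ℂ) (l : ℝ) : ‖exp (-s * l)‖ = Real.exp (-s.re * l) := by
  rw [Complex.norm_exp]; simp

/-- The difference is `s` times an integral of `exp (-s * u)` between the two points. Bounding it by
the integral over all of `[a, b]` lets the bounds for consecutive intervals add up to a convergent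
integral, whatever the lengths of the intervals. -/
lemma norm_exp_sub_exp_le (s : ℂ) {a b l τ : ℝ} (hl : l ∈ Set.Icc a b)
    (hτ : τ ∈ Set.Icc a b) :
    ‖exp (-s * l) - exp (-s * τ)‖ ≤ ‖s‖ * ∫ u in a..b, Real.exp (-s.re * u) := by
  wlog h : l ≤ τ generalizing l τ
  · rw [norm_sub_rev]
    exact this hτ hl (le_of_not_ge h)
  rcases eq_or_ne s 0 with rfl | hs
  · simp
  have h1 : exp (-s * l) - exp (-s * τ) = s * ∫ u in l..τ, exp (-s * u) := by
    rw [integral_exp_mul_complex (neg_ne_zero.2 hs)]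
    field_simp
    ring
  rw [h1, norm_mul]
  gcongr
  have hc : Continuous fun u : ℝ => Real.exp (-s.re * u) := by fun_prop
  calc ‖∫ u in l..τ, exp (-s * u)‖ ≤ ∫ u in l..τ, Real.exp (-s.re * u) := by
        refine intervalIntegral.norm_integral_le_of_norm_le h ?_ (hc.intervalIntegrable _ _)
        exact Eventually.of_forall fun u _ => (norm_exp_neg_mul s u).le
    _ ≤ ∫ u in a..b, Real.exp (-s.re * u) := by
        refine intervalIntegral.integral_mono_interval hl.1 h hτ.2 ?_ (hc.intervalIntegrable _ _)
        exact Eventually.of_forall fun u => (Real.exp_pos _).le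

namespace UnitPartition

variable {q : ℝ → ℝ} {y : ℕ → ℝ} {C : ℝ} (hq : UnitPartition q y C)

include hq

lemma y_zero_le (j : ℕ) : y 0 ≤ y j := hq.strictMono.monotone (Nat.zero_le j)

lemma y_le_succ (j : ℕ) : y j ≤ y (j + 1) := hq.strictMono.monotone (Nat.le_succ j)

lemma intervalIntegrable {a b : ℝ} (ha : y 0 ≤ a) (hb : y 0 ≤ b) :
    IntervalIntegrable q volume a b := by
  refine (hq.continuousOn.mono fun τ hτ => ?_).intervalIntegrable
  exact (le_min ha hb).trans hτ.1

lemma intervalIntegrable_block (j : ℕ) : IntervalIntegrable q volume (y j) (y (j + 1)) :=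
  hq.intervalIntegrable (hq.y_zero_le j) (hq.y_zero_le _)

lemma intervalIntegrable_block_complex (j : ℕ) :
    IntervalIntegrable (fun τ => (q τ : ℂ)) volume (y j) (y (j + 1)) :=
  ⟨(hq.intervalIntegrable_block j).1.ofReal, (hq.intervalIntegrable_block j).2.ofReal⟩

lemma differentiable_block (j : ℕ) : Differentiable ℂ (block q y j) :=
  differentiable_integral_exp_mul (hq.intervalIntegrable_block_complex j)

/-- Each interval has mass one and `q ≤ C exp`, so `C exp (y j)` grows by at least one at every
step. -/
lemma exp_y_ge (j : ℕ) : (j : ℝ) ≤ C * Real.exp (y j) := by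
  have hC : 0 ≤ C := by
    have := (hq.nonneg _ le_rfl).trans (hq.le_exp _ le_rfl)
    exact nonneg_of_mul_nonneg_left this (Real.exp_pos _)
  have h1 : ∀ j, 1 ≤ C * Real.exp (y (j + 1)) - C * Real.exp (y j) := by
    intro j
    have := intervalIntegral.integral_mono_on (hq.y_le_succ j) (hq.intervalIntegrable_block j)
      ((by fun_prop : Continuous fun τ => C * Real.exp τ).intervalIntegrable _ _)
      (fun τ hτ => hq.le_exp τ ((hq.y_zero_le j).trans hτ.1))
    rw [hq.integral_eq_one, intervalIntegral.integral_const_mul, integral_exp, mul_sub] at this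
    exact this
  induction j with
  | zero => simp; positivity
  | succ j ih =>
    have := h1 j
    push_cast
    linarith

lemma C_pos : 0 < C := by
  have := hq.exp_y_ge 1
  by_contra h
  have : C * Real.exp (y 1) ≤ 0 := mul_nonpos_of_nonpos_of_nonneg (not_lt.1 h) (Real.exp_pos _).le
  simp at *
  linarith

lemma summable_exp {a : ℝ} (ha : 1 < a) : Summable fun j => Real.exp (-a * y j) := by
  have hC := hq.C_pos
  have h1 := (Real.summable_nat_rpow_inv.2 ha).mul_left (C ^ a)
  refine (summable_nat_add_iff 1).1 ?_
  refine Summable.of_nonneg_of_le (fun _ => (Real.exp_pos _).le) (fun j => ?_)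
    ((summable_nat_add_iff 1).2 h1)
  have h2 := hq.exp_y_ge (j + 1)
  have hj : (0 : ℝ) < ((j + 1 : ℕ) : ℝ) := by positivity
  have h3 : ((j + 1 : ℕ) : ℝ) ^ a ≤ C ^ a * Real.exp (a * y (j + 1)) := by
    calc ((j + 1 : ℕ) : ℝ) ^ a ≤ (C * Real.exp (y (j + 1))) ^ a :=
          Real.rpow_le_rpow hj.le h2 (by linarith)
      _ = C ^ a * Real.exp (a * y (j + 1)) := by
          rw [Real.mul_rpow hC.le (Real.exp_pos _).le, ← Real.exp_mul, mul_comm a]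
  rw [neg_mul, Real.exp_neg, ← div_eq_mul_inv, le_div_iff₀ (Real.rpow_pos_of_pos hj a),
    inv_mul_le_iff₀ (Real.exp_pos _), mul_comm]
  exact h3

/-- Since the interval has mass one, the left side is an average of differences `exp (-s * l) - exp
(-s * τ)`. -/
lemma norm_exp_sub_block_le (j : ℕ) {l : ℝ} (hl : l ∈ Set.Icc (y j) (y (j + 1))) (s : ℂ) :
    ‖exp (-s * l) - block q y j s‖ ≤ ‖s‖ * ∫ u in (y j)..(y (j + 1)), Real.exp (-s.re * u) := by
  set K := ‖s‖ * ∫ u in (y j)..(y (j + 1)), Real.exp (-s.re * u)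
  have hqc := hq.intervalIntegrable_block_complex j
  have h1 : exp (-s * l) - block q y j s =
      ∫ τ in (y j)..(y (j + 1)), (exp (-s * l) - exp (-s * τ)) * q τ := by
    simp_rw [sub_mul]
    rw [intervalIntegral.integral_sub (hqc.const_mul _)
      (hqc.continuousOn_mul (by fun_prop : Continuous fun τ : ℝ => exp (-s * τ)).continuousOn),
      intervalIntegral.integral_const_mul, intervalIntegral.integral_ofReal, hq.integral_eq_one]
    simp [block]
  rw [h1]
  have h2 : K = ∫ τ in (y j)..(y (j + 1)), K * q τ := by
    rw [intervalIntegral.integral_const_mul, hq.integral_eq_one, mul_one]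
  rw [h2]
  refine intervalIntegral.norm_integral_le_of_norm_le (hq.y_le_succ j) ?_
    ((hq.intervalIntegrable_block j).const_mul K)
  refine Eventually.of_forall fun τ hτ => ?_
  have hτ0 := hq.nonneg τ ((hq.y_zero_le j).trans hτ.1.le)
  rw [norm_mul, Complex.norm_real, Real.norm_of_nonneg hτ0]
  gcongr
  exact norm_exp_sub_exp_le s hl ⟨hτ.1.le, hτ.2⟩

/-- The condition `2 ≤ y 0` makes the exponent at most `-1`; this keeps `1 - exp (-s * l)` away from
the branch cut of the logarithm. -/
lemma exp_neg_mul_le_half (j : ℕ) {l : ℝ} (hl : y j ≤ l) {σ : ℝ} (hσ : 1 / 2 ≤ σ) :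
    Real.exp (-σ * l) ≤ 1 / 2 := by
  have h1 : 2 ≤ l := hq.two_le.trans ((hq.y_zero_le j).trans hl)
  have h2 : Real.exp (-σ * l) ≤ Real.exp (-1) := Real.exp_le_exp.2 (by nlinarith)
  have h3 : Real.exp (-1) ≤ 1 / 2 := by
    rw [Real.exp_neg, one_div]
    exact inv_anti₀ (by norm_num) (by linarith [Real.add_one_le_exp 1])
  linarith

lemma norm_log_sub_le (j : ℕ) {l : ℝ} (hl : y j ≤ l) {s : ℂ} (hs : 1 / 2 ≤ s.re) :
    ‖-log (1 - exp (-s * l)) - exp (-s * l)‖ ≤ Real.exp (-2 * s.re * y j) := by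
  set z := exp (-s * l)
  have hz : ‖z‖ ≤ 1 / 2 := by
    rw [norm_exp_neg_mul]; exact hq.exp_neg_mul_le_half j hl hs
  have h1 := Complex.norm_log_one_add_sub_self_le (z := -z) (by rw [norm_neg]; linarith)
  rw [norm_neg, ← sub_eq_add_neg] at h1
  have h2 : -log (1 - z) - z = -(log (1 - z) - -z) := by ring
  rw [h2, norm_neg]
  refine h1.trans ?_
  have h3 : (1 - ‖z‖)⁻¹ ≤ 2 := by
    rw [inv_le_comm₀ (by linarith) (by norm_num)]; linarith
  have h4 : ‖z‖ ^ 2 ≤ Real.exp (-2 * s.re * y j) := by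
    rw [norm_exp_neg_mul, ← Real.exp_nat_mul]
    refine Real.exp_le_exp.2 ?_
    push_cast
    nlinarith
  calc ‖z‖ ^ 2 * (1 - ‖z‖)⁻¹ / 2 ≤ ‖z‖ ^ 2 * 2 / 2 := by gcongr
    _ = ‖z‖ ^ 2 := by ring
    _ ≤ _ := h4

/-- The first term comes from the position of the prime inside its interval, the second from its
higher powers. The second is summable only for `Re s > 1 / 2`, which is where that half-plane comes
from. -/
lemma norm_localLog_le (j : ℕ) {l : ℝ} (hl : l ∈ Set.Icc (y j) (y (j + 1))) {s : ℂ}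
    (hs : 1 / 2 ≤ s.re) :
    ‖localLog q y j l s‖ ≤ ‖s‖ * (∫ u in (y j)..(y (j + 1)), Real.exp (-s.re * u)) +
      Real.exp (-2 * s.re * y j) := by
  have h : localLog q y j l s = (exp (-s * l) - block q y j s) +
      (-log (1 - exp (-s * l)) - exp (-s * l)) := by
    rw [localLog]; ring
  rw [h]
  exact (norm_add_le _ _).trans
    (add_le_add (hq.norm_exp_sub_block_le j hl s) (hq.norm_log_sub_le j hl.1 hs))

lemma summable_integral_exp {σ : ℝ} (hσ : 0 < σ) :
    Summable fun j => ∫ u in (y j)..(y (j + 1)), Real.exp (-σ * u) := by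
  have hc : Continuous fun u : ℝ => Real.exp (-σ * u) := by fun_prop
  refine summable_of_sum_range_le (c := Real.exp (-σ * y 0) / σ) (fun j => ?_) fun n => ?_
  · exact intervalIntegral.integral_nonneg (hq.y_le_succ j) fun u _ => (Real.exp_pos _).le
  · rw [intervalIntegral.sum_integral_adjacent_intervals fun k _ => hc.intervalIntegrable _ _]
    have h1 : ∫ u in (y 0)..(y n), Real.exp (-σ * u) =
        (Real.exp (-σ * y 0) - Real.exp (-σ * y n)) / σ := by
      rw [intervalIntegral.integral_comp_mul_left (fun u => Real.exp u) (neg_ne_zero.2 hσ.ne'),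
        integral_exp, smul_eq_mul]
      field_simp
      ring
    rw [h1]
    gcongr
    linarith [Real.exp_pos (-σ * y n)]

/-- A Weierstrass majorant, also uniform in the placement of the primes. -/
lemma exists_summable_bound {c R : ℝ} (hc : 1 / 2 < c) :
    ∃ u : ℕ → ℝ, Summable u ∧ ∀ lam : ℕ → ℝ, (∀ j, lam j ∈ Set.Icc (y j) (y (j + 1))) →
      ∀ j (s : ℂ), c ≤ s.re → ‖s‖ ≤ R → ‖localLog q y j (lam j) s‖ ≤ u j := by
  refine ⟨fun j => R * (∫ u in (y j)..(y (j + 1)), Real.exp (-c * u)) + Real.exp (-(2 * c) * y j),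
    ((hq.summable_integral_exp (by linarith)).mul_left R).add (hq.summable_exp (by linarith)), ?_⟩
  intro lam hlam j s hs hR
  have hR0 : 0 ≤ R := (norm_nonneg _).trans hR
  have hy : 0 < y j := by linarith [hq.two_le, hq.y_zero_le j]
  refine (hq.norm_localLog_le j (hlam j) (by linarith)).trans ?_
  have hc' : ∀ σ : ℝ, Continuous fun u : ℝ => Real.exp (-σ * u) := fun σ => by fun_prop
  have h1 : ∫ u in (y j)..(y (j + 1)), Real.exp (-s.re * u) ≤
      ∫ u in (y j)..(y (j + 1)), Real.exp (-c * u) := by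
    refine intervalIntegral.integral_mono_on (hq.y_le_succ j) ((hc' _).intervalIntegrable _ _)
      ((hc' _).intervalIntegrable _ _) fun u hu => Real.exp_le_exp.2 ?_
    have : 0 < u := hy.trans_le hu.1
    nlinarith
  have h0 : 0 ≤ ∫ u in (y j)..(y (j + 1)), Real.exp (-s.re * u) :=
    intervalIntegral.integral_nonneg (hq.y_le_succ j) fun u _ => (Real.exp_pos _).le
  have h2 : Real.exp (-2 * s.re * y j) ≤ Real.exp (-(2 * c) * y j) :=
    Real.exp_le_exp.2 (by nlinarith)
  exact add_le_add (mul_le_mul hR h1 h0 hR0) h2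

lemma summable_localLog {lam : ℕ → ℝ} (hlam : ∀ j, lam j ∈ Set.Icc (y j) (y (j + 1))) {s : ℂ}
    (hs : 1 / 2 < s.re) : Summable fun j => localLog q y j (lam j) s := by
  obtain ⟨u, hu, hb⟩ := hq.exists_summable_bound (R := ‖s‖) hs
  exact Summable.of_norm_bounded hu fun j => hb lam hlam j s le_rfl le_rfl

lemma differentiableOn_localLog (j : ℕ) {l : ℝ} (hl : y j ≤ l) :
    DifferentiableOn ℂ (localLog q y j l) {s | 1 / 2 < s.re} := by
  refine DifferentiableOn.sub (DifferentiableOn.neg ?_) (hq.differentiable_block j).differentiableOn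
  refine DifferentiableOn.clog (by fun_prop) fun s hs => ?_
  have h1 : ‖exp (-s * l)‖ ≤ 1 / 2 := by
    rw [norm_exp_neg_mul]; exact hq.exp_neg_mul_le_half j hl (le_of_lt hs)
  refine Complex.mem_slitPlane_iff.2 (Or.inl ?_)
  have h2 := Complex.re_le_norm (exp (-s * l))
  simp only [sub_re, one_re]
  linarith

lemma differentiableOn_tsum_localLog {lam : ℕ → ℝ}
    (hlam : ∀ j, lam j ∈ Set.Icc (y j) (y (j + 1))) :
    DifferentiableOn ℂ (fun s => ∑' j, localLog q y j (lam j) s) {s | 1 / 2 < s.re} := by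
  intro s₀ hs₀
  have hs₀ : 1 / 2 < s₀.re := hs₀
  obtain ⟨c, hc1, hc2⟩ := exists_between hs₀
  obtain ⟨u, hu, hb⟩ := hq.exists_summable_bound (R := ‖s₀‖ + 1) hc1
  set U : Set ℂ := {s | c < s.re} ∩ Metric.ball s₀ 1
  have hU : IsOpen U := (isOpen_lt continuous_const Complex.continuous_re).inter Metric.isOpen_ball
  have hmem : s₀ ∈ U := ⟨hc2, Metric.mem_ball_self one_pos⟩
  have := Complex.differentiableOn_tsum_of_summable_norm hu (fun j =>
    (hq.differentiableOn_localLog j (hlam j).1).mono fun s hs => hc1.trans hs.1) hU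
    (fun j s hs => hb lam hlam j s (le_of_lt hs.1) (by
      have h2 : ‖s - s₀‖ < 1 := by simpa [dist_eq_norm] using hs.2
      have := norm_le_norm_add_norm_sub' s s₀
      linarith))
  exact (this.differentiableAt (hU.mem_nhds hmem)).differentiableWithinAt

end UnitPartition

end BeurlingConstruction

end

/-! ### Placing the primes by exponential moments -/

section

open MeasureTheory Filter Topology Complex

namespace BeurlingConstruction

lemma exp_le_one_add_add_sq (x : ℝ) : Real.exp x ≤ 1 + x + x ^ 2 * Real.exp |x| := by
  have h := Complex.norm_exp_sub_sum_le_norm_mul_exp x 2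
  simp only [Finset.sum_range_succ, Finset.range_zero, Finset.sum_empty, pow_zero,
    Nat.factorial_zero, Nat.cast_one, div_one, zero_add, pow_one, Nat.factorial_one] at h
  rw [← ofReal_exp, ← ofReal_one, ← ofReal_add, ← ofReal_sub, Complex.norm_real, Complex.norm_real,
    Real.norm_eq_abs, Real.norm_eq_abs, sq_abs] at h
  linarith [le_abs_self (Real.exp x - (1 + x))]

namespace UnitPartition

variable {q : ℝ → ℝ} {y : ℕ → ℝ} {C : ℝ} (hq : UnitPartition q y C)

include hq

lemma norm_block_le (j : ℕ) {s : ℂ} (hs : 0 ≤ s.re) : ‖block q y j s‖ ≤ Real.exp (-s.re * y j) := by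
  have h2 : Real.exp (-s.re * y j) = ∫ τ in (y j)..(y (j + 1)), Real.exp (-s.re * y j) * q τ := by
    rw [intervalIntegral.integral_const_mul, hq.integral_eq_one, mul_one]
  rw [h2]
  refine intervalIntegral.norm_integral_le_of_norm_le (hq.y_le_succ j) ?_
    ((hq.intervalIntegrable_block j).const_mul _)
  refine Eventually.of_forall fun τ hτ => ?_
  have hτ0 := hq.nonneg τ ((hq.y_zero_le j).trans hτ.1.le)
  rw [norm_mul, Complex.norm_real, Real.norm_of_nonneg hτ0, norm_exp_neg_mul]
  refine mul_le_mul_of_nonneg_right (Real.exp_le_exp.2 ?_) hτ0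
  nlinarith [hτ.1]

lemma continuousOn_localLog (j : ℕ) {s : ℂ} (hs : 1 / 2 ≤ s.re) :
    ContinuousOn (fun l : ℝ => localLog q y j l s) (Set.Icc (y j) (y (j + 1))) := by
  refine ContinuousOn.sub (ContinuousOn.neg (ContinuousOn.clog (by fun_prop) fun l hl => ?_))
    continuousOn_const
  have h1 : ‖exp (-s * l)‖ ≤ 1 / 2 := by
    rw [norm_exp_neg_mul]; exact hq.exp_neg_mul_le_half j hl.1 hs
  refine Complex.mem_slitPlane_iff.2 (Or.inl ?_)
  have h2 := Complex.re_le_norm (exp (-s * l))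
  simp only [sub_re, one_re]
  linarith

/-- Under the density `q`, the mean of `exp (-s * l)` is `block q y j s`, so the first-order term of
the moment vanishes and only the order `exp (-2 σ y j)` remains. The bound depends on `s` through
its real part alone, in contrast to `norm_localLog_le`, which grows with `‖s‖`. -/
lemma integral_exp_localLog_le (j : ℕ) {Λ : ℝ} (hΛ : 0 ≤ Λ) {s : ℂ} (hs : 1 / 2 ≤ s.re) :
    ∫ l in (y j)..(y (j + 1)), q l * Real.exp (Λ * (localLog q y j l s).re) ≤
      Real.exp ((Λ + 4 * Λ ^ 2 * Real.exp (2 * Λ)) * Real.exp (-2 * s.re * y j)) := by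
  set δ := Real.exp (-2 * s.re * y j) with hδ
  have hδ0 : 0 < δ := Real.exp_pos _
  set e := Real.exp (-s.re * y j) with he
  have he2 : e ^ 2 = δ := by
    rw [he, hδ, ← Real.exp_nat_mul]; congr 1; push_cast; ring
  have he0 : 0 < e := Real.exp_pos _
  have he1 : e ≤ 1 := by
    have := hq.exp_neg_mul_le_half j le_rfl hs
    linarith
  have hqi := hq.intervalIntegrable_block j
  -- The centred part of the real part of `localLog`; the higher prime powers differ from it by at
  -- most `δ`.
  set v : ℝ → ℝ := fun l => (exp (-s * l) - block q y j s).re with hv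
  have hvc : Continuous v := by
    rw [hv]; fun_prop
  have hvb : ∀ l ∈ Set.Icc (y j) (y (j + 1)), |v l| ≤ 2 * e := by
    intro l hl
    refine (Complex.abs_re_le_norm _).trans ((norm_sub_le _ _).trans ?_)
    have h1 := hq.norm_block_le j (s := s) (by linarith)
    have h2 : ‖exp (-s * l)‖ ≤ e := by
      rw [norm_exp_neg_mul]
      exact Real.exp_le_exp.2 (by nlinarith [hl.1])
    linarith
  have hvi : IntervalIntegrable (fun l => q l * v l) volume (y j) (y (j + 1)) :=
    hqi.mul_continuousOn hvc.continuousOn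
  have hmean : ∫ l in (y j)..(y (j + 1)), q l * v l = 0 := by
    have hqc := hq.intervalIntegrable_block_complex j
    have hci : IntervalIntegrable (fun l : ℝ => (exp (-s * l) - block q y j s) * (q l : ℂ)) volume
        (y j) (y (j + 1)) :=
      hqc.continuousOn_mul (by fun_prop : Continuous fun l : ℝ => exp (-s * l) - block q y j s).continuousOn
    have h1 : ∫ l in (y j)..(y (j + 1)), (exp (-s * l) - block q y j s) * (q l : ℂ) = 0 := by
      simp_rw [sub_mul]
      rw [intervalIntegral.integral_sub
        (hqc.continuousOn_mul (by fun_prop : Continuous fun τ : ℝ => exp (-s * τ)).continuousOn)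
        (hqc.const_mul _), intervalIntegral.integral_const_mul, intervalIntegral.integral_ofReal,
        hq.integral_eq_one]
      simp [block]
    have h2 := Complex.reCLM.intervalIntegral_comp_comm hci
    rw [h1] at h2
    simp only [Complex.reCLM_apply, Complex.zero_re] at h2
    rw [← h2]
    refine intervalIntegral.integral_congr fun l _ => ?_
    simp only [hv, Complex.re_mul_ofReal]
    ring
  -- Second-order expansion of `exp (Λ * v l)`, using `|Λ * v l| ≤ 2 Λ` in the exponential and `(Λ *
  -- v l) ^ 2 ≤ 4 Λ ^ 2 δ` in the remainder. The linear term is kept exact because it integrates to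
  -- zero.
  have hpt : ∀ l ∈ Set.Icc (y j) (y (j + 1)), q l * Real.exp (Λ * (localLog q y j l s).re) ≤
      Real.exp (Λ * δ) * ((1 + 4 * Λ ^ 2 * Real.exp (2 * Λ) * δ) * q l + Λ * (q l * v l)) := by
    intro l hl
    have hq0 := hq.nonneg l ((hq.y_zero_le j).trans hl.1)
    have h1 : (localLog q y j l s).re ≤ v l + δ := by
      have h := (Complex.re_le_norm _).trans (hq.norm_log_sub_le j hl.1 hs)
      simp only [localLog, hv, sub_re] at h ⊢
      linarith
    have h2 : Real.exp (Λ * (localLog q y j l s).re) ≤ Real.exp (Λ * δ) * Real.exp (Λ * v l) := by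
      rw [← Real.exp_add]
      exact Real.exp_le_exp.2 (by nlinarith)
    have hvl := hvb l hl
    have h3 : |Λ * v l| ≤ 2 * Λ := by
      rw [abs_mul, abs_of_nonneg hΛ]; nlinarith
    have h4 : (Λ * v l) ^ 2 ≤ 4 * Λ ^ 2 * δ := by
      rw [mul_pow, ← sq_abs (v l), ← he2]
      have : |v l| ^ 2 ≤ (2 * e) ^ 2 := by gcongr
      nlinarith [sq_nonneg Λ]
    have h5 : Real.exp (Λ * v l) ≤ 1 + Λ * v l + 4 * Λ ^ 2 * δ * Real.exp (2 * Λ) := by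
      refine (exp_le_one_add_add_sq _).trans ?_
      gcongr
    calc q l * Real.exp (Λ * (localLog q y j l s).re)
        ≤ q l * (Real.exp (Λ * δ) * (1 + Λ * v l + 4 * Λ ^ 2 * δ * Real.exp (2 * Λ))) := by
          refine mul_le_mul_of_nonneg_left (h2.trans ?_) hq0
          exact mul_le_mul_of_nonneg_left h5 (Real.exp_pos _).le
      _ = _ := by ring
  have hii : IntervalIntegrable (fun l => q l * Real.exp (Λ * (localLog q y j l s).re)) volume
      (y j) (y (j + 1)) := by
    refine hqi.mul_continuousOn ?_
    rw [Set.uIcc_of_le (hq.y_le_succ j)]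
    exact Real.continuous_exp.comp_continuousOn
      (continuousOn_const.mul
          (Complex.continuous_re.comp_continuousOn (hq.continuousOn_localLog j hs)))
  refine (intervalIntegral.integral_mono_on (hq.y_le_succ j) hii
    (((hqi.const_mul _).add (hvi.const_mul _)).const_mul _) hpt).trans ?_
  rw [intervalIntegral.integral_const_mul, intervalIntegral.integral_add (hqi.const_mul _)
    (hvi.const_mul _), intervalIntegral.integral_const_mul, intervalIntegral.integral_const_mul,
    hmean, hq.integral_eq_one, mul_zero, add_zero, mul_one, add_mul, Real.exp_add]
  gcongr
  rw [add_comm]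
  exact Real.add_one_le_exp _

/-- The probability measure with density `q` on the `j`-th interval. -/
lemma isProbabilityMeasure_block (j : ℕ) : IsProbabilityMeasure
    ((volume.restrict (Set.Ioc (y j) (y (j + 1)))).withDensity fun l => ENNReal.ofReal (q l)) := by
  constructor
  rw [withDensity_apply _ MeasurableSet.univ, Measure.restrict_univ,
    ← ofReal_integral_eq_lintegral_ofReal, ← intervalIntegral.integral_of_le (hq.y_le_succ j),
    hq.integral_eq_one, ENNReal.ofReal_one]
  · exact (hq.intervalIntegrable_block j).1
  · refine (ae_restrict_mem measurableSet_Ioc).mono fun l hl => ?_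
    exact hq.nonneg l ((hq.y_zero_le j).trans hl.1.le)

/-- A point of the `j`-th interval at which a weighted exponential moment of `localLog` is at most
its average. -/
lemma exists_lintegral_le (j : ℕ) {Λ σ : ℝ} (hΛ : 0 ≤ Λ) (hσ : 1 / 2 ≤ σ) {g : ℝ → ENNReal}
    (hg : Measurable g) : ∃ l ∈ Set.Icc (y j) (y (j + 1)),
      ∫⁻ t : ℝ, g t * ENNReal.ofReal (Real.exp (Λ * (localLog q y j l (σ + t * I)).re)) ≤
        ENNReal.ofReal (Real.exp ((Λ + 4 * Λ ^ 2 * Real.exp (2 * Λ)) * Real.exp (-2 * σ * y j))) *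
          ∫⁻ t, g t := by
  set μ := (volume.restrict (Set.Ioc (y j) (y (j + 1)))).withDensity fun l => ENNReal.ofReal (q l)
    with hμ
  have : IsProbabilityMeasure μ := hq.isProbabilityMeasure_block j
  have hqm : Measurable fun l => ENNReal.ofReal (q l) := hq.measurable.ennreal_ofReal
  have hbm : Measurable (block q y j) := (hq.differentiable_block j).continuous.measurable
  have hm2 : Measurable fun p : ℝ × ℝ =>
      g p.2 * ENNReal.ofReal (Real.exp (Λ * (localLog q y j p.1 (σ + p.2 * I)).re)) := by
    unfold localLog
    fun_prop
  have hm1 : Measurable fun l : ℝ => ∫⁻ t : ℝ, g t *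
      ENNReal.ofReal (Real.exp (Λ * (localLog q y j l (σ + t * I)).re)) :=
    hm2.lintegral_prod_right'
  have hN : μ (Set.Ioc (y j) (y (j + 1)))ᶜ = 0 := by
    refine withDensity_absolutelyContinuous _ _ ?_
    rw [Measure.restrict_apply measurableSet_Ioc.compl]
    simp
  -- A point at which the inner integral is at most its mean; avoiding the null set `hN` forces it
  -- into the interval.
  obtain ⟨l, hl, hle⟩ := exists_notMem_null_le_lintegral hm1.aemeasurable hN
  simp only [Set.mem_compl_iff, not_not] at hl
  refine ⟨l, ⟨hl.1.le, hl.2⟩, hle.trans ?_⟩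
  rw [lintegral_lintegral_swap hm2.aemeasurable, ← lintegral_const_mul _ hg]
  refine lintegral_mono fun t => ?_
  have hm3 : Measurable fun l : ℝ =>
      ENNReal.ofReal (Real.exp (Λ * (localLog q y j l (σ + t * I)).re)) := by
    unfold localLog
    fun_prop
  rw [lintegral_const_mul _ hm3, mul_comm]
  gcongr
  rw [hμ, lintegral_withDensity_eq_lintegral_mul _ hqm hm3]
  have hs : 1 / 2 ≤ (σ + t * I : ℂ).re := by simpa using hσ
  have h1 := hq.integral_exp_localLog_le j hΛ hs
  have h2 : (σ + t * I : ℂ).re = σ := by simp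
  rw [h2] at h1
  refine le_trans (le_of_eq ?_) (ENNReal.ofReal_le_ofReal h1)
  rw [intervalIntegral.integral_of_le (hq.y_le_succ j), ofReal_integral_eq_lintegral_ofReal]
  · refine setLIntegral_congr_fun measurableSet_Ioc fun l hl => ?_
    simp only [Pi.mul_apply]
    rw [ENNReal.ofReal_mul (hq.nonneg l ((hq.y_zero_le j).trans hl.1.le))]
  · have := (hq.intervalIntegrable_block j).mul_continuousOn
      (g := fun l => Real.exp (Λ * (localLog q y j l (σ + t * I)).re)) (by
        rw [Set.uIcc_of_le (hq.y_le_succ j)]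
        exact Real.continuous_exp.comp_continuousOn
          (continuousOn_const.mul
          (Complex.continuous_re.comp_continuousOn (hq.continuousOn_localLog j hs))))
    exact this.1
  · refine (ae_restrict_mem measurableSet_Ioc).mono fun l hl => ?_
    exact mul_nonneg (hq.nonneg l ((hq.y_zero_le j).trans hl.1.le)) (Real.exp_pos _).le

/-- Primes can be placed in the intervals so that a moment of all partial products on the line
`Re s = σ` stays bounded. -/
lemma exists_lam {Λ σ : ℝ} (hΛ : 0 ≤ Λ) (hσ : 1 / 2 < σ) :
    ∃ lam : ℕ → ℝ, (∀ j, lam j ∈ Set.Icc (y j) (y (j + 1))) ∧ ∃ B : ℝ, ∀ J : ℕ,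
      ∫⁻ t : ℝ, ENNReal.ofReal ((1 + t ^ 2)⁻¹ *
        Real.exp (Λ * (∑ j ∈ Finset.range J, localLog q y j (lam j) (σ + t * I)).re)) ≤
          ENNReal.ofReal B := by
  set K := Λ + 4 * Λ ^ 2 * Real.exp (2 * Λ) with hK
  have hK0 : 0 ≤ K := by positivity
  have step : ∀ (j : ℕ) (g : {g : ℝ → ENNReal // Measurable g}), ∃ l ∈ Set.Icc (y j) (y (j + 1)),
      ∫⁻ t : ℝ, g.1 t * ENNReal.ofReal (Real.exp (Λ * (localLog q y j l (σ + t * I)).re)) ≤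
        ENNReal.ofReal (Real.exp (K * Real.exp (-2 * σ * y j))) * ∫⁻ t, g.1 t := fun j g =>
    hq.exists_lintegral_le j hΛ hσ.le g.2
  choose pick hpick hpick_le using step
  have hmeas : ∀ (j : ℕ) (l : ℝ), Measurable fun t : ℝ =>
      ENNReal.ofReal (Real.exp (Λ * (localLog q y j l (σ + t * I)).re)) := by
    intro j l
    have hbm : Measurable (block q y j) := (hq.differentiable_block j).continuous.measurable
    unfold localLog
    fun_prop
  -- Greedy choice: `G n` is the weight `(1 + t ^ 2)⁻¹` multiplied by the moment factors of the
  -- first `n` primes, and the next prime is picked with respect to it.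
  let G : ℕ → {g : ℝ → ENNReal // Measurable g} := fun n => Nat.rec
    ⟨fun t => ENNReal.ofReal (1 + t ^ 2)⁻¹, by fun_prop⟩
    (fun j g => ⟨fun t => g.1 t *
      ENNReal.ofReal (Real.exp (Λ * (localLog q y j (pick j g) (σ + t * I)).re)),
      g.2.mul (hmeas j _)⟩) n
  have hG0 : ∀ t, (G 0).1 t = ENNReal.ofReal (1 + t ^ 2)⁻¹ := fun t => rfl
  have hGs : ∀ j t, (G (j + 1)).1 t = (G j).1 t *
      ENNReal.ofReal (Real.exp (Λ * (localLog q y j (pick j (G j)) (σ + t * I)).re)) :=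
    fun j t => rfl
  refine ⟨fun j => pick j (G j), fun j => hpick j (G j),
    Real.exp (K * ∑' j, Real.exp (-(2 * σ) * y j)) * Real.pi, fun J => ?_⟩
  have hGJ : ∀ J t, (G J).1 t = ENNReal.ofReal ((1 + t ^ 2)⁻¹ *
      Real.exp (Λ * (∑ j ∈ Finset.range J,
        localLog q y j (pick j (G j)) (σ + t * I)).re)) := by
    intro J t
    induction J with
    | zero => simp [hG0]
    | succ J ih =>
      rw [hGs, ih, ← ENNReal.ofReal_mul (by positivity), mul_assoc, ← Real.exp_add,
        Finset.sum_range_succ, add_re, mul_add]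
  -- Step `j` costs a factor `exp (K * exp (-2 σ y j))`; the exponents are summable because `2 σ >
  -- 1`, and the initial mass is `π`.
  have hbd : ∀ J, ∫⁻ t, (G J).1 t ≤
      ENNReal.ofReal (Real.exp (K * ∑ j ∈ Finset.range J, Real.exp (-(2 * σ) * y j)) * Real.pi) := by
    intro J
    induction J with
    | zero =>
      simp only [hG0]
      rw [← ofReal_integral_eq_lintegral_ofReal integrable_inv_one_add_sq
        (Eventually.of_forall fun t => by positivity), integral_univ_inv_one_add_sq]
      simp
    | succ J ih =>
      simp only [hGs]
      refine (hpick_le J (G J)).trans ?_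
      refine (mul_le_mul_right ih _).trans (le_of_eq ?_)
      rw [← ENNReal.ofReal_mul (Real.exp_pos _).le, ← mul_assoc, ← Real.exp_add,
        Finset.sum_range_succ]
      congr 3
      rw [mul_add, add_comm]
      congr 3
      ring
  simp only [← hGJ]
  refine (hbd J).trans (ENNReal.ofReal_le_ofReal ?_)
  gcongr
  exact (hq.summable_exp (by linarith)).sum_le_tsum _ fun _ _ => (Real.exp_pos _).le

end UnitPartition

end BeurlingConstruction

end

/-! ### Smoothed Perron formula and the integrand on the shifted line -/

section

open MeasureTheory Filter Topology Complex

namespace BeurlingConstruction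

/-- The continuous piecewise linear function that is `0` up to `-h` and `1` from `0` on. -/
noncomputable def ramp (h v : ℝ) : ℝ := (max (v + h) 0 - max v 0) / h

lemma ramp_nonneg {h : ℝ} (hh : 0 < h) (v : ℝ) : 0 ≤ ramp h v := by
  refine div_nonneg (sub_nonneg.2 ?_) hh.le
  exact max_le_max (by linarith) le_rfl

lemma ramp_le_one {h : ℝ} (hh : 0 < h) (v : ℝ) : ramp h v ≤ 1 := by
  rw [ramp, div_le_one hh, sub_le_iff_le_add]
  refine max_le ?_ ?_
  · linarith [le_max_left v 0]
  · linarith [le_max_right v 0]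

lemma ramp_of_nonneg {h v : ℝ} (hh : 0 < h) (hv : 0 ≤ v) : ramp h v = 1 := by
  rw [ramp, max_eq_left (by linarith), max_eq_left hv, add_sub_cancel_left, div_self hh.ne']

lemma ramp_of_le {h v : ℝ} (hh : 0 < h) (hv : v ≤ -h) : ramp h v = 0 := by
  rw [ramp, max_eq_right (by linarith), max_eq_right (by linarith), sub_zero, zero_div]

/-- A smoothed Perron formula for a general Dirichlet series. -/
lemma hasSum_ramp {ι : Type*} [Countable ι] {ℓ : ι → ℝ}
    (hℓ : Summable fun i => Real.exp (-2 * ℓ i)) {Z : ℂ → ℂ}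
    (hZ : ∀ s : ℂ, s.re = 2 → HasSum (fun i => exp (-s * ℓ i)) (Z s)) {h : ℝ} (hh : 0 < h) (Y : ℝ) :
    HasSum (fun i => ((2 * Real.pi * ramp h (Y - ℓ i) : ℝ) : ℂ))
      (∫ t : ℝ, Z (2 + t * I) *
        (exp ((2 + t * I) * Y) * ((exp ((2 + t * I) * h) - 1) / h) / (2 + t * I) ^ 2)) := by
  set k : ℝ → ℂ := fun t =>
    exp ((2 + t * I) * Y) * ((exp ((2 + t * I) * h) - 1) / h) / (2 + t * I) ^ 2 with hk
  have hh' : (h : ℂ) ≠ 0 := by exact_mod_cast hh.ne'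
  -- The ramp is a difference quotient of `max v 0`, whose Laplace transform is `1 / s ^ 2`. The
  -- quadratic decay makes every integral absolutely convergent.
  have hsplit : ∀ i, (fun t : ℝ => exp (-(2 + t * I) * ℓ i) * k t) = fun t : ℝ =>
      (h : ℂ)⁻¹ * (exp ((2 + t * I) * (Y - ℓ i + h : ℝ)) / (2 + t * I) ^ 2 -
        exp ((2 + t * I) * (Y - ℓ i : ℝ)) / (2 + t * I) ^ 2) := by
    intro i
    funext t
    have e1 : exp ((2 + t * I) * (Y - ℓ i + h : ℝ)) =
        exp (-(2 + t * I) * ℓ i) * exp ((2 + t * I) * Y) * exp ((2 + t * I) * h) := by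
      rw [← exp_add, ← exp_add]; congr 1; push_cast; ring
    have e2 : exp ((2 + t * I) * (Y - ℓ i : ℝ)) =
        exp (-(2 + t * I) * ℓ i) * exp ((2 + t * I) * Y) := by
      rw [← exp_add]; congr 1; push_cast; ring
    rw [e1, e2, hk]
    ring
  have hFi : ∀ i, Integrable fun t : ℝ => exp (-(2 + t * I) * ℓ i) * k t := by
    intro i
    rw [hsplit]
    exact ((integral_exp_div_sq _).1.sub (integral_exp_div_sq _).1).const_mul _
  have hFint : ∀ i, ∫ t : ℝ, exp (-(2 + t * I) * ℓ i) * k t =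
      ((2 * Real.pi * ramp h (Y - ℓ i) : ℝ) : ℂ) := by
    intro i
    rw [hsplit, integral_const_mul, integral_sub (integral_exp_div_sq _).1
      (integral_exp_div_sq _).1, (integral_exp_div_sq _).2, (integral_exp_div_sq _).2, ramp]
    push_cast
    field_simp
  have hki : Integrable k := by
    have : k = fun t : ℝ => (h : ℂ)⁻¹ * (exp ((2 + t * I) * (Y + h : ℝ)) / (2 + t * I) ^ 2 -
        exp ((2 + t * I) * (Y : ℝ)) / (2 + t * I) ^ 2) := by
      funext t
      have e1 : exp ((2 + t * I) * (Y + h : ℝ)) =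
          exp ((2 + t * I) * Y) * exp ((2 + t * I) * h) := by
        rw [← exp_add]; congr 1; push_cast; ring
      rw [e1, hk]
      ring
    rw [this]
    exact ((integral_exp_div_sq _).1.sub (integral_exp_div_sq _).1).const_mul _
  have hnorm : ∀ i, ∫ t : ℝ, ‖exp (-(2 + t * I) * ℓ i) * k t‖ =
      Real.exp (-2 * ℓ i) * ∫ t : ℝ, ‖k t‖ := by
    intro i
    rw [← integral_const_mul]
    refine integral_congr_ae (Eventually.of_forall fun t => ?_)
    simp only [norm_mul, norm_exp_neg_mul]
    simp
  have key := hasSum_integral_of_summable_integral_norm hFi (by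
    simp_rw [hnorm]
    exact hℓ.mul_right _)
  simp_rw [hFint] at key
  convert! key using 1
  refine integral_congr_ae (Eventually.of_forall fun t => ?_)
  have := (hZ (2 + t * I) (by simp)).mul_right (k t)
  exact this.tsum_eq.symm

/-- Trades a pointwise bound for a moment bound: either `exp a` is at most the threshold `exp b`, or
its `Λ`-th power, renormalized, dominates it. -/
lemma exp_le_add_exp (a b : ℝ) {Λ : ℝ} (hΛ : 1 ≤ Λ) :
    Real.exp a ≤ Real.exp b + Real.exp (Λ * a - (Λ - 1) * b) := by
  rcases le_or_gt a b with h | h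
  · linarith [Real.exp_le_exp.2 h, Real.exp_pos (Λ * a - (Λ - 1) * b)]
  · have : Real.exp a ≤ Real.exp (Λ * a - (Λ - 1) * b) := Real.exp_le_exp.2 (by nlinarith)
    linarith [Real.exp_pos b]

/-- Interpolates between the linear bound for `h * ‖s‖ ≤ 1` and the trivial bound. With `θ = 1 - 2
η` the kernel keeps decay `|t| ^ (-1 - 2 η)` at the price of `h ^ (-2 η)`. -/
lemma norm_exp_mul_sub_one_le {s : ℂ} (h0 : 0 < s.re) (h1 : s.re ≤ 1) {h : ℝ} (hh : 0 < h)
    (hh1 : h ≤ 1) {θ : ℝ} (hθ0 : 0 ≤ θ) (hθ1 : θ ≤ 1) :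
    ‖exp (s * h) - 1‖ ≤ 4 * (h * ‖s‖) ^ θ := by
  have hs : s ≠ 0 := by rintro rfl; simp at h0
  have he : Real.exp s.re ≤ 3 := by
    have := Real.exp_one_lt_d9
    linarith [Real.exp_le_exp.2 h1]
  have hnonneg : 0 ≤ h * ‖s‖ := by positivity
  rcases le_total (h * ‖s‖) 1 with h2 | h2
  · have e1 : exp (s * h) - 1 = s * ∫ u in (0 : ℝ)..h, exp (s * u) := by
      rw [integral_exp_mul_complex hs]
      simp
      field_simp
    have e2 : ‖∫ u in (0 : ℝ)..h, exp (s * u)‖ ≤ 3 * |h - 0| := by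
      refine intervalIntegral.norm_integral_le_of_norm_le_const fun u hu => ?_
      rw [Set.uIoc_of_le hh.le] at hu
      rw [Complex.norm_exp]
      refine le_trans (Real.exp_le_exp.2 ?_) he
      simp
      nlinarith [hu.1, hu.2]
    have e3 : h * ‖s‖ ≤ (h * ‖s‖) ^ θ := by
      rcases hnonneg.eq_or_lt with h3 | h3
      · rw [← h3]; positivity
      · conv_lhs => rw [← Real.rpow_one (h * ‖s‖)]
        exact Real.rpow_le_rpow_of_exponent_ge h3 h2 hθ1
    rw [e1, norm_mul]
    rw [sub_zero, abs_of_pos hh] at e2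
    calc ‖s‖ * ‖∫ u in (0 : ℝ)..h, exp (s * u)‖ ≤ ‖s‖ * (3 * h) := by gcongr
      _ = 3 * (h * ‖s‖) := by ring
      _ ≤ 4 * (h * ‖s‖) ^ θ := by linarith
  · have e3 : 1 ≤ (h * ‖s‖) ^ θ := Real.one_le_rpow h2 hθ0
    have e4 : ‖exp (s * h)‖ ≤ 3 := by
      rw [Complex.norm_exp]
      refine le_trans (Real.exp_le_exp.2 ?_) he
      simp
      nlinarith
    have := norm_sub_le (exp (s * h)) 1
    rw [norm_one] at this
    linarith

/-- The pointwise estimate of the integrand in the shifted smoothed Perron integral. -/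
lemma norm_perron_integrand_le {σ r η Λ BW : ℝ} (hσ : 0 < σ) (hσr : σ < r) (hr : r < 1)
    (hη : 0 < η) (hη1 : 2 * η ≤ 1) (hΛ : η * (Λ - 1) = 1) {h : ℝ} (Y : ℝ) (hh : 0 < h)
    (hh1 : h ≤ 1) {s w : ℂ} (f : ℂ) {t : ℝ} (hsre : s.re = σ) (hsim : s.im = t) (hw : ‖w‖ ≤ BW) :
    ‖(w * exp f * exp (s * Y) * ((exp (s * h) - 1) / h)) / ((s - 1) * (s - r))‖ ≤
      BW * 4 / ((1 - σ) * (r - σ)) * (Real.exp (σ * Y) * h ^ (-(2 * η))) *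
        ((1 + t ^ 2) ^ (-(1 + η) / 2) + (1 + t ^ 2)⁻¹ * Real.exp (Λ * f.re)) := by
  set c₀ := (1 - σ) * (r - σ) with hc₀
  have hc₀0 : 0 < c₀ := mul_pos (by linarith) (by linarith)
  set M := Real.exp (σ * Y) * h ^ (-(2 * η)) with hM
  have hM0 : 0 < M := by positivity
  have hBW : 0 ≤ BW := (norm_nonneg _).trans hw
  -- Chosen so that `exp L = √(1 + t ^ 2)`; all powers of `1 + t ^ 2` become exponentials of
  -- multiples of `L`.
  set L := Real.log (1 + t ^ 2) / 2 with hL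
  have h1t : 0 < 1 + t ^ 2 := by positivity
  have hu : ∀ a : ℝ, (1 + t ^ 2) ^ a = Real.exp (2 * a * L) := by
    intro a
    rw [Real.rpow_def_of_pos h1t]; congr 1; rw [hL]; ring
  have hu2 : Real.exp L ^ 2 = 1 + t ^ 2 := by
    rw [← Real.exp_nat_mul, hL]; push_cast
    rw [mul_div_cancel₀ _ (two_ne_zero), Real.exp_log h1t]
  have hL0 : 0 ≤ L := by
    rw [hL]; exact div_nonneg (Real.log_nonneg (by nlinarith [sq_nonneg t])) two_pos.le
  have hnorm : ∀ a : ℝ, ‖s - a‖ ^ 2 = (σ - a) ^ 2 + t ^ 2 := by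
    intro a
    rw [← Complex.normSq_eq_norm_sq, Complex.normSq_apply]
    simp [hsre, hsim]
    ring
  have hlow : ∀ a : ℝ, σ < a → a ≤ 1 → (a - σ) * Real.exp L ≤ ‖s - a‖ := by
    intro a ha ha1
    refine (sq_le_sq₀ (mul_nonneg (by linarith) (Real.exp_pos _).le) (norm_nonneg _)).1 ?_
    rw [mul_pow, hu2, hnorm]
    have : (a - σ) ^ 2 ≤ 1 := by nlinarith
    nlinarith [sq_nonneg t]
  have hsup : ‖s‖ ≤ Real.exp L := by
    refine (sq_le_sq₀ (norm_nonneg _) (Real.exp_pos _).le).1 ?_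
    have := hnorm 0
    simp only [ofReal_zero, sub_zero] at this
    rw [this, hu2]
    nlinarith
  have hden : c₀ * Real.exp (2 * L) ≤ ‖(s - 1) * (s - r)‖ := by
    have e : Real.exp (2 * L) = Real.exp L * Real.exp L := by rw [← Real.exp_add]; ring_nf
    rw [norm_mul, e, hc₀]
    have a1 := hlow 1 (by linarith) le_rfl
    have a2 := hlow r hσr hr.le
    simp only [ofReal_one] at a1
    calc (1 - σ) * (r - σ) * (Real.exp L * Real.exp L) =
          ((1 - σ) * Real.exp L) * ((r - σ) * Real.exp L) := by ring
      _ ≤ _ := mul_le_mul a1 a2 (mul_nonneg (by linarith) (Real.exp_pos _).le) (norm_nonneg _)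
  have hker : ‖(exp (s * h) - 1) / h‖ ≤ 4 * (h ^ (-(2 * η)) * Real.exp ((1 - 2 * η) * L)) := by
    rw [norm_div, Complex.norm_real, Real.norm_of_nonneg hh.le, div_le_iff₀ hh]
    have a1 := norm_exp_mul_sub_one_le (s := s) (by linarith) (by linarith) hh hh1
      (θ := 1 - 2 * η) (by linarith) (by linarith)
    refine a1.trans ?_
    rw [Real.mul_rpow hh.le (norm_nonneg _)]
    have a2 : ‖s‖ ^ (1 - 2 * η) ≤ Real.exp ((1 - 2 * η) * L) := by
      rw [mul_comm (1 - 2 * η) L, Real.exp_mul]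
      exact Real.rpow_le_rpow (norm_nonneg _) hsup (by linarith)
    have a3 : h ^ (1 - 2 * η) = h ^ (-(2 * η)) * h := by
      rw [sub_eq_add_neg, add_comm, Real.rpow_add hh, Real.rpow_one]
    rw [a3]
    have : 0 ≤ h ^ (-(2 * η)) * h := by positivity
    nlinarith
  have hnum : ‖w * exp f * exp (s * Y) * ((exp (s * h) - 1) / h)‖ ≤
      BW * Real.exp f.re * Real.exp (σ * Y) *
        (4 * (h ^ (-(2 * η)) * Real.exp ((1 - 2 * η) * L))) := by
    rw [norm_mul, norm_mul, norm_mul, Complex.norm_exp, Complex.norm_exp]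
    have e : (s * (Y : ℂ)).re = σ * Y := by simp [hsre]
    rw [e]
    gcongr
  rw [norm_div]
  -- The threshold is `exp (η * L)`. Below it the kernel still decays like `|t| ^ (-1 - η)`; above
  -- it, `η * (Λ - 1) = 1` produces the extra `exp (-L)` that completes the weight `(1 + t ^ 2)⁻¹`
  -- of the moment.
  have hmain : Real.exp f.re * Real.exp (-(1 + 2 * η) * L) ≤
      (1 + t ^ 2) ^ (-(1 + η) / 2) + ((1 + t ^ 2)⁻¹ * Real.exp (Λ * f.re)) := by
    have a1 := exp_le_add_exp f.re (η * L) (Λ := Λ) (by nlinarith)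
    have a2 : (1 + t ^ 2) ^ (-(1 + η) / 2) = Real.exp (η * L) * Real.exp (-(1 + 2 * η) * L) := by
      rw [hu, ← Real.exp_add]; congr 1; ring
    have a3 : Real.exp (Λ * f.re - (Λ - 1) * (η * L)) * Real.exp (-(1 + 2 * η) * L) ≤ ((1 + t ^ 2)⁻¹ * Real.exp (Λ * f.re)) := by
      have b1 : (1 + t ^ 2)⁻¹ = Real.exp (-(2 * L)) := by
        rw [← Real.rpow_neg_one, hu]; congr 1; ring
      rw [b1, ← Real.exp_add, ← Real.exp_add]
      refine Real.exp_le_exp.2 ?_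
      have : (Λ - 1) * (η * L) = L := by
        calc _ = (η * (Λ - 1)) * L := by ring
          _ = L := by rw [hΛ, one_mul]
      nlinarith
    rw [a2]
    have : 0 < Real.exp (-(1 + 2 * η) * L) := Real.exp_pos _
    nlinarith
  calc _ ≤ BW * Real.exp f.re * Real.exp (σ * Y) *
        (4 * (h ^ (-(2 * η)) * Real.exp ((1 - 2 * η) * L))) / (c₀ * Real.exp (2 * L)) := by
        gcongr
    _ = BW * 4 / c₀ * M * (Real.exp f.re * Real.exp (-(1 + 2 * η) * L)) := by
        have : Real.exp ((1 - 2 * η) * L) = Real.exp (-(1 + 2 * η) * L) * Real.exp (2 * L) := by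
          rw [← Real.exp_add]; congr 1; ring
        rw [this, hM]
        field_simp
    _ ≤ _ := by gcongr

/-- The exponential of the partial sums of `localLog` on the line `Re s = σ`, estimated against a
kernel of size `|t| ^ (-1 - 2 η)`. -/
lemma exists_norm_integral_le {σ r η Λ B BW : ℝ} (hσ : 0 < σ) (hσr : σ < r) (hr : r < 1)
    (hη : 0 < η) (hη1 : 2 * η ≤ 1) (hΛ : η * (Λ - 1) = 1) (hB : 0 ≤ B) :
    ∃ K : ℝ, ∀ (W F : ℂ → ℂ) (h Y : ℝ), 0 < h → h ≤ 1 → (∀ s : ℂ, s.re = σ → ‖W s‖ ≤ BW) →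
      Measurable (fun t : ℝ => F (σ + t * I)) →
      ∫⁻ t : ℝ, ENNReal.ofReal ((1 + t ^ 2)⁻¹ * Real.exp (Λ * (F (σ + t * I)).re)) ≤
        ENNReal.ofReal B →
      ‖∫ t : ℝ, (W (σ + t * I) * exp (F (σ + t * I)) * exp ((σ + t * I) * Y) *
        ((exp ((σ + t * I) * h) - 1) / h)) / ((σ + t * I - 1) * (σ + t * I - r))‖ ≤
          K * (Real.exp (σ * Y) * h ^ (-(2 * η))) := by
  set c₀ := (1 - σ) * (r - σ) with hc₀
  have hc₀0 : 0 < c₀ := mul_pos (by linarith) (by linarith)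
  have hi1 : Integrable fun t : ℝ => (1 + t ^ 2) ^ (-(1 + η) / 2) := by
    have := integrable_rpow_neg_one_add_norm_sq (E := ℝ) (μ := volume) (r := 1 + η) (by simp [hη])
    simpa using this
  -- The constant precedes `W`, `F`, `h` and `Y`, so one value serves all partial products and all
  -- smoothing widths.
  refine ⟨BW * 4 / c₀ * ((∫ t : ℝ, (1 + t ^ 2) ^ (-(1 + η) / 2)) + B),
    fun W F h Y hh hh1 hW hF hint => ?_⟩
  set M := Real.exp (σ * Y) * h ^ (-(2 * η)) with hM
  have hM0 : 0 < M := by positivity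
  have hBW : 0 ≤ BW := (norm_nonneg _).trans (hW σ (by simp))
  set E2 : ℝ → ℝ := fun t => (1 + t ^ 2)⁻¹ * Real.exp (Λ * (F (σ + t * I)).re) with hE2
  have hE20 : ∀ t, 0 ≤ E2 t := fun t => by positivity
  have hE2m : Measurable E2 := by
    have : Measurable fun t : ℝ => (F (σ + t * I)).re := Complex.measurable_re.comp hF
    rw [hE2]; fun_prop
  have hi2 : Integrable E2 := by
    refine ⟨hE2m.aestronglyMeasurable, ?_⟩
    rw [hasFiniteIntegral_iff_ofReal (Eventually.of_forall hE20)]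
    exact hint.trans_lt ENNReal.ofReal_lt_top
  have hE2B : ∫ t, E2 t ≤ B := by
    rw [integral_eq_lintegral_of_nonneg_ae (Eventually.of_forall hE20) hE2m.aestronglyMeasurable]
    exact ENNReal.toReal_le_of_le_ofReal hB hint
  have hdom : ∀ t : ℝ, ‖(W (σ + t * I) * exp (F (σ + t * I)) * exp ((σ + t * I) * Y) *
        ((exp ((σ + t * I) * h) - 1) / h)) / ((σ + t * I - 1) * (σ + t * I - r))‖ ≤
      BW * 4 / c₀ * M * ((1 + t ^ 2) ^ (-(1 + η) / 2) + E2 t) := by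
    intro t
    exact norm_perron_integrand_le hσ hσr hr hη hη1 hΛ Y hh hh1 _ (by simp) (by simp)
      (hW _ (by simp))
  refine (norm_integral_le_of_norm_le ((hi1.add hi2).const_mul (BW * 4 / c₀ * M))
    (Eventually.of_forall hdom)).trans ?_
  rw [integral_const_mul]
  simp only [Pi.add_apply]
  rw [integral_add hi1 hi2]
  calc BW * 4 / c₀ * M * ((∫ t : ℝ, (1 + t ^ 2) ^ (-(1 + η) / 2)) + ∫ t, E2 t) ≤
      BW * 4 / c₀ * M * ((∫ t : ℝ, (1 + t ^ 2) ^ (-(1 + η) / 2)) + B) := by gcongr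
    _ = _ := by ring

end BeurlingConstruction

end

/-! ### The smoothed counting function -/

section

open MeasureTheory Filter Topology Complex

namespace BeurlingConstruction

namespace UnitPartition

variable {q : ℝ → ℝ} {y : ℕ → ℝ} {C : ℝ} (hq : UnitPartition q y C)

include hq

/-- Uniform in `Im s`, but summable over `j` only for `Re s > 1`. It bounds finite partial sums in
the strip and provides the majorant on `Re s = 2`. -/
lemma norm_localLog_le_three_mul (j : ℕ) {l : ℝ} (hl : y j ≤ l) {s : ℂ} (hs : 1 / 2 ≤ s.re) :
    ‖localLog q y j l s‖ ≤ 3 * Real.exp (-s.re * y j) := by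
  have hy : 0 < y j := by linarith [hq.two_le, hq.y_zero_le j]
  have h : localLog q y j l s = exp (-s * l) - block q y j s +
      (-log (1 - exp (-s * l)) - exp (-s * l)) := by
    rw [localLog]; ring
  have h1 : ‖exp (-s * l)‖ ≤ Real.exp (-s.re * y j) := by
    rw [norm_exp_neg_mul]
    exact Real.exp_le_exp.2 (by nlinarith)
  have h2 := hq.norm_block_le j (s := s) (by linarith)
  have h3 := hq.norm_log_sub_le j hl hs
  have h4 : Real.exp (-2 * s.re * y j) ≤ Real.exp (-s.re * y j) :=
    Real.exp_le_exp.2 (by nlinarith)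
  rw [h]
  have h5 := norm_add_le (exp (-s * l) - block q y j s) (-log (1 - exp (-s * l)) - exp (-s * l))
  have h6 := norm_sub_le (exp (-s * l)) (block q y j s)
  linarith

lemma summable_block {s : ℂ} (hs : 1 < s.re) : Summable fun j => block q y j s :=
  Summable.of_norm_bounded (hq.summable_exp hs) fun j => hq.norm_block_le j (by linarith)

lemma exp_tsum_log {lam : ℕ → ℝ} (hlam : ∀ j, lam j ∈ Set.Icc (y j) (y (j + 1))) {s : ℂ}
    (hs : 1 < s.re) : exp (∑' j, -log (1 - exp (-s * lam j))) =
      exp (∑' j, localLog q y j (lam j) s) * exp (∑' j, block q y j s) := by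
  rw [← exp_add, ← (hq.summable_localLog hlam (by linarith)).tsum_add (hq.summable_block hs)]
  congr 2
  funext j
  rw [localLog]
  ring

/-- The smoothed counting function of the integers is `κ x + c x ^ r` up to a small error. -/
lemma exists_smoothed_count_bound {lam : ℕ → ℝ} (hlam : ∀ j, lam j ∈ Set.Icc (y j) (y (j + 1)))
    {ι : Type*} [Countable ι] {ℓ : ι → ℝ} (hℓ : Summable fun i => Real.exp (-2 * ℓ i))
    (hZ : ∀ s : ℂ, s.re = 2 →
      HasSum (fun i => exp (-s * ℓ i)) (exp (∑' j, -log (1 - exp (-s * lam j)))))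
    {σ r η Λ B BW : ℝ} (hσ : 1 / 2 < σ) (hσr : σ < r) (hr : r < 1)
    (hη : 0 < η) (hη1 : 2 * η ≤ 1) (hΛ : η * (Λ - 1) = 1) (hB : 0 ≤ B)
    (hmom : ∀ J : ℕ, ∫⁻ t : ℝ, ENNReal.ofReal ((1 + t ^ 2)⁻¹ *
        Real.exp (Λ * (∑ j ∈ Finset.range J, localLog q y j (lam j) (σ + t * I)).re)) ≤
          ENNReal.ofReal B)
    {W : ℂ → ℂ} (hWd : DifferentiableOn ℂ W {s | 1 / 2 < s.re})
    (hWB : ∀ s : ℂ, 1 / 2 < s.re → ‖W s‖ ≤ BW)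
    (hW : ∀ s : ℂ, 1 < s.re → exp (∑' j, block q y j s) = s ^ 2 / ((s - 1) * (s - r)) * W s) :
    ∃ K : ℝ, ∀ h Y : ℝ, 0 < h → h ≤ 1 →
      ‖((∑' i, ramp h (Y - ℓ i) : ℝ) : ℂ) -
        (W 1 * exp (∑' j, localLog q y j (lam j) 1) * exp Y * ((exp h - 1) / h) -
          W r * exp (∑' j, localLog q y j (lam j) r) * exp (r * Y) * ((exp (r * h) - 1) / h)) /
            (1 - r)‖ ≤ K * (Real.exp (σ * Y) * h ^ (-(2 * η))) := by
  obtain ⟨K, hK⟩ := exists_norm_integral_le (σ := σ) (r := r) (η := η) (Λ := Λ) (B := B) (BW := BW)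
    (by linarith) hσr hr hη hη1 hΛ hB
  refine ⟨(2 * Real.pi)⁻¹ * K, fun h Y hh hh1 => ?_⟩
  have hBW : 0 ≤ BW := (norm_nonneg _).trans (hWB 1 (by norm_num))
  -- Only finitely many local factors are used at first: a finite partial sum is bounded on the
  -- strip, which justifies shifting the contour, while the full series may be unbounded there.
  set S : ℕ → ℂ → ℂ := fun J s => ∑ j ∈ Finset.range J, localLog q y j (lam j) s with hS
  -- The `s ^ 2` in the template zeta function cancels the `1 / s ^ 2` of the Perron kernel, so
  -- neither appears.
  set G : ℕ → ℂ → ℂ := fun J s => W s * exp (S J s) * exp (s * Y) * ((exp (s * h) - 1) / h) with hG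
  have hh' : (h : ℂ) ≠ 0 := by exact_mod_cast hh.ne'
  have hSd : ∀ J, DifferentiableOn ℂ (S J) {s | 1 / 2 < s.re} := fun J =>
    DifferentiableOn.fun_sum fun j _ => hq.differentiableOn_localLog j (hlam j).1
  have hGd : ∀ J, DifferentiableOn ℂ (G J) {s | 1 / 2 < s.re} := fun J =>
    ((hWd.mul (hSd J).cexp).mul (by fun_prop)).mul (by fun_prop)
  have hkB : ∀ s : ℂ, 0 ≤ s.re → s.re ≤ 2 →
      ‖exp (s * Y) * ((exp (s * h) - 1) / h)‖ ≤ Real.exp (2 * |Y|) * ((Real.exp 2 + 1) / h) := by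
    intro s h0 h2
    rw [norm_mul, norm_div, Complex.norm_real, Real.norm_of_nonneg hh.le, Complex.norm_exp]
    have e1 : (s * (Y : ℂ)).re ≤ 2 * |Y| := by
      simp only [re_mul_ofReal]
      calc s.re * Y ≤ s.re * |Y| := by gcongr; exact le_abs_self Y
        _ ≤ 2 * |Y| := by gcongr
    have e2 : ‖exp (s * h) - 1‖ ≤ Real.exp 2 + 1 := by
      refine (norm_sub_le _ _).trans ?_
      rw [norm_one, Complex.norm_exp]
      gcongr
      simp only [re_mul_ofReal]
      nlinarith
    gcongr
  have hSB : ∀ J (s : ℂ), 1 / 2 < s.re → ‖S J s‖ ≤ 3 * J := by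
    intro J s hs
    refine (norm_sum_le _ _).trans ?_
    calc ∑ j ∈ Finset.range J, ‖localLog q y j (lam j) s‖ ≤ ∑ j ∈ Finset.range J, (3 : ℝ) := by
          refine Finset.sum_le_sum fun j _ => ?_
          have h1 := hq.norm_localLog_le_three_mul j (hlam j).1 hs.le
          have h2 := hq.exp_neg_mul_le_half j le_rfl hs.le
          linarith
      _ = 3 * J := by simp; ring
  have hGB : ∀ J (s : ℂ), σ ≤ s.re → s.re ≤ 2 → ‖G J s‖ ≤
      BW * Real.exp (3 * J) * (Real.exp (2 * |Y|) * ((Real.exp 2 + 1) / h)) := by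
    intro J s h1 h2
    rw [hG]
    dsimp only
    rw [mul_assoc, norm_mul, norm_mul]
    gcongr
    · exact hWB s (by linarith)
    · rw [Complex.norm_exp]
      exact Real.exp_le_exp.2 ((Complex.re_le_norm _).trans (hSB J s (by linarith)))
    · exact hkB s (by linarith) h2
  have hshift : ∀ J, (∫ t : ℝ, G J (2 + t * I) / ((2 + t * I - 1) * (2 + t * I - r))) =
      (∫ t : ℝ, G J (σ + t * I) / ((σ + t * I - 1) * (σ + t * I - r))) +
        2 * Real.pi * ((G J 1 - G J r) / (1 - r)) := fun J =>
    integral_div_sub_integral_div hσ (by linarith) hσr hr (hGd J) (hGB J)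
  have hσbound : ∀ J, ‖∫ t : ℝ, G J (σ + t * I) / ((σ + t * I - 1) * (σ + t * I - r))‖ ≤
      K * (Real.exp (σ * Y) * h ^ (-(2 * η))) := by
    intro J
    refine hK W (S J) h Y hh hh1 (fun s hs => hWB s (by linarith)) ?_ (hmom J)
    have : Continuous fun t : ℝ => S J (σ + t * I) :=
      (hSd J).continuousOn.comp_continuous (by fun_prop) fun t => by simpa using hσ
    exact this.measurable
  set Q : ℂ → ℂ := fun s => ∑' j, localLog q y j (lam j) s with hQ
  have hSlim : ∀ s : ℂ, 1 / 2 < s.re → Tendsto (fun J => S J s) atTop (𝓝 (Q s)) := fun s hs =>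
    (hq.summable_localLog hlam hs).hasSum.tendsto_sum_nat
  have hGlim : ∀ s : ℂ, 1 / 2 < s.re → Tendsto (fun J => G J s) atTop
      (𝓝 (W s * exp (Q s) * exp (s * Y) * ((exp (s * h) - 1) / h))) := fun s hs =>
    ((((continuous_exp.tendsto _).comp (hSlim s hs)).const_mul (W s)).mul_const _).mul_const _
  have hsum2 : Summable fun j => 3 * Real.exp (-2 * y j) :=
    (hq.summable_exp (by norm_num)).mul_left 3
  -- The limit `J → ∞` is taken on `Re s = 2`, where the local logarithms are uniformly summable.
  have hdct : Tendsto (fun J => ∫ t : ℝ, G J (2 + t * I) / ((2 + t * I - 1) * (2 + t * I - r)))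
      atTop (𝓝 (∫ t : ℝ, (W (2 + t * I) * exp (Q (2 + t * I)) * exp ((2 + t * I) * Y) *
        ((exp ((2 + t * I) * h) - 1) / h)) / ((2 + t * I - 1) * (2 + t * I - r)))) := by
    refine tendsto_integral_of_dominated_convergence (fun t : ℝ =>
      BW * Real.exp (∑' j, 3 * Real.exp (-2 * y j)) *
        (Real.exp (2 * |Y|) * ((Real.exp 2 + 1) / h)) * (1 + t ^ 2)⁻¹) ?_
      (integrable_inv_one_add_sq.const_mul _) ?_ ?_
    · intro J
      have hc : Continuous fun t : ℝ => G J (2 + t * I) :=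
        (hGd J).continuousOn.comp_continuous (by fun_prop) fun t => by simp; norm_num
      exact (hc.measurable.div (by fun_prop)).aestronglyMeasurable
    · intro J
      refine Eventually.of_forall fun t => ?_
      have hre : (2 + t * I : ℂ).re = 2 := by simp
      have hden : 1 + t ^ 2 ≤ ‖(2 + t * I - 1 : ℂ) * (2 + t * I - r)‖ := by
        rw [norm_mul]
        have k1 : √(1 + t ^ 2) ≤ ‖(2 + t * I - 1 : ℂ)‖ := by
          apply Real.sqrt_le_iff.2 ⟨norm_nonneg _, ?_⟩
          rw [← Complex.normSq_eq_norm_sq, Complex.normSq_apply]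
          simp; nlinarith
        have k2 : √(1 + t ^ 2) ≤ ‖(2 + t * I - r : ℂ)‖ := by
          apply Real.sqrt_le_iff.2 ⟨norm_nonneg _, ?_⟩
          rw [← Complex.normSq_eq_norm_sq, Complex.normSq_apply]
          simp; nlinarith
        calc 1 + t ^ 2 = √(1 + t ^ 2) * √(1 + t ^ 2) := (Real.mul_self_sqrt (by positivity)).symm
          _ ≤ _ := mul_le_mul k1 k2 (Real.sqrt_nonneg _) (norm_nonneg _)
      have hSle : (S J (2 + t * I)).re ≤ ∑' j, 3 * Real.exp (-2 * y j) := by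
        refine (Complex.re_le_norm _).trans ((norm_sum_le _ _).trans ?_)
        refine le_trans (Finset.sum_le_sum fun j _ => ?_)
          (hsum2.sum_le_tsum (Finset.range J) fun j _ => by positivity)
        have := hq.norm_localLog_le_three_mul j (hlam j).1 (s := 2 + t * I) (by rw [hre]; norm_num)
        rwa [hre] at this
      rw [norm_div, ← div_eq_mul_inv]
      have hnum : ‖G J (2 + t * I)‖ ≤ BW * Real.exp (∑' j, 3 * Real.exp (-2 * y j)) *
          (Real.exp (2 * |Y|) * ((Real.exp 2 + 1) / h)) := by
        rw [hG]
        dsimp only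
        rw [mul_assoc, norm_mul, norm_mul]
        gcongr
        · exact hWB _ (by rw [hre]; norm_num)
        · rw [Complex.norm_exp]
          exact Real.exp_le_exp.2 hSle
        · exact hkB _ (by rw [hre]; norm_num) (by rw [hre])
      gcongr
    · refine Eventually.of_forall fun t => ?_
      exact (hGlim _ (by simp; norm_num)).div_const _
  have hperron := hasSum_ramp hℓ (Z := fun s => exp (∑' j, -log (1 - exp (-s * lam j)))) hZ hh Y
  have hlim_eq : (∫ t : ℝ, (W (2 + t * I) * exp (Q (2 + t * I)) * exp ((2 + t * I) * Y) *
      ((exp ((2 + t * I) * h) - 1) / h)) / ((2 + t * I - 1) * (2 + t * I - r))) =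
      2 * Real.pi * ((∑' i, ramp h (Y - ℓ i) : ℝ) : ℂ) := by
    have e1 : 2 * Real.pi * ((∑' i, ramp h (Y - ℓ i) : ℝ) : ℂ) =
        ((∑' i, 2 * Real.pi * ramp h (Y - ℓ i) : ℝ) : ℂ) := by
      rw [tsum_mul_left]; push_cast; ring
    rw [e1, ofReal_tsum, hperron.tsum_eq]
    refine integral_congr_ae (Eventually.of_forall fun t => ?_)
    dsimp only
    have hre : (2 + t * I : ℂ).re = 2 := by simp
    generalize (2 + t * I : ℂ) = s at hre
    rw [hq.exp_tsum_log hlam (by rw [hre]; norm_num), hW s (by rw [hre]; norm_num)]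
    have hs0 : s ≠ 0 := by rintro rfl; simp at hre
    rw [hQ]
    field_simp
  rw [hlim_eq] at hdct
  have hmain : Tendsto (fun J => (∫ t : ℝ, G J (2 + t * I) / ((2 + t * I - 1) * (2 + t * I - r))) -
      2 * Real.pi * ((G J 1 - G J r) / (1 - r))) atTop (𝓝 _) :=
    hdct.sub ((((hGlim 1 (by norm_num)).sub (hGlim r (by simp; linarith))).div_const _).const_mul _)
  -- On `Re s = σ` a bound uniform in `J` is enough; the limit of that integral is never identified.
  have hfin := le_of_tendsto hmain.norm (Eventually.of_forall fun J => by
    rw [hshift J, add_sub_cancel_right]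
    exact hσbound J)
  rw [← mul_sub, norm_mul] at hfin
  have hpi : ‖(2 * Real.pi : ℂ)‖ = 2 * Real.pi := by
    rw [← ofReal_ofNat, ← ofReal_mul, Complex.norm_real, Real.norm_of_nonneg (by positivity)]
  rw [hpi] at hfin
  simp only [one_mul] at hfin
  have hle := (le_div_iff₀' (by positivity : (0 : ℝ) < 2 * Real.pi)).2 hfin
  exact hle.trans (le_of_eq (by ring))

end UnitPartition

end BeurlingConstruction

end

/-! ### Sharp counts, residues at real points, and sums over primes -/

section

open MeasureTheory Filter Topology Complex

namespace BeurlingConstruction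

section counting

variable {w : Nat.Primes → ℝ} {δ : ℝ} (hδ : 0 < δ) (hw : ∀ p, δ ≤ w p)
  (hfin : ∀ y, {p | w p ≤ y}.Finite)

include hδ hw hfin in
lemma support_ramp_subset {h : ℝ} (hh : 0 < h) (Y : ℝ) (n : ℕ+)
    (hn : n ∉ (finite_logSize_le hδ hw hfin (Y + h)).toFinset) : ramp h (Y - logSize w n) = 0 := by
  simp only [Set.Finite.mem_toFinset, Set.mem_ofPred_eq, not_le] at hn
  exact ramp_of_le hh (by linarith)

lemma count_eq_card {x : ℝ} (hx : 0 < x) : (semigroup w hδ hw hfin).count x =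
    (finite_logSize_le hδ hw hfin (Real.log x)).toFinset.card := by
  rw [ArithmeticalSemigroup.count,
    ← Set.ncard_eq_toFinset_card _ (finite_logSize_le hδ hw hfin (Real.log x))]
  congr 1
  ext n
  simp only [Set.mem_ofPred_eq, semigroup_norm]
  exact (Real.le_log_iff_exp_le hx).symm

lemma count_le_tsum_ramp {x h : ℝ} (hx : 0 < x) (hh : 0 < h) :
    ((semigroup w hδ hw hfin).count x : ℝ) ≤ ∑' n, ramp h (Real.log x - logSize w n) := by
  rw [count_eq_card hδ hw hfin hx,
    tsum_eq_sum (fun n hn => support_ramp_subset hδ hw hfin hh (Real.log x) n hn)]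
  have hsub : (finite_logSize_le hδ hw hfin (Real.log x)).toFinset ⊆
      (finite_logSize_le hδ hw hfin (Real.log x + h)).toFinset := by
    intro n hn
    simp only [Set.Finite.mem_toFinset, Set.mem_ofPred_eq] at hn ⊢
    linarith
  refine le_trans ?_ (Finset.sum_le_sum_of_subset_of_nonneg hsub fun n _ _ => ramp_nonneg hh _)
  rw [Finset.sum_congr rfl fun n hn => ramp_of_nonneg hh (by
    simp only [Set.Finite.mem_toFinset, Set.mem_ofPred_eq] at hn
    linarith)]
  simp

lemma tsum_ramp_le_count {x h : ℝ} (hx : 0 < x) (hh : 0 < h) :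
    ∑' n, ramp h (Real.log x - h - logSize w n) ≤ ((semigroup w hδ hw hfin).count x : ℝ) := by
  rw [count_eq_card hδ hw hfin hx,
    tsum_eq_sum (fun n hn => support_ramp_subset hδ hw hfin hh (Real.log x - h) n hn)]
  simp only [sub_add_cancel]
  refine (Finset.sum_le_card_nsmul _ _ 1 fun n _ => ramp_le_one hh _).trans ?_
  simp

end counting

lemma norm_exp_sub_one_div_sub_one_le {u : ℝ} (hu : |u| ≤ 1) (hu0 : u ≠ 0) :
    |(Real.exp u - 1) / u - 1| ≤ |u| := by
  have h := Real.abs_exp_sub_one_sub_id_le hu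
  have e : (Real.exp u - 1) / u - 1 = (Real.exp u - 1 - u) / u := by field_simp
  rw [e, abs_div, div_le_iff₀ (abs_pos.2 hu0), ← sq, sq_abs]
  exact h

namespace UnitPartition

variable {q : ℝ → ℝ} {y : ℕ → ℝ} {C : ℝ} (hq : UnitPartition q y C)

include hq

lemma localLog_ofReal (j : ℕ) {l : ℝ} (hl : y j ≤ l) {x : ℝ} (hx : 1 / 2 ≤ x) :
    localLog q y j l x = ((localLog q y j l x).re : ℂ) := by
  have h1 : exp (-(x : ℂ) * l) = (Real.exp (-x * l) : ℝ) := by push_cast; rfl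
  have h2 : block q y j x = ((∫ τ in (y j)..(y (j + 1)), Real.exp (-x * τ) * q τ : ℝ) : ℂ) := by
    rw [block, ← intervalIntegral.integral_ofReal]
    push_cast
    rfl
  have h3 := hq.exp_neg_mul_le_half j hl hx
  rw [localLog, h1, h2, ← ofReal_one, ← ofReal_sub, ← Complex.ofReal_log (by linarith)]
  simp

/-- At the two real poles `1` and `r` the correction factor is positive, hence the two residues have
a definite sign and do not vanish. -/
lemma exists_exp_tsum_localLog {lam : ℕ → ℝ} (hlam : ∀ j, lam j ∈ Set.Icc (y j) (y (j + 1)))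
    {x : ℝ} (hx : 1 / 2 ≤ x) :
    ∃ b : ℝ, exp (∑' j, localLog q y j (lam j) x) = (Real.exp b : ℝ) := by
  refine ⟨∑' j, (localLog q y j (lam j) x).re, ?_⟩
  rw [ofReal_exp, ofReal_tsum]
  congr 2
  funext j
  exact hq.localLog_ofReal j (hlam j).1 hx

lemma tendsto_y : Tendsto y atTop atTop := by
  have hC := hq.C_pos
  refine tendsto_atTop.2 fun b => ?_
  obtain ⟨n, hn⟩ := exists_nat_gt (C * Real.exp b)
  filter_upwards [eventually_ge_atTop n] with j hj
  have h1 := hq.exp_y_ge j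
  have h2 : (n : ℝ) ≤ j := by exact_mod_cast hj
  have h3 : C * Real.exp b < C * Real.exp (y j) := by linarith
  exact (Real.exp_lt_exp.1 (lt_of_mul_lt_mul_left h3 hC.le)).le

lemma finite_lam_le {lam : ℕ → ℝ} (hlam : ∀ j, lam j ∈ Set.Icc (y j) (y (j + 1))) (Y : ℝ) :
    {j | lam j ≤ Y}.Finite := by
  obtain ⟨n, hn⟩ := ((tendsto_atTop.1 hq.tendsto_y) (Y + 1)).exists_forall_of_atTop
  refine (Set.finite_lt_nat n).subset fun j hj => ?_
  by_contra h
  have h1 := hn j (not_lt.1 h)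
  have h2 := (hlam j).1
  have h3 : lam j ≤ Y := hj
  linarith

lemma card_lam_le {lam : ℕ → ℝ} (hlam : ∀ j, lam j ∈ Set.Icc (y j) (y (j + 1))) (Y : ℝ) :
    ((hq.finite_lam_le hlam Y).toFinset.card : ℝ) ≤ C * Real.exp Y + 1 := by
  have hC := hq.C_pos
  have hsub : (hq.finite_lam_le hlam Y).toFinset ⊆ Finset.range (⌊C * Real.exp Y⌋₊ + 1) := by
    intro j hj
    simp only [Set.Finite.mem_toFinset, Set.mem_ofPred_eq] at hj
    rw [Finset.mem_range, Nat.lt_succ_iff]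
    refine Nat.le_floor ((hq.exp_y_ge j).trans ?_)
    gcongr
    exact (hlam j).1.trans hj
  have h1 := Finset.card_le_card hsub
  rw [Finset.card_range] at h1
  have h2 : ((⌊C * Real.exp Y⌋₊ : ℕ) : ℝ) ≤ C * Real.exp Y := Nat.floor_le (by positivity)
  have h3 : ((hq.finite_lam_le hlam Y).toFinset.card : ℝ) ≤ ((⌊C * Real.exp Y⌋₊ + 1 : ℕ) : ℝ) := by
    exact_mod_cast h1
  push_cast at h3
  linarith

/-- The sum of the logarithmic sizes of the primes follows the density. -/
lemma abs_sum_lam_sub_integral_le {lam : ℕ → ℝ}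
    (hlam : ∀ j, lam j ∈ Set.Icc (y j) (y (j + 1))) {Y : ℝ} (hY : y 0 ≤ Y) :
    |∑ j ∈ (hq.finite_lam_le hlam Y).toFinset, lam j - ∫ τ in (y 0)..Y, τ * q τ| ≤ 3 * Y := by
  have hy0 : 0 < y 0 := by linarith [hq.two_le]
  -- The interval containing `Y`. Below it, a prime and the mean of `τ` over its interval both lie
  -- in `[y j, y (j + 1)]`, so their differences telescope to at most `Y`; the incomplete interval
  -- adds at most `Y` to the sum and at most `Y` to the integral.
  obtain ⟨J, hJ1, hJ2⟩ : ∃ J, y J ≤ Y ∧ Y < y (J + 1) := by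
    have hex : ∃ n, Y < y n := by
      obtain ⟨n, hn⟩ := ((tendsto_atTop.1 hq.tendsto_y) (Y + 1)).exists
      exact ⟨n, by linarith⟩
    classical
    have h0 : Nat.find hex ≠ 0 := by
      intro h
      have := Nat.find_spec hex
      rw [h] at this
      linarith
    obtain ⟨J, hJ⟩ := Nat.exists_eq_succ_of_ne_zero h0
    refine ⟨J, not_lt.1 (Nat.find_min hex (by omega)), ?_⟩
    have := Nat.find_spec hex
    rwa [hJ] at this
  have hmul : ∀ a b : ℝ, y 0 ≤ a → y 0 ≤ b → IntervalIntegrable (fun τ => τ * q τ) volume a b :=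
    fun a b ha hb => (hq.intervalIntegrable ha hb).continuousOn_mul continuousOn_id
  have hsplit : ∫ τ in (y 0)..Y, τ * q τ =
      (∑ j ∈ Finset.range J, ∫ τ in (y j)..(y (j + 1)), τ * q τ) + ∫ τ in (y J)..Y, τ * q τ := by
    rw [intervalIntegral.sum_integral_adjacent_intervals fun k _ =>
      hmul _ _ (hq.y_zero_le _) (hq.y_zero_le _),
      intervalIntegral.integral_add_adjacent_intervals (hmul _ _ le_rfl (hq.y_zero_le _))
        (hmul _ _ (hq.y_zero_le _) hY)]
  have hblock : ∀ j, y j ≤ ∫ τ in (y j)..(y (j + 1)), τ * q τ ∧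
      ∫ τ in (y j)..(y (j + 1)), τ * q τ ≤ y (j + 1) := by
    intro j
    have hi := hq.intervalIntegrable_block j
    have hm := hmul _ _ (hq.y_zero_le j) (hq.y_zero_le (j + 1))
    constructor
    · calc y j = ∫ τ in (y j)..(y (j + 1)), y j * q τ := by
            rw [intervalIntegral.integral_const_mul, hq.integral_eq_one, mul_one]
        _ ≤ _ := intervalIntegral.integral_mono_on (hq.y_le_succ j) (hi.const_mul _) hm fun τ hτ =>
            mul_le_mul_of_nonneg_right hτ.1 (hq.nonneg τ ((hq.y_zero_le j).trans hτ.1))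
    · calc _ ≤ ∫ τ in (y j)..(y (j + 1)), y (j + 1) * q τ :=
            intervalIntegral.integral_mono_on (hq.y_le_succ j) hm (hi.const_mul _) fun τ hτ =>
              mul_le_mul_of_nonneg_right hτ.2 (hq.nonneg τ ((hq.y_zero_le j).trans hτ.1))
        _ = y (j + 1) := by rw [intervalIntegral.integral_const_mul, hq.integral_eq_one, mul_one]
  have hlast : 0 ≤ ∫ τ in (y J)..Y, τ * q τ ∧ ∫ τ in (y J)..Y, τ * q τ ≤ Y := by
    have hpos : ∀ τ, y 0 ≤ τ → 0 ≤ q τ := hq.nonneg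
    constructor
    · refine intervalIntegral.integral_nonneg hJ1 fun τ hτ => ?_
      have : y 0 ≤ τ := (hq.y_zero_le J).trans hτ.1
      exact mul_nonneg (by linarith) (hpos τ this)
    · have hi := hq.intervalIntegrable (hq.y_zero_le J) hY
      calc ∫ τ in (y J)..Y, τ * q τ ≤ ∫ τ in (y J)..Y, Y * q τ :=
            intervalIntegral.integral_mono_on hJ1 (hmul _ _ (hq.y_zero_le J) hY) (hi.const_mul _)
              fun τ hτ => mul_le_mul_of_nonneg_right hτ.2 (hpos τ ((hq.y_zero_le J).trans hτ.1))
        _ = Y * ∫ τ in (y J)..Y, q τ := intervalIntegral.integral_const_mul _ _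
        _ ≤ Y * ∫ τ in (y J)..(y (J + 1)), q τ := by
            refine mul_le_mul_of_nonneg_left ?_ (by linarith)
            refine intervalIntegral.integral_mono_interval le_rfl hJ1 hJ2.le ?_
              (hq.intervalIntegrable_block J)
            refine (ae_restrict_mem measurableSet_Ioc).mono fun τ hτ => ?_
            exact hpos τ ((hq.y_zero_le J).trans hτ.1.le)
        _ = Y := by rw [hq.integral_eq_one, mul_one]
  have hset : ∃ e : ℝ, 0 ≤ e ∧ e ≤ Y ∧ ∑ j ∈ (hq.finite_lam_le hlam Y).toFinset, lam j =
      ∑ j ∈ Finset.range J, lam j + e := by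
    have hsub1 : Finset.range J ⊆ (hq.finite_lam_le hlam Y).toFinset := by
      intro j hj
      simp only [Set.Finite.mem_toFinset, Set.mem_ofPred_eq]
      refine (hlam j).2.trans ((hq.strictMono.monotone ?_).trans hJ1)
      have := Finset.mem_range.1 hj
      omega
    have hsub2 : (hq.finite_lam_le hlam Y).toFinset ⊆ Finset.range (J + 1) := by
      intro j hj
      simp only [Set.Finite.mem_toFinset, Set.mem_ofPred_eq] at hj
      rw [Finset.mem_range]
      by_contra h
      have h1 : y (J + 1) ≤ y j := hq.strictMono.monotone (not_lt.1 h)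
      linarith [(hlam j).1]
    have hlam0 : ∀ j, 0 ≤ lam j := fun j => by linarith [(hlam j).1, hq.y_zero_le j]
    refine ⟨∑ j ∈ (hq.finite_lam_le hlam Y).toFinset \ Finset.range J, lam j,
      Finset.sum_nonneg fun j _ => hlam0 j, ?_, ?_⟩
    · have hcard : ((hq.finite_lam_le hlam Y).toFinset \ Finset.range J).card ≤ 1 := by
        rw [Finset.card_sdiff_of_subset hsub1]
        have := Finset.card_le_card hsub2
        simp only [Finset.card_range] at this ⊢
        omega
      refine (Finset.sum_le_card_nsmul _ _ Y fun j hj => ?_).trans ?_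
      · have := (Finset.mem_sdiff.1 hj).1
        simpa using this
      · rw [nsmul_eq_mul]
        have : (((hq.finite_lam_le hlam Y).toFinset \ Finset.range J).card : ℝ) ≤ 1 := by
          exact_mod_cast hcard
        nlinarith
    · rw [add_comm, Finset.sum_sdiff hsub1]
  obtain ⟨e, he0, he1, he⟩ := hset
  have hsum : |∑ j ∈ Finset.range J, (lam j - ∫ τ in (y j)..(y (j + 1)), τ * q τ)| ≤ Y := by
    refine (Finset.abs_sum_le_sum_abs _ _).trans ?_
    calc ∑ j ∈ Finset.range J, |lam j - ∫ τ in (y j)..(y (j + 1)), τ * q τ| ≤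
        ∑ j ∈ Finset.range J, (y (j + 1) - y j) := by
          refine Finset.sum_le_sum fun j _ => ?_
          have := hblock j
          have := hlam j
          rw [abs_le]
          constructor <;> linarith [this.1, this.2, (hblock j).1, (hblock j).2]
      _ = y J - y 0 := Finset.sum_range_sub y J
      _ ≤ Y := by linarith
  rw [Finset.sum_sub_distrib] at hsum
  rw [he, hsplit]
  rw [abs_le] at hsum ⊢
  constructor <;> linarith [hsum.1, hsum.2, hlast.1, hlast.2]

end UnitPartition

end BeurlingConstruction

end

/-! ### Axiom A and the discretization theorem -/

section

open MeasureTheory Filter Topology Complex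

namespace BeurlingConstruction

/-- A two-term asymptotic formula for the counting function gives Axiom A with exponent `r`. -/
lemma axiomA_of_asymptotic {G : Type*} [CommMonoid G] (S : ArithmeticalSemigroup G)
    {κ c K r θ₀ : ℝ} (hκ : 0 < κ) (hr0 : 0 < r) (hr1 : r < 1) (hθ₀ : θ₀ ≤ r)
    (hN : ∀ x : ℝ, 1 ≤ x → |(S.count x : ℝ) - κ * x - c * x ^ r| ≤ K * x ^ θ₀) :
    S.AxiomA κ r := by
  refine ⟨hκ, hr0, hr1, |K| + κ + |c|, fun x hx => ?_⟩
  have h1 := hN x hx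
  have h2 : x ^ θ₀ ≤ x ^ r := Real.rpow_le_rpow_of_exponent_le hx hθ₀
  have h3 : 1 ≤ x ^ r := Real.one_le_rpow hx hr0.le
  have h4 : 0 ≤ x ^ θ₀ := by positivity
  have e : (S.count x : ℝ) - κ * (x - 1) = ((S.count x : ℝ) - κ * x - c * x ^ r) + κ + c * x ^ r := by
    ring
  rw [e]
  refine (abs_add_le _ _).trans ?_
  refine (add_le_add_left (abs_add_le _ _) _).trans ?_
  rw [abs_of_pos hκ, abs_mul, abs_of_pos (by linarith : 0 < x ^ r)]
  have h5 : K * x ^ θ₀ ≤ |K| * x ^ r :=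
    (mul_le_mul_of_nonneg_right (le_abs_self K) h4).trans
      (mul_le_mul_of_nonneg_left h2 (abs_nonneg K))
  nlinarith

/-- A genuine secondary term `c x ^ r` excludes Axiom A with an exponent below `r`. -/
lemma le_of_axiomA {G : Type*} [CommMonoid G] (S : ArithmeticalSemigroup G)
    {κ c K r θ₀ : ℝ} (hc : c ≠ 0) (hr0 : 0 < r) (hr1 : r < 1) (hθ₀ : θ₀ < r)
    (hN : ∀ x : ℝ, 1 ≤ x → |(S.count x : ℝ) - κ * x - c * x ^ r| ≤ K * x ^ θ₀) {κ' θ : ℝ}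
    (hA : S.AxiomA κ' θ) : r ≤ θ := by
  obtain ⟨-, hθ0, hθ1, A, hA⟩ := hA
  by_contra hlt
  rw [not_le] at hlt
  have hbound : ∀ x : ℝ, 1 ≤ x → |(κ - κ') * x + c * x ^ r + κ'| ≤ K * x ^ θ₀ + A * x ^ θ := by
    intro x hx
    have e : (κ - κ') * x + c * x ^ r + κ' =
        -((S.count x : ℝ) - κ * x - c * x ^ r) + ((S.count x : ℝ) - κ' * (x - 1)) := by ring
    rw [e]
    refine (abs_add_le _ _).trans ?_
    rw [abs_neg]
    exact add_le_add (hN x hx) (hA x hx)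
  have hpow : ∀ a b : ℝ, a < b → Tendsto (fun x : ℝ => x ^ a / x ^ b) atTop (𝓝 0) := by
    intro a b hab
    refine (tendsto_rpow_neg_atTop (sub_pos.2 hab)).congr' ?_
    filter_upwards [eventually_gt_atTop 0] with x hx
    rw [← Real.rpow_sub hx]
    congr 1
    ring
  -- Taking `b = 1` forces `κ = κ'`; then `b = r` forces `c = 0`, a contradiction.
  have hquot : ∀ b : ℝ, r ≤ b → Tendsto
      (fun x : ℝ => ((κ - κ') * x + c * x ^ r + κ') / x ^ b) atTop (𝓝 0) := by
    intro b hb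
    have h1 := ((hpow θ₀ b (by linarith)).const_mul K).add ((hpow θ b (by linarith)).const_mul A)
    simp only [mul_zero, add_zero] at h1
    refine squeeze_zero_norm' ?_ h1
    filter_upwards [eventually_ge_atTop 1] with x hx
    have hxb : 0 < x ^ b := Real.rpow_pos_of_pos (by linarith) _
    rw [norm_div, Real.norm_eq_abs, Real.norm_of_nonneg hxb.le, div_le_iff₀ hxb]
    refine (hbound x hx).trans (le_of_eq ?_)
    field_simp
  have hκ : κ - κ' = 0 := by
    have h1 := hquot 1 hr1.le
    have h2 : Tendsto (fun x : ℝ => ((κ - κ') * x + c * x ^ r + κ') / x ^ (1 : ℝ)) atTop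
        (𝓝 (κ - κ')) := by
      have := ((tendsto_const_nhds (x := κ - κ')).add ((hpow r 1 hr1).const_mul c)).add
        ((hpow 0 1 one_pos).const_mul κ')
      simp only [mul_zero, add_zero] at this
      refine this.congr' ?_
      filter_upwards [eventually_gt_atTop 0] with x hx
      simp only [Real.rpow_one, Real.rpow_zero]
      field_simp
    exact tendsto_nhds_unique h2 h1
  have h1 := hquot r le_rfl
  have h2 : Tendsto (fun x : ℝ => ((κ - κ') * x + c * x ^ r + κ') / x ^ r) atTop (𝓝 c) := by
    have := (tendsto_const_nhds (x := c)).add ((hpow 0 r hr0).const_mul κ')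
    simp only [mul_zero, add_zero] at this
    refine this.congr' ?_
    filter_upwards [eventually_gt_atTop 0] with x hx
    have hxr : 0 < x ^ r := Real.rpow_pos_of_pos hx _
    rw [hκ, Real.rpow_zero]
    field_simp
    ring
  exact hc (tendsto_nhds_unique h2 h1)

/-- Unsmoothing: a monotone sandwich by the smoothed sums `F h Y` turns their two-term asymptotic
formula into one for `N`. -/
lemma exists_abs_sub_le_of_smoothed {F : ℝ → ℝ → ℝ} {N : ℝ → ℝ} {κ c K σ η r : ℝ} (hκ0 : 0 < κ)
    (hσ : 1 / 2 ≤ σ) (hr0 : 0 < r) (hr : r < 1) (hη : 0 < η)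
    (hreal : ∀ h Y : ℝ, 0 < h → h ≤ 1 →
      |F h Y - (κ * (Real.exp Y * ((Real.exp h - 1) / h)) +
        c * (Real.exp (r * Y) * ((Real.exp (r * h) - 1) / (r * h))))| ≤
        K * (Real.exp (σ * Y) * h ^ (-(2 * η))))
    (hup : ∀ x h : ℝ, 0 < x → 0 < h → N x ≤ F h (Real.log x))
    (hlow : ∀ x h : ℝ, 0 < x → 0 < h → F h (Real.log x - h) ≤ N x) :
    ∃ K' : ℝ, ∀ x : ℝ, 1 ≤ x → |N x - κ * x - c * x ^ r| ≤ K' * x ^ (σ + η) := by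
  have hK0 : 0 ≤ K := by
    have := (abs_nonneg _).trans (hreal 1 0 one_pos le_rfl)
    simpa using this
  refine ⟨κ + |c| + K, fun x hx => ?_⟩
  have hx0 : 0 < x := by linarith
  set Y := Real.log x with hY
  have hY0 : 0 ≤ Y := Real.log_nonneg hx
  have hxY : x = Real.exp Y := (Real.exp_log hx0).symm
  -- The width `h = x ^ (-1 / 2)`: unsmoothing costs `x * h = x ^ (1 / 2)`, and the factor `h ^ (-2
  -- η)` is exactly `x ^ η`.
  set h := Real.exp (-Y / 2) with hh
  have hh0 : 0 < h := Real.exp_pos _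
  have hh1 : h ≤ 1 := Real.exp_le_one_iff.2 (by linarith)
  have hxh : Real.exp Y * h ≤ x ^ (σ + η) := by
    rw [hxY, ← Real.exp_mul, hh, ← Real.exp_add]
    refine Real.exp_le_exp.2 ?_
    nlinarith
  have hrY : Real.exp (r * Y) ≤ Real.exp Y := Real.exp_le_exp.2 (by nlinarith)
  have hxr : x ^ r = Real.exp (r * Y) := by
    rw [hxY, ← Real.exp_mul, mul_comm]
  have herr : Real.exp (σ * Y) * h ^ (-(2 * η)) = x ^ (σ + η) := by
    rw [hh, ← Real.exp_mul, ← Real.exp_add, hxY, ← Real.exp_mul]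
    congr 1
    ring
  -- Both signs are needed: evaluating the smoothed sum at `Y - h` turns `(exp h - 1) / h` into the
  -- same quotient at `-h`.
  have happrox : ∀ u : ℝ, |u| = h →
      |κ * (Real.exp Y * ((Real.exp u - 1) / u)) +
        c * (Real.exp (r * Y) * ((Real.exp (r * u) - 1) / (r * u))) - (κ * x + c * x ^ r)| ≤
        (κ + |c|) * x ^ (σ + η) := by
    intro u hu
    have hu0 : u ≠ 0 := by rintro rfl; simp at hu; linarith
    have a1 := norm_exp_sub_one_div_sub_one_le (u := u) (by rw [hu]; exact hh1) hu0
    have a2 := norm_exp_sub_one_div_sub_one_le (u := r * u) (by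
      rw [abs_mul, hu, abs_of_pos hr0]; nlinarith) (mul_ne_zero hr0.ne' hu0)
    rw [hu] at a1
    rw [abs_mul, hu, abs_of_pos hr0] at a2
    have e : κ * (Real.exp Y * ((Real.exp u - 1) / u)) +
        c * (Real.exp (r * Y) * ((Real.exp (r * u) - 1) / (r * u))) - (κ * x + c * x ^ r) =
        κ * (Real.exp Y * ((Real.exp u - 1) / u - 1)) +
        c * (Real.exp (r * Y) * ((Real.exp (r * u) - 1) / (r * u) - 1)) := by
      rw [hxr, hxY]; ring
    rw [e]
    refine (abs_add_le _ _).trans ?_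
    rw [abs_mul, abs_mul, abs_mul, abs_mul, abs_of_pos hκ0, Real.abs_exp, Real.abs_exp, add_mul]
    have b1 : Real.exp Y * |(Real.exp u - 1) / u - 1| ≤ x ^ (σ + η) :=
      (mul_le_mul_of_nonneg_left a1 (Real.exp_pos _).le).trans hxh
    have b2 : Real.exp (r * Y) * |(Real.exp (r * u) - 1) / (r * u) - 1| ≤ x ^ (σ + η) := by
      refine le_trans (mul_le_mul hrY (a2.trans ?_) (abs_nonneg _) (Real.exp_pos _).le) hxh
      nlinarith
    exact add_le_add (mul_le_mul_of_nonneg_left b1 hκ0.le)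
      (mul_le_mul_of_nonneg_left b2 (abs_nonneg c))
  have hup := hup x h hx0 hh0
  have hlow := hlow x h hx0 hh0
  have r1 := hreal h Y hh0 hh1
  have r2 := hreal h (Y - h) hh0 hh1
  have p1 := happrox h (abs_of_pos hh0)
  have p2 := happrox (-h) (by rw [abs_neg, abs_of_pos hh0])
  have e1 : Real.exp (Y - h) * ((Real.exp h - 1) / h) = Real.exp Y * ((Real.exp (-h) - 1) / (-h)) := by
    rw [Real.exp_sub, Real.exp_neg]
    field_simp
    ring
  have e2 : Real.exp (r * (Y - h)) * ((Real.exp (r * h) - 1) / (r * h)) =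
      Real.exp (r * Y) * ((Real.exp (r * -h) - 1) / (r * -h)) := by
    rw [mul_sub, Real.exp_sub, mul_neg, Real.exp_neg]
    field_simp
    ring
  rw [e1, e2] at r2
  have e3 : Real.exp (σ * (Y - h)) * h ^ (-(2 * η)) ≤ x ^ (σ + η) := by
    rw [← herr]
    have : Real.exp (σ * (Y - h)) ≤ Real.exp (σ * Y) := Real.exp_le_exp.2 (by nlinarith)
    gcongr
  have e4 := mul_le_mul_of_nonneg_left e3 hK0
  rw [herr] at r1
  rw [abs_le] at r1 r2 p1 p2 ⊢
  rw [add_mul]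
  constructor <;> linarith [r1.1, r1.2, r2.1, r2.2, p1.1, p1.2, p2.1, p2.2]

namespace UnitPartition

variable {q : ℝ → ℝ} {y : ℕ → ℝ} {C : ℝ} (hq : UnitPartition q y C)

include hq

/-- The unsmoothed form of `exists_smoothed_count_bound`. -/
lemma exists_count_asymptotic {lam : ℕ → ℝ} (hlam : ∀ j, lam j ∈ Set.Icc (y j) (y (j + 1)))
    {w : Nat.Primes → ℝ} {δ : ℝ} (hδ : 0 < δ) (hw : ∀ p, δ ≤ w p)
    (hfin : ∀ y, {p | w p ≤ y}.Finite)
    (hℓ : Summable fun n : ℕ+ => Real.exp (-2 * logSize w n))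
    (hZ : ∀ s : ℂ, s.re = 2 →
      HasSum (fun n : ℕ+ => exp (-s * logSize w n)) (exp (∑' j, -log (1 - exp (-s * lam j)))))
    {σ r η Λ B BW : ℝ} (hσ : 1 / 2 < σ) (hσr : σ < r) (hr : r < 1)
    (hη : 0 < η) (hη1 : 2 * η ≤ 1) (hΛ : η * (Λ - 1) = 1) (hB : 0 ≤ B)
    (hmom : ∀ J : ℕ, ∫⁻ t : ℝ, ENNReal.ofReal ((1 + t ^ 2)⁻¹ *
        Real.exp (Λ * (∑ j ∈ Finset.range J, localLog q y j (lam j) (σ + t * I)).re)) ≤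
          ENNReal.ofReal B)
    {W : ℂ → ℂ} (hWd : DifferentiableOn ℂ W {s | 1 / 2 < s.re})
    (hWB : ∀ s : ℂ, 1 / 2 < s.re → ‖W s‖ ≤ BW)
    (hW : ∀ s : ℂ, 1 < s.re → exp (∑' j, block q y j s) = s ^ 2 / ((s - 1) * (s - r)) * W s)
    {w₁ wr : ℝ} (hw₁ : W 1 = w₁) (hwr : W r = wr) (hw₁0 : 0 < w₁) (hwr0 : wr ≠ 0) :
    ∃ κ c K : ℝ, 0 < κ ∧ c ≠ 0 ∧ ∀ x : ℝ, 1 ≤ x →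
      |((semigroup w hδ hw hfin).count x : ℝ) - κ * x - c * x ^ r| ≤ K * x ^ (σ + η) := by
  obtain ⟨b₁, hb₁⟩ := hq.exists_exp_tsum_localLog hlam (x := 1) (by norm_num)
  obtain ⟨br, hbr⟩ := hq.exists_exp_tsum_localLog hlam (x := r) (by linarith)
  obtain ⟨K, hK⟩ := hq.exists_smoothed_count_bound hlam hℓ hZ hσ hσr hr hη hη1 hΛ hB hmom hWd hWB hW
  have hr0 : 0 < r := by linarith
  have h1r : 0 < 1 - r := by linarith
  -- These are the residues of `ζ(s) x ^ s / s` at `1` and `r`, stripped of the powers of `x`.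
  set κ := w₁ * Real.exp b₁ / (1 - r) with hκ
  set c := -(r * (wr * Real.exp br / (1 - r))) with hc
  have hκ0 : 0 < κ := by positivity
  have hc0 : c ≠ 0 := neg_ne_zero.2 (mul_ne_zero hr0.ne' (div_ne_zero
    (mul_ne_zero hwr0 (Real.exp_pos _).ne') h1r.ne'))
  have hreal : ∀ h Y : ℝ, 0 < h → h ≤ 1 →
      |∑' n, ramp h (Y - logSize w n) - (κ * (Real.exp Y * ((Real.exp h - 1) / h)) +
        c * (Real.exp (r * Y) * ((Real.exp (r * h) - 1) / (r * h))))| ≤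
        K * (Real.exp (σ * Y) * h ^ (-(2 * η))) := by
    intro h Y hh hh1
    refine le_trans (le_of_eq ?_) (hK h Y hh hh1)
    rw [ofReal_one] at hb₁
    rw [hw₁, hwr, hb₁, hbr, ← Real.norm_eq_abs, ← Complex.norm_real]
    congr 1
    rw [hκ, hc]
    have n1 : (1 - r : ℂ) ≠ 0 := by exact_mod_cast h1r.ne'
    have n2 : (r : ℂ) ≠ 0 := by exact_mod_cast hr0.ne'
    have n3 : (h : ℂ) ≠ 0 := by exact_mod_cast hh.ne'
    push_cast
    field_simp
    ring
  obtain ⟨K', hK'⟩ := exists_abs_sub_le_of_smoothed (N := fun x =>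
    ((semigroup w hδ hw hfin).count x : ℝ)) hκ0 (by linarith) hr0 hr hη hreal
    (fun x h hx hh => count_le_tsum_ramp hδ hw hfin hx hh)
    (fun x h hx hh => tsum_ramp_le_count hδ hw hfin hx hh)
  exact ⟨κ, c, K', hκ0, hc0, hK'⟩

/-- The discretization theorem: a density whose Laplace transform is the logarithm of
`s ^ 2 / ((s - 1) (s - r)) * W s` is modelled by the primes of an arithmetical semigroup that
satisfies Axiom A with optimal exponent `r`. -/
theorem exists_arithmeticalSemigroup {r BW : ℝ} (hr : 1 / 2 < r) (hr1 : r < 1)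
    {W : ℂ → ℂ} (hWd : DifferentiableOn ℂ W {s | 1 / 2 < s.re})
    (hWB : ∀ s : ℂ, 1 / 2 < s.re → ‖W s‖ ≤ BW)
    (hW : ∀ s : ℂ, 1 < s.re → exp (∑' j, block q y j s) = s ^ 2 / ((s - 1) * (s - r)) * W s)
    {w₁ wr : ℝ} (hw₁ : W 1 = w₁) (hwr : W r = wr) (hw₁0 : 0 < w₁) (hwr0 : wr ≠ 0) :
    ∃ S : ArithmeticalSemigroup ℕ+, (∃ κ : ℝ, S.AxiomA κ r) ∧
      (∀ κ θ : ℝ, S.AxiomA κ θ → r ≤ θ) ∧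
      (∃ Q : ℂ → ℂ, S.IsZeta r fun s => s ^ 2 / ((s - 1) * (s - r)) * W s * Q s) ∧
      ∀ x : ℝ, 1 ≤ x → y 0 ≤ Real.log x → |S.psi x - ∫ τ in (y 0)..(Real.log x), τ * q τ| ≤
        (4 + C * Real.exp (Real.log x / 2)) * Real.log x := by
  obtain ⟨σ, hσ, hσr⟩ := exists_between hr
  -- This makes `σ + η < r`, so that the error term stays below the secondary term; `Λ` is then
  -- fixed by `η * (Λ - 1) = 1`.
  set η := (r - σ) / 2 with hη
  have hη0 : 0 < η := by rw [hη]; linarith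
  set Λ := 1 + η⁻¹ with hΛ
  have hΛ1 : η * (Λ - 1) = 1 := by rw [hΛ, add_sub_cancel_left, mul_inv_cancel₀ hη0.ne']
  obtain ⟨lam, hlam, B, hmom⟩ := hq.exists_lam (Λ := Λ) (by positivity) hσ
  have hmom' : ∀ J : ℕ, ∫⁻ t : ℝ, ENNReal.ofReal ((1 + t ^ 2)⁻¹ *
        Real.exp (Λ * (∑ j ∈ Finset.range J, localLog q y j (lam j) (σ + t * I)).re)) ≤
          ENNReal.ofReal (max B 0) := fun J =>
    (hmom J).trans (ENNReal.ofReal_le_ofReal (le_max_left _ _))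
  -- The ordinary primes serve only as labels, so any bijection with `ℕ` will do.
  obtain ⟨e⟩ : Nonempty (Nat.Primes ≃ ℕ) := nonempty_equiv_of_countable
  set w : Nat.Primes → ℝ := fun p => lam (e p) with hwdef
  have hw : ∀ p, (2 : ℝ) ≤ w p := fun p =>
    hq.two_le.trans ((hq.y_zero_le _).trans (hlam (e p)).1)
  have hfin : ∀ Y, {p | w p ≤ Y}.Finite := fun Y =>
    (hq.finite_lam_le hlam Y).preimage e.injective.injOn
  have hsumlam : ∀ a : ℝ, 1 < a → Summable fun j => Real.exp (-a * lam j) := fun a ha => by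
    refine Summable.of_nonneg_of_le (fun _ => (Real.exp_pos _).le) (fun j => ?_) (hq.summable_exp ha)
    exact Real.exp_le_exp.2 (by nlinarith [(hlam j).1])
  have hsumw : ∀ a : ℝ, 1 < a → Summable fun p => Real.exp (-a * w p) := fun a ha =>
    e.summable_iff.2 (hsumlam a ha)
  have hZ : ∀ s : ℂ, 1 < s.re → HasSum (fun n : ℕ+ => exp (-s * logSize w n))
      (exp (∑' j, -log (1 - exp (-s * lam j)))) := by
    intro s hs
    have := hasSum_exp_logSize (w := w) (fun p => by linarith [hw p]) (by linarith) (hsumw s.re hs)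
    rwa [e.tsum_eq (fun j => -log (1 - exp (-s * lam j)))] at this
  have hℓ : Summable fun n : ℕ+ => Real.exp (-2 * logSize w n) := by
    have := (hZ 2 (by norm_num)).summable.norm
    simpa [Complex.norm_exp] using this
  obtain ⟨κ, c, K, hκ, hc, hN⟩ := hq.exists_count_asymptotic hlam two_pos hw hfin hℓ
    (fun s hs => hZ s (by rw [hs]; norm_num)) hσ hσr hr1 hη0 (by rw [hη]; linarith) hΛ1
    (le_max_right B 0) hmom' hWd hWB hW hw₁ hwr hw₁0 hwr0
  refine ⟨semigroup w two_pos hw hfin,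
    ⟨κ, axiomA_of_asymptotic _ hκ (by linarith) hr1 (by rw [hη]; linarith) hN⟩,
    fun κ' θ hA => le_of_axiomA _ hc (by linarith) hr1 (by rw [hη]; linarith) hN hA,
    ⟨fun s => exp (∑' j, localLog q y j (lam j) s), ?_, ?_⟩, ?_⟩
  · have hsub : ∀ s ∈ {s : ℂ | r < s.re ∧ s ≠ 1}, s ∈ {s : ℂ | 1 / 2 < s.re} := fun s hs =>
      hr.trans hs.1
    refine DifferentiableOn.mul (DifferentiableOn.mul ?_ (hWd.mono hsub))
      ((hq.differentiableOn_tsum_localLog hlam).mono hsub).cexp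
    refine DifferentiableOn.div (by fun_prop) (by fun_prop) fun s hs => mul_ne_zero ?_ ?_
    · exact sub_ne_zero.2 hs.2
    · intro h
      have := congrArg Complex.re h
      have h2 := hs.1
      simp at this
      linarith
  · intro s hs
    have h1 := hZ s hs
    rw [hq.exp_tsum_log hlam hs, hW s hs, mul_comm] at h1
    refine h1.congr_fun fun n => ?_
    rw [semigroup_norm, Complex.cpow_def_of_ne_zero (by exact_mod_cast (Real.exp_pos _).ne'),
      ← Complex.ofReal_log (Real.exp_pos _).le, Real.log_exp, mul_comm]
  · intro x hx1 hx
    have hlog : 2 ≤ Real.log x := hq.two_le.trans hx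
    have h1 := abs_psi_sub_theta_le two_pos hw hfin hx1
    have hsum : ∑ p ∈ (hfin (Real.log x)).toFinset, w p =
        ∑ j ∈ (hq.finite_lam_le hlam (Real.log x)).toFinset, lam j :=
      Finset.sum_equiv e (fun p => by simp [hwdef]) fun p _ => rfl
    have hcard : (hfin (Real.log x / 2)).toFinset.card =
        (hq.finite_lam_le hlam (Real.log x / 2)).toFinset.card :=
      Finset.card_equiv e fun p => by simp [hwdef]
    have h2 := hq.abs_sum_lam_sub_integral_le hlam hx
    have h3 := hq.card_lam_le hlam (Real.log x / 2)
    rw [hsum, hcard] at h1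
    have h4 := h1.trans (mul_le_mul_of_nonneg_right h3 (by linarith : (0 : ℝ) ≤ Real.log x))
    rw [abs_le] at h2 h4 ⊢
    constructor <;> linarith [h2.1, h2.2, h4.1, h4.2]

end UnitPartition

end BeurlingConstruction

end

/-! ### Frullani's integral and existence of unit partitions -/

section

open MeasureTheory Filter Topology Complex

namespace BeurlingConstruction

lemma exp_sub_one_div_eq_integral (a : ℂ) {τ : ℝ} (hτ : τ ≠ 0) :
    (exp (a * τ) - 1) / τ = ∫ θ in Set.Ioc (0 : ℝ) 1, a * exp (a * θ * τ) := by
  rw [← intervalIntegral.integral_of_le zero_le_one]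
  have hτ' : (τ : ℂ) ≠ 0 := by exact_mod_cast hτ
  have hd : ∀ θ : ℝ, HasDerivAt (fun θ : ℝ => exp (a * θ * τ) / τ) (a * exp (a * θ * τ)) θ := by
    intro θ
    have h1 : HasDerivAt (fun θ : ℝ => a * θ * τ) (a * 1 * τ) θ :=
      ((Complex.ofRealCLM.hasDerivAt (x := θ)).const_mul a).mul_const _
    refine (h1.cexp.div_const (τ : ℂ)).congr_deriv ?_
    field_simp
  rw [intervalIntegral.integral_eq_sub_of_hasDerivAt (fun θ _ => hd θ)
    (Continuous.intervalIntegrable (by fun_prop) _ _)]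
  simp
  ring

lemma integral_div_sub_mul {a s : ℂ} (hs : 0 < s.re) (hsa : a.re < s.re) :
    ∫ θ in Set.Ioc (0 : ℝ) 1, a / (s - a * θ) = log s - log (s - a) := by
  rw [← intervalIntegral.integral_of_le zero_le_one]
  have hre : ∀ θ ∈ Set.uIcc (0 : ℝ) 1, 0 < (s - a * θ).re := by
    intro θ hθ
    rw [Set.uIcc_of_le zero_le_one] at hθ
    simp only [sub_re, mul_re, ofReal_re, ofReal_im, mul_zero, sub_zero]
    rcases hθ.1.eq_or_lt with rfl | h0
    · simpa using hs
    · nlinarith [mul_pos h0 (sub_pos.2 hsa), mul_nonneg (sub_nonneg.2 hθ.2) hs.le]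
  have hd : ∀ θ ∈ Set.uIcc (0 : ℝ) 1,
      HasDerivAt (fun θ : ℝ => -log (s - a * θ)) (a / (s - a * θ)) θ := by
    intro θ hθ
    have h1 : HasDerivAt (fun θ : ℝ => s - a * θ) (-(a * 1)) θ :=
      ((Complex.ofRealCLM.hasDerivAt (x := θ)).const_mul a).const_sub s
    refine (h1.clog_real (Or.inl (hre θ hθ))).neg.congr_deriv ?_
    ring
  rw [intervalIntegral.integral_eq_sub_of_hasDerivAt hd]
  · simp; ring
  · refine ContinuousOn.intervalIntegrable (ContinuousOn.div (by fun_prop) (by fun_prop) ?_)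
    intro θ hθ h0
    have := hre θ hθ
    rw [h0] at this
    simp at this

/-- Frullani's integral, in exponentiated form. -/
lemma frullani {a s : ℂ} (hs : 0 < s.re) (hsa : a.re < s.re) :
    IntegrableOn (fun τ : ℝ => exp (-s * τ) * ((exp (a * τ) - 1) / τ)) (Set.Ioi 0) ∧
      exp (∫ τ in Set.Ioi (0 : ℝ), exp (-s * τ) * ((exp (a * τ) - 1) / τ)) = s / (s - a) := by
  set c := min s.re (s.re - a.re) with hc
  have hc0 : 0 < c := lt_min hs (by linarith)
  have hcθ : ∀ θ ∈ Set.Ioc (0 : ℝ) 1, c ≤ (s - a * θ).re := by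
    intro θ hθ
    have h1 : c ≤ s.re := min_le_left _ _
    have h2 : c ≤ s.re - a.re := min_le_right _ _
    simp only [sub_re, mul_re, ofReal_re, ofReal_im, mul_zero, sub_zero]
    nlinarith [hθ.1, hθ.2]
  -- Writing `(exp (a τ) - 1) / τ` as an integral over `θ ∈ (0, 1]` and exchanging integrals reduces
  -- the claim to `∫ a / (s - a θ) dθ = log s - log (s - a)`. The real parts `Re (s - a θ)` lie
  -- between `Re s` and `Re (s - a)`, whence the uniform decay rate `c`.
  set F : ℝ → ℝ → ℂ := fun τ θ => a * exp (-(s - a * θ) * τ) with hF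
  have hint : Integrable (Function.uncurry F)
      ((volume.restrict (Set.Ioi (0 : ℝ))).prod (volume.restrict (Set.Ioc (0 : ℝ) 1))) := by
    have hdom : Integrable (fun z : ℝ × ℝ => (‖a‖ * Real.exp (-c * z.1)) * (1 : ℝ))
        ((volume.restrict (Set.Ioi (0 : ℝ))).prod (volume.restrict (Set.Ioc (0 : ℝ) 1))) :=
      Integrable.mul_prod ((integrableOn_exp_mul_Ioi (neg_neg_of_pos hc0) 0).const_mul _)
        (integrable_const _)
    refine hdom.mono' (Continuous.aestronglyMeasurable (by fun_prop)) ?_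
    rw [Measure.prod_restrict]
    refine (ae_restrict_iff' (measurableSet_Ioi.prod measurableSet_Ioc)).2 (ae_of_all _ ?_)
    rintro ⟨τ, θ⟩ ⟨hτ, hθ⟩
    simp only [Function.uncurry, hF, norm_mul, mul_one]
    rw [norm_exp_neg_mul]
    have h1 := hcθ θ hθ
    have h2 : (0 : ℝ) < τ := hτ
    gcongr
  have hpt : ∀ τ ∈ Set.Ioi (0 : ℝ),
      ∫ θ in Set.Ioc (0 : ℝ) 1, F τ θ = exp (-s * τ) * ((exp (a * τ) - 1) / τ) := by
    intro τ hτ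
    rw [exp_sub_one_div_eq_integral a (ne_of_gt hτ), ← integral_const_mul]
    refine integral_congr_ae (ae_of_all _ fun θ => ?_)
    simp only [hF]
    rw [mul_left_comm, ← exp_add]
    congr 2
    ring
  refine ⟨(hint.integral_prod_left).congr ?_, ?_⟩
  · exact (ae_restrict_iff' measurableSet_Ioi).2 (ae_of_all _ hpt)
  · rw [← setIntegral_congr_fun measurableSet_Ioi hpt, integral_integral_swap hint]
    have h2 : ∀ θ ∈ Set.Ioc (0 : ℝ) 1, ∫ τ in Set.Ioi (0 : ℝ), F τ θ = a / (s - a * θ) := by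
      intro θ hθ
      have hre : (-(s - a * θ)).re < 0 := by
        rw [neg_re]; linarith [hcθ θ hθ]
      simp only [hF]
      rw [integral_const_mul, integral_exp_mul_complex_Ioi hre]
      simp [div_eq_mul_inv, neg_inv]
    rw [setIntegral_congr_fun measurableSet_Ioc h2, integral_div_sub_mul hs hsa, exp_sub,
      exp_log, exp_log]
    · intro h
      have := congrArg re h
      simp at this
      linarith
    · rintro rfl
      simp at hs

/-- Integrability at the removable singularity `0` is inherited from Frullani's integral; the
exponential damping is undone by a continuous factor. -/
lemma intervalIntegrable_exp_sub_one_div (a : ℂ) {L : ℝ} (hL : 0 ≤ L) :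
    IntervalIntegrable (fun τ : ℝ => (exp (a * τ) - 1) / τ) volume 0 L := by
  have h := (frullani (a := a) (s := ((|a.re| + 1 : ℝ) : ℂ)) (by rw [ofReal_re]; positivity)
    (by rw [ofReal_re]; linarith [le_abs_self a.re])).1
  have h1 : IntervalIntegrable (fun τ : ℝ => exp (-((|a.re| + 1 : ℝ) : ℂ) * τ) *
      ((exp (a * τ) - 1) / τ)) volume 0 L :=
    (intervalIntegrable_iff_integrableOn_Ioc_of_le hL).2 (h.mono_set Set.Ioc_subset_Ioi_self)
  have h2 := h1.continuousOn_mul (g := fun τ : ℝ => exp (((|a.re| + 1 : ℝ) : ℂ) * τ))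
    (by fun_prop)
  refine h2.congr (fun τ _ => ?_)
  rw [← mul_assoc, ← exp_add, neg_mul, add_neg_cancel, exp_zero, one_mul]

/-- A density bounded below has a partition into intervals of mass one. -/
lemma exists_unitPartition {q : ℝ → ℝ} {L C c : ℝ} (hL : 2 ≤ L) (hqm : Measurable q)
    (hqc : ContinuousOn q (Set.Ici L)) (hc : 0 < c) (hlow : ∀ τ, L ≤ τ → c ≤ q τ)
    (hup : ∀ τ, L ≤ τ → q τ ≤ C * Real.exp τ) :
    ∃ y : ℕ → ℝ, y 0 = L ∧ UnitPartition q y C := by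
  have hint : ∀ a b : ℝ, L ≤ a → L ≤ b → IntervalIntegrable q volume a b := fun a b ha hb =>
    (hqc.mono fun x hx => le_trans (le_min ha hb) hx.1).intervalIntegrable
  -- As `q ≥ c`, the interval `[a, a + 1 / c]` has mass at least one, and the intermediate value
  -- theorem yields an endpoint of mass exactly one.
  have step : ∀ a : Set.Ici L, ∃ b : Set.Ici L, a.1 < b.1 ∧ ∫ τ in a.1..b.1, q τ = 1 := by
    rintro ⟨a, ha⟩
    have ha' : L ≤ a := ha
    have hle : a ≤ a + 1 / c := by have : 0 < 1 / c := by positivity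
                                   linarith
    have hcont : ContinuousOn (fun b => ∫ τ in a..b, q τ) (Set.Icc a (a + 1 / c)) := by
      have := intervalIntegral.continuousOn_primitive_interval' (hint a (a + 1 / c) ha'
        (ha'.trans hle)) Set.left_mem_uIcc
      rwa [Set.uIcc_of_le hle] at this
    have hbig : 1 ≤ ∫ τ in a..(a + 1 / c), q τ := by
      have h1 : ∫ _ in a..(a + 1 / c), c ≤ ∫ τ in a..(a + 1 / c), q τ :=
        intervalIntegral.integral_mono_on hle intervalIntegrable_const
          (hint a _ ha' (ha'.trans hle)) fun τ hτ => hlow τ (ha'.trans hτ.1)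
      rw [intervalIntegral.integral_const, smul_eq_mul, add_sub_cancel_left,
        one_div_mul_cancel hc.ne'] at h1
      exact h1
    obtain ⟨b, hb, hb1⟩ := intermediate_value_Icc hle hcont (show (1 : ℝ) ∈ Set.Icc _ _ from
      ⟨by rw [intervalIntegral.integral_same]; exact zero_le_one, hbig⟩)
    refine ⟨⟨b, ha'.trans hb.1⟩, lt_of_le_of_ne hb.1 ?_, hb1⟩
    rintro rfl
    simp at hb1
  choose f hf1 hf2 using step
  set z : ℕ → Set.Ici L := fun n => f^[n] ⟨L, Set.self_mem_Ici⟩ with hz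
  have hz1 : ∀ n, z (n + 1) = f (z n) := fun n => Function.iterate_succ_apply' f n _
  refine ⟨fun n => (z n).1, rfl, hL, strictMono_nat_of_lt_succ fun n => ?_, hqm, hqc,
    fun τ hτ => hc.le.trans (hlow τ hτ), hup, fun n => ?_⟩
  · rw [hz1]; exact hf1 _
  · simp only [hz1]; exact hf2 _

lemma UnitPartition.tsum_block {q : ℝ → ℝ} {y : ℕ → ℝ} {C : ℝ} (hq : UnitPartition q y C) {s : ℂ}
    (hs : 1 < s.re) (hint : IntegrableOn (fun τ : ℝ => exp (-s * τ) * q τ) (Set.Ioi (y 0))) :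
    ∑' j, block q y j s = ∫ τ in Set.Ioi (y 0), exp (-s * τ) * q τ := by
  have h1 := (hq.summable_block hs).hasSum.tendsto_sum_nat
  have h2 := intervalIntegral_tendsto_integral_Ioi (y 0) hint hq.tendsto_y
  refine tendsto_nhds_unique h1 (h2.congr fun n => ?_)
  refine (intervalIntegral.sum_integral_adjacent_intervals fun k _ => ?_).symm
  exact (intervalIntegrable_iff_integrableOn_Ioc_of_le (hq.y_le_succ k)).2
    (hint.mono_set fun x hx => lt_of_le_of_lt (hq.y_zero_le k) hx.1)

end BeurlingConstruction

end

/-! ### The template density with prescribed poles and zeros -/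

section

open MeasureTheory Filter Topology Complex
open scoped ComplexConjugate

namespace BeurlingConstruction

/-- `τ` times the density of primes, on the logarithmic scale, of a zeta function with poles at `1`
and `r` and zeros at `ρ` and its conjugate for `ρ ∈ T`. -/
noncomputable def templateNum (r : ℝ) (T : Finset ℂ) (τ : ℝ) : ℝ :=
  (Real.exp τ - 1) + (Real.exp (r * τ) - 1) - ∑ ρ ∈ T, 2 * ((exp (ρ * τ)).re - 1)

/-- The density of primes on the logarithmic scale. -/
noncomputable def template (r : ℝ) (T : Finset ℂ) (τ : ℝ) : ℝ := templateNum r T τ / τ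

/-- The holomorphic factor of the template zeta function. -/
noncomputable def templateFactor (r : ℝ) (T : Finset ℂ) (L : ℝ) (s : ℂ) : ℂ :=
  (∏ ρ ∈ T, ((s - ρ) / s) * ((s - conj ρ) / s)) *
    exp (-∫ τ in (0 : ℝ)..L, exp (-s * τ) * template r T τ)

variable {r : ℝ} {T : Finset ℂ} {L : ℝ}

lemma continuous_templateNum : Continuous (templateNum r T) := by
  unfold templateNum
  have : ∀ ρ ∈ T, Continuous fun τ : ℝ => 2 * ((exp (ρ * τ)).re - 1) := fun ρ _ =>
    continuous_const.mul ((continuous_re.comp (by fun_prop)).sub continuous_const)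
  exact Continuous.sub (by fun_prop) (continuous_finsetSum _ this)

lemma measurable_template : Measurable (template r T) :=
  continuous_templateNum.measurable.div measurable_id

/-- Splits the density into Frullani integrands, one for each of the points `1`, `r`, `ρ` and `conj
ρ`. -/
lemma template_eq (r : ℝ) (T : Finset ℂ) (τ : ℝ) : (template r T τ : ℂ) =
    (exp ((1 : ℂ) * τ) - 1) / τ + (exp ((r : ℂ) * τ) - 1) / τ -
      ∑ ρ ∈ T, ((exp (ρ * τ) - 1) / τ + (exp (conj ρ * τ) - 1) / τ) := by
  have h : ∀ ρ : ℂ, (exp (ρ * τ) - 1) / τ + (exp (conj ρ * τ) - 1) / τ =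
      (2 * ((exp (ρ * τ)).re - 1) : ℝ) / (τ : ℂ) := by
    intro ρ
    have : exp (conj ρ * τ) = conj (exp (ρ * τ)) := by
      rw [← exp_conj, map_mul, conj_ofReal]
    rw [this, ← add_div, ofReal_mul, ofReal_sub, re_eq_add_conj]
    congr 1
    push_cast
    ring
  rw [Finset.sum_congr rfl fun ρ _ => h ρ, ← Finset.sum_div, template, templateNum]
  push_cast
  rw [one_mul]
  ring

lemma intervalIntegrable_template (hL : 0 ≤ L) :
    IntervalIntegrable (fun τ => (template r T τ : ℂ)) volume 0 L := by
  simp_rw [template_eq]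
  refine ((intervalIntegrable_exp_sub_one_div 1 hL).add
    (intervalIntegrable_exp_sub_one_div r hL)).sub ?_
  have := IntervalIntegrable.sum T (μ := volume) (a := 0) (b := L) (f := fun ρ (τ : ℝ) =>
    (exp (ρ * τ) - 1) / τ + (exp (conj ρ * τ) - 1) / τ) fun ρ _ => ?_
  · rwa [Finset.sum_fn] at this
  exact (intervalIntegrable_exp_sub_one_div ρ hL).add
    (intervalIntegrable_exp_sub_one_div (conj ρ) hL)

lemma laplace_template (hr1 : r < 1) (hT : ∀ ρ ∈ T, ρ.re < 1) {s : ℂ} (hs : 1 < s.re) :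
    IntegrableOn (fun τ : ℝ => exp (-s * τ) * template r T τ) (Set.Ioi 0) ∧
      exp (∫ τ in Set.Ioi (0 : ℝ), exp (-s * τ) * template r T τ) =
        s / (s - 1) * (s / (s - r)) * ∏ ρ ∈ T, ((s - ρ) / s) * ((s - conj ρ) / s) := by
  have hs0 : 0 < s.re := by linarith
  set G : ℂ → ℝ → ℂ := fun a τ => exp (-s * τ) * ((exp (a * τ) - 1) / τ) with hG
  have key : ∀ a : ℂ, a.re ≤ 1 → IntegrableOn (G a) (Set.Ioi 0) ∧
      exp (∫ τ in Set.Ioi (0 : ℝ), G a τ) = s / (s - a) := fun a ha =>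
    frullani hs0 (ha.trans_lt hs)
  have f1 := key 1 (by simp)
  have fr := key r (by rw [ofReal_re]; exact hr1.le)
  have fρ : ∀ ρ ∈ T, _ := fun ρ hρ => key ρ (hT ρ hρ).le
  have fρ' : ∀ ρ ∈ T, _ := fun ρ hρ => key (conj ρ) (by rw [conj_re]; exact (hT ρ hρ).le)
  have e : (fun τ : ℝ => exp (-s * τ) * template r T τ) = fun τ : ℝ =>
      (G 1 τ + G r τ) - ∑ ρ ∈ T, (G ρ τ + G (conj ρ) τ) := by
    funext τ
    rw [template_eq, mul_sub, mul_add, Finset.mul_sum]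
    simp only [mul_add, hG]
  have h1 : IntegrableOn (fun τ => G 1 τ + G r τ) (Set.Ioi 0) := f1.1.add fr.1
  have hρ : ∀ ρ ∈ T, IntegrableOn (fun τ => G ρ τ + G (conj ρ) τ) (Set.Ioi 0) := fun ρ hρ =>
    (fρ ρ hρ).1.add (fρ' ρ hρ).1
  have hsum : IntegrableOn (fun τ => ∑ ρ ∈ T, (G ρ τ + G (conj ρ) τ)) (Set.Ioi 0) :=
    integrable_finsetSum T hρ
  rw [e]
  refine ⟨h1.sub hsum, ?_⟩
  rw [integral_sub h1 hsum, integral_add f1.1 fr.1, integral_finsetSum T hρ,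
    exp_sub, exp_add, f1.2, fr.2, exp_sum, div_eq_mul_inv, ← Finset.prod_inv_distrib]
  congr 1
  refine Finset.prod_congr rfl fun ρ hρ => ?_
  rw [integral_add (fρ ρ hρ).1 (fρ' ρ hρ).1, exp_add, (fρ ρ hρ).2, (fρ' ρ hρ).2, mul_inv, inv_div,
    inv_div]

/-- Near `0` the density need not be positive and is discarded. The transform of the discarded piece
is entire, so its exponential creates no poles or zeros. -/
lemma exp_laplace_template_Ioi (hL : 0 ≤ L) (hr1 : r < 1) (hT : ∀ ρ ∈ T, ρ.re < 1) {s : ℂ}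
    (hs : 1 < s.re) : exp (∫ τ in Set.Ioi L, exp (-s * τ) * template r T τ) =
      s ^ 2 / ((s - 1) * (s - r)) * templateFactor r T L s := by
  obtain ⟨hi, he⟩ := laplace_template hr1 hT hs
  have h1 := intervalIntegral.integral_Ioi_sub_Ioi hi hL
  have h2 : ∫ τ in Set.Ioi L, exp (-s * τ) * template r T τ =
      (∫ τ in Set.Ioi (0 : ℝ), exp (-s * τ) * template r T τ) +
        -∫ τ in (0 : ℝ)..L, exp (-s * τ) * template r T τ := by
    rw [← h1]; ring
  rw [h2, exp_add, he, templateFactor, ← mul_assoc]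
  congr 2
  rw [div_mul_div_comm, sq]

lemma differentiableOn_templateFactor (hL : 0 ≤ L) :
    DifferentiableOn ℂ (templateFactor r T L) {s | 1 / 2 < s.re} := by
  have hne : ∀ s ∈ {s : ℂ | 1 / 2 < s.re}, s ≠ 0 := by
    rintro s hs rfl
    have : (1 : ℝ) / 2 < (0 : ℂ).re := hs
    norm_num at this
  refine DifferentiableOn.mul ?_
    ((differentiable_integral_exp_mul (intervalIntegrable_template hL)).neg.cexp.differentiableOn)
  refine DifferentiableOn.fun_finsetProd fun ρ _ => ?_
  exact (DifferentiableOn.div (by fun_prop) (by fun_prop) hne).mul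
    (DifferentiableOn.div (by fun_prop) (by fun_prop) hne)

lemma norm_templateFactor_le (hL : 0 ≤ L) : ∃ B : ℝ, ∀ s : ℂ, 1 / 2 < s.re →
    ‖templateFactor r T L s‖ ≤ B := by
  refine ⟨(∏ ρ ∈ T, (1 + 2 * ‖ρ‖) * (1 + 2 * ‖ρ‖)) *
    Real.exp (∫ τ in (0 : ℝ)..L, ‖(template r T τ : ℂ)‖), fun s hs => ?_⟩
  have hsn : 1 / 2 ≤ ‖s‖ := hs.le.trans (re_le_norm s)
  have hs0 : 0 < ‖s‖ := by linarith
  have hfac : ∀ a : ℂ, ‖(s - a) / s‖ ≤ 1 + 2 * ‖a‖ := by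
    intro a
    rw [norm_div, div_le_iff₀ hs0]
    nlinarith [norm_sub_le s a, norm_nonneg a]
  rw [templateFactor, norm_mul, norm_prod]
  refine mul_le_mul ?_ ?_ (norm_nonneg _) (Finset.prod_nonneg fun _ _ => by positivity)
  · refine Finset.prod_le_prod (fun _ _ => norm_nonneg _) fun ρ _ => ?_
    rw [norm_mul]
    have := hfac (conj ρ)
    rw [norm_conj] at this
    exact mul_le_mul (hfac ρ) this (norm_nonneg _) (by positivity)
  · refine (norm_exp_le_exp_norm _).trans (Real.exp_le_exp.2 ?_)
    rw [norm_neg]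
    refine (intervalIntegral.norm_integral_le_integral_norm hL).trans ?_
    have hi := intervalIntegrable_template (r := r) (T := T) hL
    refine intervalIntegral.integral_mono_on hL
      (hi.continuousOn_mul (g := fun τ : ℝ => exp (-s * τ)) (by fun_prop)).norm hi.norm
      fun τ hτ => ?_
    rw [norm_mul, norm_exp_neg_mul]
    refine mul_le_of_le_one_left (norm_nonneg _) (Real.exp_le_one_iff.2 ?_)
    nlinarith [hτ.1]

/-- Conjugate pairs combine to squared absolute values, positive because no `ρ` is real. -/
lemma templateFactor_ofReal (hT : ∀ ρ ∈ T, ρ.im ≠ 0) {x : ℝ} (hx : 0 < x) :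
    ∃ w : ℝ, 0 < w ∧ templateFactor r T L x = w := by
  refine ⟨(∏ ρ ∈ T, normSq ((x - ρ) / x)) *
    Real.exp (-∫ τ in (0 : ℝ)..L, Real.exp (-x * τ) * template r T τ), ?_, ?_⟩
  · refine mul_pos (Finset.prod_pos fun ρ hρ => normSq_pos.2 (div_ne_zero ?_ ?_)) (Real.exp_pos _)
    · intro h
      have := congrArg im h
      simp at this
      exact hT ρ hρ this
    · exact_mod_cast hx.ne'
  · rw [templateFactor, ofReal_mul, ofReal_prod, ofReal_exp, ofReal_neg]
    congr 1
    · refine Finset.prod_congr rfl fun ρ _ => ?_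
      rw [normSq_eq_conj_mul_self, map_div₀, map_sub, conj_ofReal, mul_comm]
    · congr 2
      rw [← intervalIntegral.integral_ofReal]
      refine intervalIntegral.integral_congr fun τ _ => ?_
      push_cast
      rfl

lemma templateFactor_eq_zero {ρ : ℂ} (hρ : ρ ∈ T) : templateFactor r T L ρ = 0 := by
  rw [templateFactor, Finset.prod_eq_zero hρ (by simp), zero_mul]

lemma abs_sum_le {b : ℝ} (hT : ∀ ρ ∈ T, ρ.re ≤ b) {τ : ℝ} (hτ : 0 ≤ τ) :
    ∀ ρ ∈ T, |(exp (ρ * τ)).re| ≤ Real.exp (b * τ) := by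
  intro ρ hρ
  refine (abs_re_le_norm _).trans ?_
  rw [norm_exp]
  refine Real.exp_le_exp.2 ?_
  simp only [mul_re, ofReal_re, ofReal_im, mul_zero, sub_zero]
  exact mul_le_mul_of_nonneg_right (hT ρ hρ) hτ

/-- For large `τ` the density is bounded below by a positive constant. -/
lemma eventually_half_le_template (hr : 0 ≤ r) {b : ℝ} (hb : b < 1) (hT : ∀ ρ ∈ T, ρ.re ≤ b) :
    ∀ᶠ τ : ℝ in atTop, 1 / 2 ≤ template r T τ := by
  have h1 : Tendsto (fun τ : ℝ => 2 * T.card * Real.exp (-(1 - b) * τ)) atTop (𝓝 (2 * T.card * 0)) := by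
    refine Tendsto.const_mul _ ?_
    refine Real.tendsto_exp_atBot.comp ?_
    exact tendsto_id.const_mul_atTop_of_neg (by linarith)
  rw [mul_zero] at h1
  filter_upwards [h1.eventually_le_const (show (0 : ℝ) < 1 / 4 by norm_num),
    eventually_ge_atTop 4] with τ h hτ
  have hτ0 : 0 < τ := by linarith
  rw [template, le_div_iff₀ hτ0, templateNum]
  have hs : ∑ ρ ∈ T, 2 * ((exp (ρ * τ)).re - 1) ≤ ∑ ρ ∈ T, 2 * Real.exp (b * τ) :=
    Finset.sum_le_sum fun ρ hρ => by
      linarith [(abs_le.1 (abs_sum_le hT hτ0.le ρ hρ)).2]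
  rw [Finset.sum_const, nsmul_eq_mul] at hs
  have e : Real.exp (b * τ) = Real.exp (-(1 - b) * τ) * Real.exp τ := by
    rw [← Real.exp_add]; congr 1; ring
  have h2 : (T.card : ℝ) * (2 * Real.exp (b * τ)) ≤ 1 / 4 * Real.exp τ := by
    rw [e]
    nlinarith [Real.exp_pos τ]
  have h3 : 1 ≤ Real.exp (r * τ) := Real.one_le_exp (by positivity)
  have h4 := Real.add_one_le_exp τ
  linarith

lemma template_le (hr1 : r ≤ 1) (hT : ∀ ρ ∈ T, ρ.re ≤ 1) {τ : ℝ} (hτ : 1 ≤ τ) :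
    template r T τ ≤ (2 + 4 * T.card) * Real.exp τ := by
  have hτ0 : 0 < τ := by linarith
  have he : 1 ≤ Real.exp τ := Real.one_le_exp hτ0.le
  have h0 : 0 ≤ (2 + 4 * T.card : ℝ) * Real.exp τ := by positivity
  rw [template, div_le_iff₀ hτ0, templateNum]
  refine le_trans ?_ (le_mul_of_one_le_right h0 hτ)
  have hs : ∑ ρ ∈ T, -(4 * Real.exp τ) ≤ ∑ ρ ∈ T, 2 * ((exp (ρ * τ)).re - 1) :=
    Finset.sum_le_sum fun ρ hρ => by
      have := (abs_le.1 (abs_sum_le hT hτ0.le ρ hρ)).1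
      rw [one_mul] at this
      linarith
  rw [Finset.sum_const, nsmul_eq_mul] at hs
  have h3 : Real.exp (r * τ) ≤ Real.exp τ := Real.exp_le_exp.2 (by nlinarith)
  linarith

/-- Source of the explicit formula: with `Y = log x` this is `x - ∑ 2 Re (x ^ ρ / ρ)` up to terms
`O(x ^ r)`. -/
lemma integral_templateNum (hr : r ≠ 0) (hT : ∀ ρ ∈ T, ρ ≠ 0) : ∃ c : ℝ, ∀ Y : ℝ,
    ∫ τ in L..Y, templateNum r T τ = Real.exp Y + Real.exp (r * Y) / r -
      ∑ ρ ∈ T, 2 * (exp (ρ * Y) / ρ).re + (2 * T.card - 2) * Y - c := by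
  refine ⟨Real.exp L + Real.exp (r * L) / r -
      ∑ ρ ∈ T, 2 * (exp (ρ * L) / ρ).re + (2 * T.card - 2) * L, fun Y => ?_⟩
  rw [intervalIntegral.integral_eq_sub_of_hasDerivAt (f := fun Y : ℝ =>
    Real.exp Y + Real.exp (r * Y) / r - ∑ ρ ∈ T, 2 * (exp (ρ * Y) / ρ).re + (2 * T.card - 2) * Y)
    (fun Y _ => ?_) (continuous_templateNum.intervalIntegrable _ _)]
  have hρ : ∀ ρ ∈ T, HasDerivAt (fun Y : ℝ => 2 * (exp (ρ * Y) / ρ).re)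
      (2 * (exp (ρ * Y)).re) Y := by
    intro ρ hρ
    have h1 : HasDerivAt (fun z : ℂ => exp (ρ * z) / ρ) (exp (ρ * Y)) (Y : ℂ) := by
      refine (((hasDerivAt_id (Y : ℂ)).const_mul ρ).cexp.div_const ρ).congr_deriv ?_
      have := hT ρ hρ
      simp only [id]
      field_simp
    exact h1.real_of_complex.const_mul 2
  have h2 := HasDerivAt.fun_sum hρ
  have h3 : HasDerivAt (fun Y : ℝ => Real.exp (r * Y) / r) (Real.exp (r * Y)) Y := by
    refine (((hasDerivAt_id Y).const_mul r).exp.div_const r).congr_deriv ?_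
    simp only [id]
    field_simp
  refine ((((Real.hasDerivAt_exp Y).add h3).sub h2).add
    ((hasDerivAt_id Y).const_mul (2 * (T.card : ℝ) - 2))).congr_deriv ?_
  rw [templateNum]
  simp only [mul_sub, Finset.sum_sub_distrib, Finset.sum_const, nsmul_eq_mul]
  ring

end BeurlingConstruction

end

/-! ### A semigroup with prescribed zeros -/

section

open MeasureTheory Filter Topology Complex Asymptotics
open scoped ComplexConjugate

namespace BeurlingConstruction

/-- An arithmetical semigroup satisfying Axiom A with optimal exponent `r`, whose zeta function
vanishes at prescribed points `ρ ∈ T`, and whose prime number formula has only the corresponding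
oscillating terms up to `O(x ^ r)`. -/
theorem exists_arithmeticalSemigroup_of_zeros {r b : ℝ} (hr : 1 / 2 < r) (hr1 : r < 1) (hb : b < 1)
    (T : Finset ℂ) (hT : ∀ ρ ∈ T, ρ.re ≤ b) (hT0 : ∀ ρ ∈ T, ρ.im ≠ 0) :
    ∃ S : ArithmeticalSemigroup ℕ+, (∃ κ : ℝ, S.AxiomA κ r) ∧
      (∀ κ θ : ℝ, S.AxiomA κ θ → r ≤ θ) ∧
      (∀ ρ ∈ T, r < ρ.re → S.IsZetaZero r ρ) ∧
      (fun x : ℝ => S.Delta x + ∑ ρ ∈ T, 2 * (exp (ρ * Real.log x) / ρ).re) =O[atTop]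
        fun x : ℝ => x ^ r := by
  obtain ⟨L₀, hL₀⟩ := eventually_atTop.1 (eventually_half_le_template (r := r) (by linarith) hb hT)
  -- Beyond `L₀` the density is at least `1 / 2`; the lower limit `2` is required of a unit
  -- partition.
  set L := max L₀ 2 with hLdef
  have hL2 : 2 ≤ L := le_max_right _ _
  have hL0 : 0 ≤ L := by linarith
  have hT1 : ∀ ρ ∈ T, ρ.re < 1 := fun ρ hρ => (hT ρ hρ).trans_lt hb
  set C : ℝ := 2 + 4 * T.card with hC
  obtain ⟨y, hy0, hq⟩ := exists_unitPartition (C := C) hL2 (measurable_template (r := r) (T := T))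
    (continuous_templateNum.continuousOn.div continuousOn_id fun τ hτ => by
      have : L ≤ τ := hτ
      exact (show (0 : ℝ) < τ by linarith).ne') one_half_pos
    (fun τ hτ => hL₀ τ ((le_max_left _ _).trans hτ))
    (fun τ hτ => template_le hr1.le (fun ρ hρ => (hT1 ρ hρ).le) (by linarith))
  obtain ⟨BW, hBW⟩ := norm_templateFactor_le (r := r) (T := T) hL0
  obtain ⟨w₁, hw₁0, hw₁⟩ := templateFactor_ofReal (r := r) (L := L) hT0 one_pos
  obtain ⟨wr, hwr0, hwr⟩ := templateFactor_ofReal (r := r) (L := L) hT0 (x := r) (by linarith)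
  have hW : ∀ s : ℂ, 1 < s.re → exp (∑' j, block (template r T) y j s) =
      s ^ 2 / ((s - 1) * (s - r)) * templateFactor r T L s := by
    intro s hs
    rw [hq.tsum_block hs ((laplace_template hr1 hT1 hs).1.mono_set
      (Set.Ioi_subset_Ioi (by rw [hy0]; exact hL0))), hy0]
    exact exp_laplace_template_Ioi hL0 hr1 hT1 hs
  rw [ofReal_one] at hw₁
  obtain ⟨S, hS1, hS2, ⟨Q, hQ⟩, hS3⟩ := hq.exists_arithmeticalSemigroup hr hr1
    (differentiableOn_templateFactor hL0) hBW hW hw₁ hwr hw₁0 hwr0.ne'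
  refine ⟨S, hS1, hS2, fun ρ hρ hrρ => ⟨hrρ, ?_, _, hQ, ?_⟩, ?_⟩
  · rintro rfl
    exact hT0 1 hρ one_im
  · simp only [templateFactor_eq_zero hρ, mul_zero, zero_mul]
  obtain ⟨c, hc⟩ := integral_templateNum (L := L) (r := r) (by linarith) (T := T) (by
    rintro ρ hρ rfl
    exact hT0 0 hρ zero_im)
  have hlog : (fun x : ℝ => Real.log x) =O[atTop] fun x : ℝ => x ^ r :=
    (isLittleO_log_rpow_atTop (by linarith)).isBigO
  have hone : (fun _ : ℝ => (1 : ℝ)) =O[atTop] fun x : ℝ => x ^ r := by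
    refine IsBigO.of_bound 1 ?_
    filter_upwards [eventually_ge_atTop 1] with x hx
    rw [norm_one, one_mul]
    exact (Real.one_le_rpow hx (by linarith)).trans (le_abs_self _)
  -- The contribution of higher prime powers, absorbed because `r > 1 / 2`.
  have hsqrt : (fun x : ℝ => Real.exp (Real.log x / 2) * Real.log x) =O[atTop]
      fun x : ℝ => x ^ r := by
    have h1 : (fun x : ℝ => x ^ (1 / 2 : ℝ) * Real.log x) =O[atTop]
        fun x : ℝ => x ^ (1 / 2 : ℝ) * x ^ (r - 1 / 2) :=
      (isBigO_refl _ _).mul (isLittleO_log_rpow_atTop (by linarith)).isBigO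
    refine h1.congr' ?_ ?_
    · filter_upwards [eventually_gt_atTop 0] with x hx
      rw [Real.rpow_def_of_pos hx]
      ring_nf
    · filter_upwards [eventually_gt_atTop 0] with x hx
      rw [← Real.rpow_add hx]
      ring_nf
  have hmain : (fun x : ℝ => S.Delta x + ∑ ρ ∈ T, 2 * (exp (ρ * Real.log x) / ρ).re -
      (x ^ r / r + (2 * T.card - 2) * Real.log x - c)) =O[atTop] fun x : ℝ => x ^ r := by
    have h1 : (fun x : ℝ => (4 + C * Real.exp (Real.log x / 2)) * Real.log x) =O[atTop]
        fun x : ℝ => x ^ r := by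
      refine ((hlog.const_mul_left 4).add (hsqrt.const_mul_left C)).congr_left fun x => ?_
      ring
    refine IsBigO.trans (IsBigO.of_bound 1 ?_) h1
    filter_upwards [eventually_ge_atTop 1, Real.tendsto_log_atTop.eventually_ge_atTop L]
      with x hx hxL
    have hx0 : 0 < x := by linarith
    have h2 := hS3 x hx (by rw [hy0]; exact hxL)
    have h3 : ∫ τ in (y 0)..(Real.log x), τ * template r T τ =
        ∫ τ in L..(Real.log x), templateNum r T τ := by
      rw [hy0]
      refine intervalIntegral.integral_congr fun τ hτ => ?_
      rw [Set.uIcc_of_le hxL] at hτ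
      have : τ ≠ 0 := by linarith [hτ.1]
      simp only [template]
      field_simp
    rw [h3, hc, Real.exp_log hx0] at h2
    rw [one_mul, Real.norm_eq_abs, Real.norm_eq_abs]
    refine le_trans (le_of_eq ?_) (h2.trans (le_abs_self _))
    congr 1
    rw [ArithmeticalSemigroup.Delta, Real.rpow_def_of_pos hx0, mul_comm (Real.log x) r]
    ring
  have hrest : (fun x : ℝ => x ^ r / r + (2 * T.card - 2) * Real.log x - c) =O[atTop]
      fun x : ℝ => x ^ r := by
    refine ((((isBigO_refl (fun x : ℝ => x ^ r) atTop).const_mul_left r⁻¹).add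
      (hlog.const_mul_left (2 * T.card - 2 : ℝ))).sub (hone.const_mul_left c)).congr_left fun x => ?_
    ring
  exact (hmain.add hrest).congr_left fun x => by ring

end BeurlingConstruction

end

/-! ### Odd sine polynomials without Gibbs overshoot -/

section

open Filter Topology

namespace BeurlingConstruction

/-- The linear term is isolated because it cancels when averaged over a centred variable. -/
lemma exp_le_add_exp_sq (y : ℝ) : Real.exp y ≤ y + Real.exp (y ^ 2) := by
  have h1 := Real.add_one_le_exp (y ^ 2)
  rcases le_or_gt |y| 1 with h | h
  · have := (abs_le.1 (Real.abs_exp_sub_one_sub_id_le h)).2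
    linarith
  · rcases lt_abs.1 h with h | h
    · have := Real.exp_le_exp.2 (show y ≤ y ^ 2 by nlinarith)
      linarith
    · have := Real.exp_le_one_iff.2 (show y ≤ 0 by linarith)
      nlinarith

/-- The exponential moment of a centred Bernoulli variable. -/
lemma bernoulli_exp_le {p : ℝ} (hp : p ∈ Set.Icc (0 : ℝ) 1) (t : ℝ) :
    p * Real.exp ((1 - p) * t) + (1 - p) * Real.exp (-p * t) ≤ Real.exp (t ^ 2) := by
  obtain ⟨h0, h1⟩ := hp
  have a := exp_le_add_exp_sq ((1 - p) * t)
  have b := exp_le_add_exp_sq (-p * t)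
  have a' : Real.exp (((1 - p) * t) ^ 2) ≤ Real.exp (t ^ 2) := Real.exp_le_exp.2 (by
    rw [mul_pow]
    exact mul_le_of_le_one_left (sq_nonneg t) (by nlinarith))
  have b' : Real.exp ((-p * t) ^ 2) ≤ Real.exp (t ^ 2) := Real.exp_le_exp.2 (by
    rw [mul_pow]
    exact mul_le_of_le_one_left (sq_nonneg t) (by nlinarith))
  have c := mul_le_mul_of_nonneg_left (a.trans (add_le_add_right a' _)) h0
  have d := mul_le_mul_of_nonneg_left (b.trans (add_le_add_right b' _)) (sub_nonneg.2 h1)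
  linarith

/-- The hyperbolic cosine serves as a potential that controls deviations of both signs. -/
lemma bernoulli_cosh_le {p : ℝ} (hp : p ∈ Set.Icc (0 : ℝ) 1) (x t : ℝ) :
    p * Real.cosh (x + (1 - p) * t) + (1 - p) * Real.cosh (x + -p * t) ≤
      Real.cosh x * Real.exp (t ^ 2) := by
  have a := mul_le_mul_of_nonneg_left (bernoulli_exp_le hp t) (Real.exp_pos x).le
  have b := mul_le_mul_of_nonneg_left (bernoulli_exp_le hp (-t)) (Real.exp_pos (-x)).le
  rw [neg_sq] at b
  have e1 : ∀ y z : ℝ, Real.cosh (y + z) =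
      (Real.exp y * Real.exp z + Real.exp (-y) * Real.exp (-z)) / 2 := fun y z => by
    rw [Real.cosh_eq, neg_add, Real.exp_add, Real.exp_add]
  rw [e1, e1, Real.cosh_eq]
  simp only [mul_neg] at b
  linarith

/-- Derandomized rounding of weights `p n ∈ [0, 1]` to a subset, for finitely many linear forms. -/
lemma exists_subset_sum_cosh_le {ι : Type*} [Fintype ι] {p : ℕ → ℝ}
    (hp : ∀ n, p n ∈ Set.Icc (0 : ℝ) 1) {v : ℕ → ι → ℝ} {c : ℕ → ℝ} (hv : ∀ n i, |v n i| ≤ c n)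
    (l : ℝ) (s : Finset ℕ) :
    ∃ B ⊆ s, ∑ i, Real.cosh (l * (∑ n ∈ B, v n i - ∑ n ∈ s, p n * v n i)) ≤
      Fintype.card ι * Real.exp (l ^ 2 * ∑ n ∈ s, c n ^ 2) := by
  induction s using Finset.induction_on with
  | empty => exact ⟨∅, subset_rfl, by simp⟩
  | insert m s hm ih =>
    obtain ⟨B, hB, hle⟩ := ih
    have hmB : m ∉ B := fun h => hm (hB h)
    set x : ι → ℝ := fun i => l * (∑ n ∈ B, v n i - ∑ n ∈ s, p n * v n i) with hx
    set F : ℝ := ∑ i, Real.cosh (x i + (1 - p m) * (l * v m i)) with hF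
    set G : ℝ := ∑ i, Real.cosh (x i + -p m * (l * v m i)) with hG
    -- `F` and `G` are the potentials with `m` included and excluded. Their `p m`-weighted mean
    -- obeys the bound, hence so does the smaller one.
    have key : p m * F + (1 - p m) * G ≤
        Fintype.card ι * Real.exp (l ^ 2 * ∑ n ∈ insert m s, c n ^ 2) := by
      rw [hF, hG, Finset.mul_sum, Finset.mul_sum, ← Finset.sum_add_distrib]
      calc _ ≤ ∑ i, Real.cosh (x i) * Real.exp (l ^ 2 * c m ^ 2) := by
            refine Finset.sum_le_sum fun i _ => (bernoulli_cosh_le (hp m) _ _).trans ?_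
            refine mul_le_mul_of_nonneg_left (Real.exp_le_exp.2 ?_) (Real.cosh_pos _).le
            rw [mul_pow]
            exact mul_le_mul_of_nonneg_left (sq_le_sq' (neg_le_of_abs_le (hv m i))
              (le_of_abs_le (hv m i))) (sq_nonneg l)
        _ = (∑ i, Real.cosh (x i)) * Real.exp (l ^ 2 * c m ^ 2) := by rw [Finset.sum_mul]
        _ ≤ (Fintype.card ι * Real.exp (l ^ 2 * ∑ n ∈ s, c n ^ 2)) * Real.exp (l ^ 2 * c m ^ 2) :=
            mul_le_mul_of_nonneg_right hle (Real.exp_pos _).le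
        _ = _ := by
            rw [Finset.sum_insert hm, mul_add, Real.exp_add]
            ring
    obtain ⟨h0, h1⟩ := hp m
    rcases le_total F G with h | h
    · refine ⟨insert m B, Finset.insert_subset_insert m hB, le_trans (le_of_eq ?_)
        (le_trans (show F ≤ p m * F + (1 - p m) * G by nlinarith) key)⟩
      refine Finset.sum_congr rfl fun i _ => ?_
      rw [Finset.sum_insert hmB, Finset.sum_insert hm]
      congr 1
      simp only [hx]
      ring
    · refine ⟨B, hB.trans (Finset.subset_insert m s), le_trans (le_of_eq ?_)
        (le_trans (show G ≤ p m * F + (1 - p m) * G by nlinarith) key)⟩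
      refine Finset.sum_congr rfl fun i _ => ?_
      rw [Finset.sum_insert hm]
      congr 1
      simp only [hx]
      ring

/-- The odd sine series damped by a Poisson factor. -/
lemma hasSum_sin_odd {Q : ℝ} (hQ0 : 0 ≤ Q) (hQ1 : Q < 1) (u : ℝ) : ∃ P : ℝ, |P| ≤ Real.pi / 4 ∧
    HasSum (fun n : ℕ => Q ^ (2 * n + 1) * (Real.sin ((2 * n + 1) * u) / (2 * n + 1))) P := by
  -- The series is the imaginary part of `∑ z ^ (2 n + 1) / (2 n + 1) = (1 / 2) log ((1 + z) / (1 -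
  -- z))`. The quotient has nonnegative real part for `‖z‖ < 1`, so its argument is at most `π / 2`.
  set z : ℂ := Q * Complex.exp (u * Complex.I) with hz
  have hzn : ‖z‖ < 1 := by
    rw [hz, norm_mul, Complex.norm_exp_ofReal_mul_I, mul_one, Complex.norm_real,
      Real.norm_of_nonneg hQ0]
    exact hQ1
  have h1 := Complex.hasSum_arctan (z := -Complex.I * z) (by simpa using hzn)
  have h2 := (h1.mul_left Complex.I)
  have h3 := Complex.hasSum_im h2
  refine ⟨_, ?_, h3.congr_fun fun n => ?_⟩
  · have e : Complex.I * Complex.arctan (-Complex.I * z) =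
        Complex.log ((1 + z) / (1 - z)) / 2 := by
      rw [Complex.arctan]
      have e1 : -Complex.I * z * Complex.I = z := by
        linear_combination (-z) * Complex.I_mul_I
      rw [e1]
      linear_combination (-(1 / 2 : ℂ) * Complex.log ((1 + z) / (1 - z))) * Complex.I_mul_I
    rw [e]
    have hre : 0 ≤ ((1 + z) / (1 - z)).re := by
      rw [Complex.div_re, ← add_div]
      refine div_nonneg ?_ (Complex.normSq_nonneg _)
      have h4 : Complex.normSq z < 1 := by
        rw [Complex.normSq_eq_norm_sq]; nlinarith [norm_nonneg z]
      rw [Complex.normSq_apply] at h4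
      simp only [Complex.add_re, Complex.one_re, Complex.sub_re, Complex.add_im, Complex.one_im,
        Complex.sub_im]
      nlinarith
    have := Complex.abs_arg_le_pi_div_two_iff.2 hre
    have e2 : (Complex.log ((1 + z) / (1 - z)) / 2).im = ((1 + z) / (1 - z)).arg / 2 := by
      rw [← Complex.log_im]
      simp
    rw [e2, abs_div, abs_two]
    linarith
  · have e : Complex.I * ((-1) ^ n * (-Complex.I * z) ^ (2 * n + 1) / ((2 * n + 1 : ℕ) : ℂ)) =
        ((Q ^ (2 * n + 1) / (2 * n + 1) : ℝ) : ℂ) *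
          Complex.exp (((2 * n + 1) * u : ℝ) * Complex.I) := by
      have e1 : (-Complex.I * z) ^ (2 * n + 1) = (-1) ^ n * -Complex.I * z ^ (2 * n + 1) := by
        rw [mul_pow, pow_succ (-Complex.I), pow_mul, neg_sq, Complex.I_sq]
      have e2 : z ^ (2 * n + 1) = Q ^ (2 * n + 1) *
          Complex.exp (((2 * n + 1) * u : ℝ) * Complex.I) := by
        rw [hz, mul_pow, ← Complex.exp_nat_mul]
        congr 2
        push_cast
        ring
      have e3 : ((-1 : ℂ) ^ n) * (-1) ^ n = 1 := by rw [← mul_pow]; simp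
      rw [e1, e2]
      push_cast
      linear_combination (-(Q : ℂ) ^ (2 * n + 1) * Complex.exp ((2 * n + 1) * u * Complex.I) /
        (2 * n + 1)) * (Complex.I * Complex.I * e3 + Complex.I_mul_I)
    rw [e, Complex.im_ofReal_mul, Complex.exp_ofReal_mul_I_im]
    ring

lemma abs_sin_div_sub_le (n : ℕ) (u u' : ℝ) :
    |Real.sin ((2 * n + 1) * u) / (2 * n + 1) - Real.sin ((2 * n + 1) * u') / (2 * n + 1)| ≤
      |u - u'| := by
  have h : (0 : ℝ) < 2 * n + 1 := by positivity
  rw [← sub_div, abs_div, abs_of_pos h, div_le_iff₀ h]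
  have := Real.abs_sin_sub_sin_le ((2 * n + 1) * u) ((2 * n + 1) * u')
  rwa [← mul_sub, abs_mul, abs_of_pos h, mul_comm (2 * (n : ℝ) + 1) |u - u'|] at this

lemma abs_sin_div_le (n : ℕ) (u : ℝ) :
    |Real.sin ((2 * n + 1) * u) / (2 * n + 1)| ≤ 1 / (2 * n + 1) := by
  have h : (0 : ℝ) < 2 * n + 1 := by positivity
  rw [abs_div, abs_of_pos h]
  exact div_le_div_of_nonneg_right (Real.abs_sin_le_one _) h.le

lemma sum_Ico_sq_le {K : ℕ} (hK : 1 ≤ K) (N : ℕ) :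
    ∑ n ∈ Finset.Ico K N, (1 / (2 * n + 1 : ℝ)) ^ 2 ≤ 1 / (K : ℝ) := by
  have hK0 : (0 : ℝ) < K := by exact_mod_cast hK
  rcases le_total N K with h | h
  · rw [Finset.Ico_eq_empty_of_le h, Finset.sum_empty]; positivity
  have : ∑ n ∈ Finset.Ico K N, (1 / (2 * n + 1 : ℝ)) ^ 2 ≤ 1 / (K : ℝ) - 1 / (N : ℝ) := by
    induction N, h using Nat.le_induction with
    | base => simp
    | succ N hN ih =>
      have hN0 : (0 : ℝ) < N := by exact_mod_cast hK.trans hN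
      rw [Finset.sum_Ico_succ_top hN]
      have : (1 / (2 * N + 1 : ℝ)) ^ 2 ≤ 1 / (N : ℝ) - 1 / ((N + 1 : ℕ) : ℝ) := by
        push_cast
        rw [div_sub_div _ _ hN0.ne' (by positivity), div_pow, div_le_div_iff₀ (by positivity)
          (by positivity)]
        nlinarith
      linarith
  have h2 : (0 : ℝ) ≤ 1 / (N : ℝ) := by positivity
  linarith

/-- Every angle is close, modulo `2π`, to a point of the grid `2πi/M`. -/
lemma exists_grid_point {M : ℕ} (hM : 0 < M) (u : ℝ) : ∃ (i : Fin M) (t : ℝ),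
    (∀ n : ℕ, Real.sin ((2 * n + 1) * u) = Real.sin ((2 * n + 1) * t)) ∧
      |t - 2 * Real.pi * i / M| ≤ 2 * Real.pi / M := by
  have hM0 : (0 : ℝ) < M := by exact_mod_cast hM
  have hpi := Real.pi_pos
  set f := Int.fract (u / (2 * Real.pi)) with hf
  have hf0 : 0 ≤ f := Int.fract_nonneg _
  have hf1 : f < 1 := Int.fract_lt_one _
  have hlt : ⌊M * f⌋₊ < M := by
    rw [Nat.floor_lt (by positivity)]
    nlinarith
  refine ⟨⟨⌊M * f⌋₊, hlt⟩, 2 * Real.pi * f, fun n => ?_, ?_⟩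
  · have e : (2 * n + 1) * u = (2 * n + 1) * (2 * Real.pi * f) +
        (((2 * n + 1) * ⌊u / (2 * Real.pi)⌋ : ℤ) : ℝ) * (2 * Real.pi) := by
      rw [hf, Int.fract]
      push_cast
      field_simp
      ring
    rw [e, Real.sin_add_int_mul_two_pi]
  · have h1 := Nat.floor_le (show 0 ≤ M * f by positivity)
    have h2 := Nat.lt_floor_add_one (M * f)
    have e : 2 * Real.pi * f - 2 * Real.pi * (⌊M * f⌋₊ : ℝ) / M =
        2 * Real.pi / M * (M * f - ⌊M * f⌋₊) := by
      field_simp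
    simp only
    rw [e, abs_mul, abs_of_pos (by positivity : 0 < 2 * Real.pi / M)]
    refine mul_le_of_le_one_right (by positivity) ?_
    rw [abs_le]
    constructor <;> linarith

/-- Rounding of the damped coefficients on an interval, uniformly in the angle. -/
lemma exists_subset_abs_le {K N M : ℕ} (hK : 1 ≤ K) (hM : 0 < M) {p : ℕ → ℝ}
    (hp : ∀ n, p n ∈ Set.Icc (0 : ℝ) 1) : ∃ B ⊆ Finset.Ico K N, ∀ u : ℝ,
      |∑ n ∈ B, Real.sin ((2 * n + 1) * u) / (2 * n + 1) -
        ∑ n ∈ Finset.Ico K N, p n * (Real.sin ((2 * n + 1) * u) / (2 * n + 1))| ≤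
      (Real.log (2 * M) + 1) / √K + 2 * N * (2 * Real.pi / M) := by
  have hM0 : (0 : ℝ) < M := by exact_mod_cast hM
  have hK0 : (0 : ℝ) < K := by exact_mod_cast hK
  have hl : 0 < √(K : ℝ) := Real.sqrt_pos.2 hK0
  set f : ℕ → ℝ → ℝ := fun n u => Real.sin ((2 * n + 1) * u) / (2 * n + 1) with hf
  -- The parameter `√K` matches the variance bound `1 / K`: the total potential over the `M` grid
  -- points is at most `M e`.
  obtain ⟨B, hB, hle⟩ := exists_subset_sum_cosh_le (ι := Fin M) hp
    (v := fun n i => f n (2 * Real.pi * i / M)) (c := fun n => 1 / (2 * n + 1))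
    (fun n i => abs_sin_div_le n _) (√K) (Finset.Ico K N)
  refine ⟨B, hB, fun u => ?_⟩
  set D : ℝ → ℝ := fun u => ∑ n ∈ B, f n u - ∑ n ∈ Finset.Ico K N, p n * f n u with hD
  obtain ⟨i, t, ht, hti⟩ := exists_grid_point hM u
  have hDt : D u = D t := by simp only [hD, hf, ht]
  change |D u| ≤ _
  rw [hDt]
  set t' := 2 * Real.pi * i / M with ht'
  have hgrid : |D t'| ≤ (Real.log (2 * M) + 1) / √K := by
    have h1 : Real.cosh (√K * D t') ≤ M * Real.exp 1 := by
      refine (Finset.single_le_sum (f := fun i : Fin M => Real.cosh (√K *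
        D (2 * Real.pi * i / M))) (fun _ _ => (Real.cosh_pos _).le) (Finset.mem_univ i)).trans ?_
      refine hle.trans ?_
      rw [Fintype.card_fin]
      refine mul_le_mul_of_nonneg_left (Real.exp_le_exp.2 ?_) hM0.le
      rw [Real.sq_sqrt hK0.le]
      have := mul_le_mul_of_nonneg_left (sum_Ico_sq_le hK N) hK0.le
      rwa [mul_one_div_cancel hK0.ne'] at this
    have h2 : Real.exp (√K * |D t'|) ≤ 2 * M * Real.exp 1 := by
      rw [← Real.cosh_abs, abs_mul, abs_of_pos hl, Real.cosh_eq] at h1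
      linarith [Real.exp_pos (-(√K * |D t'|))]
    rw [le_div_iff₀ hl, mul_comm, ← Real.log_exp 1, ← Real.log_mul (by positivity) (by positivity),
      Real.le_log_iff_exp_le (by positivity)]
    exact h2
  -- Every summand is 1-Lipschitz in the angle, and two sums of at most `N` terms are compared
  -- across one mesh width.
  have hlip : |D t - D t'| ≤ 2 * N * (2 * Real.pi / M) := by
    set δ := 2 * Real.pi / M with hδ
    have hδ0 : 0 ≤ δ := by positivity
    have hpt : ∀ n, |f n t - f n t'| ≤ δ := fun n => (abs_sin_div_sub_le n t t').trans hti
    have hcard : ((Finset.Ico K N).card : ℝ) ≤ N := by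
      rw [Nat.card_Ico]
      exact_mod_cast Nat.sub_le N K
    have hcardB : (B.card : ℝ) ≤ N := le_trans (by exact_mod_cast Finset.card_le_card hB) hcard
    have e : D t - D t' = ∑ n ∈ B, (f n t - f n t') -
        ∑ n ∈ Finset.Ico K N, p n * (f n t - f n t') := by
      simp only [hD, mul_sub, Finset.sum_sub_distrib]
      ring
    have a1 : |∑ n ∈ B, (f n t - f n t')| ≤ N * δ := by
      refine (Finset.abs_sum_le_sum_abs _ _).trans ((Finset.sum_le_card_nsmul _ _ δ
        fun n _ => hpt n).trans ?_)
      rw [nsmul_eq_mul]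
      exact mul_le_mul_of_nonneg_right hcardB hδ0
    have a2 : |∑ n ∈ Finset.Ico K N, p n * (f n t - f n t')| ≤ N * δ := by
      refine (Finset.abs_sum_le_sum_abs _ _).trans ((Finset.sum_le_card_nsmul _ _ δ
        fun n _ => ?_).trans ?_)
      · rw [abs_mul, abs_of_nonneg (hp n).1]
        exact (mul_le_of_le_one_left (abs_nonneg _) (hp n).2).trans (hpt n)
      · rw [nsmul_eq_mul]
        exact mul_le_mul_of_nonneg_right hcard hδ0
    rw [e]
    refine (abs_sub _ _).trans ?_
    linarith
  have : D t = D t' + (D t - D t') := by ring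
  rw [this]
  exact (abs_add_le _ _).trans (add_le_add hgrid hlip)

/-- A quantitative form of `exists_odd_sine_polynomial`. -/
lemma exists_odd_sine_polynomial_aux {K : ℕ} (hK : 1 ≤ K) : ∃ A : Finset ℕ, 0 ∈ A ∧ ∀ u : ℝ,
    |∑ n ∈ A, Real.sin ((2 * n + 1) * u) / (2 * n + 1)| ≤ Real.pi / 4 +
      (3 / K + (Real.log (32 * K ^ 4) + 1) / √K) := by
  have hK0 : (0 : ℝ) < K := by exact_mod_cast hK
  have hK1 : (1 : ℝ) ≤ K := by exact_mod_cast hK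
  -- With this `Q`, undamping the terms `n < K` costs at most `K * (1 / K ^ 2)`, and the damped tail
  -- beyond `K ^ 3` is at most `K ^ 2 / K ^ 3`; both are `1 / K`.
  set Q : ℝ := 1 - 1 / (K : ℝ) ^ 2 with hQ
  have hQi : 1 / (K : ℝ) ^ 2 ≤ 1 := by
    rw [div_le_one (by positivity)]
    exact one_le_pow₀ hK1
  have hQ0 : 0 ≤ Q := by rw [hQ]; linarith
  have hQ1 : Q < 1 := by
    have : 0 < 1 / (K : ℝ) ^ 2 := by positivity
    rw [hQ]; linarith
  have hp : ∀ n : ℕ, Q ^ (2 * n + 1) ∈ Set.Icc (0 : ℝ) 1 := fun n =>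
    ⟨by positivity, pow_le_one₀ hQ0 hQ1.le⟩
  -- The grid size `16 K ^ 4` makes the discretization error `π / (4 K)`. Terms below `K` are all
  -- kept, which secures `0 ∈ A`.
  obtain ⟨B, hB, hBu⟩ := exists_subset_abs_le (N := K ^ 3) (M := 16 * K ^ 4) hK (by positivity) hp
  refine ⟨Finset.range K ∪ B, Finset.mem_union_left _ (Finset.mem_range.2 hK), fun u => ?_⟩
  set f : ℕ → ℝ := fun n => Real.sin ((2 * n + 1) * u) / (2 * n + 1) with hf
  have hdisj : Disjoint (Finset.range K) B := by
    rw [Finset.disjoint_left]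
    intro n hn hnB
    have h1 := Finset.mem_range.1 hn
    have h2 := (Finset.mem_Ico.1 (hB hnB)).1
    omega
  have hKN : K ≤ K ^ 3 := Nat.le_self_pow (by norm_num) K
  obtain ⟨P, hP, hsum⟩ := hasSum_sin_odd hQ0 hQ1 u
  have hlow : |∑ n ∈ Finset.range K, (1 - Q ^ (2 * n + 1)) * f n| ≤ 1 / K := by
    refine (Finset.abs_sum_le_sum_abs _ _).trans ((Finset.sum_le_card_nsmul _ _ (1 / (K : ℝ) ^ 2)
      fun n _ => ?_).trans (le_of_eq ?_))
    · have h1 := one_add_mul_sub_le_pow (show (-1 : ℝ) ≤ Q by linarith) (2 * n + 1)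
      have h2 : 1 - Q ^ (2 * n + 1) ≤ (2 * n + 1) * (1 / (K : ℝ) ^ 2) := by
        push_cast at h1
        rw [hQ] at h1 ⊢
        linarith
      rw [abs_mul, abs_of_nonneg (sub_nonneg.2 (hp n).2)]
      refine (mul_le_mul h2 (abs_sin_div_le n u) (abs_nonneg _) (by positivity)).trans
        (le_of_eq ?_)
      field_simp
    · rw [Finset.card_range, nsmul_eq_mul]
      field_simp
  have htail : |P - ∑ n ∈ Finset.range (K ^ 3), Q ^ (2 * n + 1) * f n| ≤ 1 / K := by
    have h1 := (hasSum_nat_add_iff' (K ^ 3)).2 hsum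
    have h2 := (hasSum_geometric_of_lt_one hQ0 hQ1).mul_right (1 / (K : ℝ) ^ 3)
    have h3 := tsum_of_norm_bounded h2 (f := fun n : ℕ =>
      Q ^ (2 * (n + K ^ 3) + 1) * f (n + K ^ 3)) fun n => ?_
    · rw [h1.tsum_eq] at h3
      refine h3.trans (le_of_eq ?_)
      rw [hQ, sub_sub_cancel]
      field_simp
    · rw [norm_mul, Real.norm_of_nonneg (hp _).1, Real.norm_eq_abs]
      refine mul_le_mul (pow_le_pow_of_le_one hQ0 hQ1.le (by omega))
        ((abs_sin_div_le _ u).trans ?_) (abs_nonneg _) (by positivity)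
      refine one_div_le_one_div_of_le (by positivity) ?_
      push_cast
      have : (0 : ℝ) ≤ K ^ 3 := by positivity
      linarith [(Nat.cast_nonneg n : (0 : ℝ) ≤ n)]
  have hround := hBu u
  have hgrid : 2 * ((K ^ 3 : ℕ) : ℝ) * (2 * Real.pi / ((16 * K ^ 4 : ℕ) : ℝ)) ≤ 1 / K := by
    push_cast
    have e : 2 * (K : ℝ) ^ 3 * (2 * Real.pi / (16 * K ^ 4)) = (Real.pi / 4) * (1 / K) := by
      field_simp
      ring
    rw [e]
    exact mul_le_of_le_one_left (by positivity) (by linarith [Real.pi_le_four])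
  have hlog : 2 * ((16 * K ^ 4 : ℕ) : ℝ) = 32 * K ^ 4 := by push_cast; ring
  rw [hlog] at hround
  have hsplit := Finset.sum_range_add_sum_Ico (fun n => Q ^ (2 * n + 1) * f n) hKN
  rw [← hsplit] at htail
  rw [Finset.sum_union hdisj]
  simp only [sub_mul, one_mul, Finset.sum_sub_distrib] at hlow
  have e3 : 3 / (K : ℝ) = 1 / K + 1 / K + 1 / K := by ring
  rw [e3]
  rw [abs_le] at hlow htail hround hP ⊢
  constructor <;> linarith [hlow.1, hlow.2, htail.1, htail.2, hround.1, hround.2, hP.1, hP.2]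

/-- There are odd sine polynomials with coefficients `0` and `1 / k`, the first one being `1`, that
are bounded by almost the height of the square wave. -/
lemma exists_odd_sine_polynomial {ε : ℝ} (hε : 0 < ε) : ∃ A : Finset ℕ, 0 ∈ A ∧ ∀ u : ℝ,
    |∑ n ∈ A, Real.sin ((2 * n + 1) * u) / (2 * n + 1)| ≤ Real.pi / 4 + ε := by
  have hlim : Tendsto (fun x : ℝ => 3 / x + (Real.log (32 * x ^ 4) + 1) / √x) atTop (𝓝 0) := by
    have h1 : Tendsto (fun x : ℝ => 3 / x) atTop (𝓝 0) := tendsto_const_nhds.div_atTop tendsto_id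
    have h2 : Tendsto (fun x : ℝ => (Real.log 32 + 1) / √x) atTop (𝓝 0) :=
      tendsto_const_nhds.div_atTop Real.tendsto_sqrt_atTop
    have h3 := ((isLittleO_log_rpow_atTop (one_half_pos (α := ℝ))).tendsto_div_nhds_zero).const_mul 4
    have h4 := h1.add (h2.add h3)
    simp only [mul_zero, add_zero] at h4
    refine h4.congr' ?_
    filter_upwards [eventually_gt_atTop 0] with x hx
    rw [← Real.sqrt_eq_rpow, Real.log_mul (by norm_num) (by positivity), Real.log_pow]
    push_cast
    ring
  have h := (hlim.comp tendsto_natCast_atTop_atTop).eventually_le_const hε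
  obtain ⟨K, hK1, hK⟩ := ((eventually_ge_atTop 1).and h).exists
  obtain ⟨A, hA0, hA⟩ := exists_odd_sine_polynomial_aux hK1
  exact ⟨A, hA0, fun u => (hA u).trans (add_le_add_right hK _)⟩

end BeurlingConstruction

end

/-! ### The oscillating terms and the theorem -/

section

open Filter Topology Complex

namespace BeurlingConstruction

/-- Replacing `1 / (β + i m)` by `1 / (i m)` costs at most `1 / m ^ 2`, and `Re (exp (i m Y) / (i
m)) = sin (m Y) / m`. -/
lemma abs_re_exp_div_sub_le {β m : ℝ} (hβ : β ∈ Set.Icc (0 : ℝ) 1) (hm : 0 < m) (Y : ℝ) :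
    |(exp ((β + m * I) * Y) / (β + m * I)).re - Real.exp (β * Y) * (Real.sin (m * Y) / m)| ≤
      Real.exp (β * Y) / m ^ 2 := by
  set a : ℂ := β + m * I with ha
  have hare : a.re = β := by simp [ha]
  have haim : a.im = m := by simp [ha]
  have hma : m ≤ ‖a‖ := by
    rw [← haim]
    exact (le_abs_self _).trans (abs_im_le_norm a)
  have ha0 : 0 < ‖a‖ := hm.trans_le hma
  have hmI : (m * I : ℂ) ≠ 0 := mul_ne_zero (by exact_mod_cast hm.ne') I_ne_zero
  have hnorm : ‖exp (a * Y)‖ = Real.exp (β * Y) := by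
    rw [norm_exp, mul_re, hare, haim, ofReal_re, ofReal_im, mul_zero, sub_zero]
  have hexp : exp (a * Y) = Real.exp (β * Y) * exp ((m * Y : ℝ) * I) := by
    rw [ofReal_exp, ← exp_add, ha]
    congr 1
    push_cast
    ring
  have hre : (exp (a * Y) / (m * I)).re = Real.exp (β * Y) * (Real.sin (m * Y) / m) := by
    have e : exp (a * Y) / (m * I) =
        ((Real.exp (β * Y) / m : ℝ) : ℂ) * (exp ((m * Y : ℝ) * I) * -I) := by
      rw [hexp, ofReal_div, div_eq_mul_inv, mul_inv, inv_I]
      ring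
    rw [e, re_ofReal_mul, mul_neg, neg_re, mul_I_re, neg_neg, exp_ofReal_mul_I_im]
    ring
  rw [← hre, ← sub_re]
  refine (abs_re_le_norm _).trans ?_
  have e : exp (a * Y) / a - exp (a * Y) / (m * I) = exp (a * Y) * (-β / (a * (m * I))) := by
    have hsub : a - m * I = β := by rw [ha]; ring
    rw [div_sub_div _ _ (norm_pos_iff.1 ha0) hmI, mul_div_assoc']
    congr 1
    linear_combination (-exp (a * Y)) * hsub
  rw [e, norm_mul, hnorm, norm_div, norm_neg, norm_mul, norm_mul, norm_I, mul_one, norm_real,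
    norm_real, Real.norm_of_nonneg hβ.1, Real.norm_of_nonneg hm.le, div_eq_mul_inv (Real.exp _)]
  refine mul_le_mul_of_nonneg_left ?_ (Real.exp_pos _).le
  rw [div_le_iff₀ (by positivity), inv_mul_eq_div, le_div_iff₀ (by positivity)]
  nlinarith [hβ.2]

/-- The oscillating terms from zeros at `β + (2 n + 1) γ i`, `n ∈ A`. -/
lemma abs_sum_oscillation_le {β γ δ : ℝ} (hβ : β ∈ Set.Icc (0 : ℝ) 1) (hγ : 0 < γ) {A : Finset ℕ}
    (hA : ∀ u : ℝ, |∑ n ∈ A, Real.sin ((2 * n + 1) * u) / (2 * n + 1)| ≤ δ) (Y : ℝ) :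
    |∑ n ∈ A, 2 * (exp ((β + ((2 * n + 1) * γ : ℝ) * I) * Y) /
      (β + ((2 * n + 1) * γ : ℝ) * I)).re| ≤
      Real.exp (β * Y) * (2 * δ / γ + 2 * A.card / γ ^ 2) := by
  set E := Real.exp (β * Y) with hE
  have hE0 : 0 < E := Real.exp_pos _
  set a : ℕ → ℝ := fun n => (exp ((β + ((2 * n + 1) * γ : ℝ) * I) * Y) /
      (β + ((2 * n + 1) * γ : ℝ) * I)).re with ha
  set b : ℕ → ℝ := fun n => E * (Real.sin ((2 * n + 1) * γ * Y) / ((2 * n + 1) * γ)) with hb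
  have h1 : ∀ n ∈ A, |a n - b n| ≤ E / γ ^ 2 := by
    intro n _
    refine (abs_re_exp_div_sub_le hβ (by positivity) Y).trans ?_
    refine div_le_div_of_nonneg_left hE0.le (by positivity) ?_
    refine pow_le_pow_left₀ hγ.le (le_mul_of_one_le_left hγ.le ?_) 2
    linarith [(Nat.cast_nonneg n : (0 : ℝ) ≤ n)]
  have h2 : |∑ n ∈ A, (a n - b n)| ≤ A.card * (E / γ ^ 2) := by
    refine (Finset.abs_sum_le_sum_abs _ _).trans ((Finset.sum_le_card_nsmul _ _ _ h1).trans ?_)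
    rw [nsmul_eq_mul]
  have h3 : |∑ n ∈ A, b n| ≤ E / γ * δ := by
    have e : ∑ n ∈ A, b n = E / γ *
        ∑ n ∈ A, Real.sin ((2 * n + 1) * (γ * Y)) / (2 * n + 1) := by
      rw [Finset.mul_sum]
      refine Finset.sum_congr rfl fun n _ => ?_
      simp only [hb]
      rw [mul_assoc _ γ Y]
      have : (0 : ℝ) < 2 * n + 1 := by positivity
      field_simp
    rw [e, abs_mul, abs_of_pos (by positivity : 0 < E / γ)]
    exact mul_le_mul_of_nonneg_left (hA _) (by positivity)
  have e : ∑ n ∈ A, 2 * a n = 2 * (∑ n ∈ A, (a n - b n)) + 2 * ∑ n ∈ A, b n := by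
    rw [Finset.sum_sub_distrib, ← Finset.mul_sum]
    ring
  rw [e]
  refine (abs_add_le _ _).trans ?_
  rw [abs_mul, abs_mul, abs_two]
  have e2 : E * (2 * δ / γ + 2 * A.card / γ ^ 2) = 2 * (A.card * (E / γ ^ 2)) + 2 * (E / γ * δ) := by
    ring
  linarith

end BeurlingConstruction

end

theorem theorem1p3 (ε β₀ r : ℝ) (hε : 0 < ε) (hβ₀ : β₀ ∈ Set.Ioo (1 / 2 : ℝ) 1)
    (hr : 1 / 2 < r) (hrβ₀ : r < β₀) :
    ∃ (G : Type) (_ : CommMonoid G) (S : ArithmeticalSemigroup G),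
      (∃ κ : ℝ, S.AxiomA κ r) ∧
      (∀ κ θ : ℝ, S.AxiomA κ θ → r ≤ θ) ∧
      ∃ ρ₀ : ℂ, ρ₀.re = β₀ ∧ ρ₀.im ≠ 0 ∧ S.IsZetaZero r ρ₀ ∧
        ∀ᶠ x : ℝ in Filter.atTop,
          |S.Delta x| ≤ (Real.pi / 2 + ε) * (x ^ β₀ / ‖ρ₀‖) := by
  obtain ⟨hβh, hβ1⟩ := hβ₀
  obtain ⟨A, hA0, hA⟩ :=
    BeurlingConstruction.exists_odd_sine_polynomial (ε := ε / 8) (by positivity)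
  have hpi := Real.pi_pos
  set c : ℝ := Real.pi / 2 + ε / 4 with hc
  have hc0 : 0 < c := by positivity
  -- Large enough that the `1 / γ ^ 2` corrections and the replacement of `‖ρ₀‖` by `γ + 1` together
  -- cost at most `ε / 4` in the constant.
  set γ : ℝ := max 1 (4 * (c + 4 * A.card) / ε) with hγ
  have hγ1 : 1 ≤ γ := le_max_left _ _
  have hγ0 : 0 < γ := by linarith
  have hγε : c + 4 * A.card ≤ ε / 4 * γ := by
    have := le_max_right 1 (4 * (c + 4 * A.card) / ε)
    rw [div_le_iff₀ hε] at this
    linarith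
  set z : ℕ → ℂ := fun n => β₀ + ((2 * n + 1) * γ : ℝ) * Complex.I with hz
  have hzre : ∀ n, (z n).re = β₀ := fun n => by simp [hz]
  have hzim : ∀ n, (z n).im = (2 * n + 1) * γ := fun n => by simp [hz]
  have hzim0 : ∀ n, (z n).im ≠ 0 := fun n => by rw [hzim]; positivity
  have hinj : Function.Injective z := by
    intro m n hmn
    have := congrArg Complex.im hmn
    rw [hzim, hzim] at this
    have h2 := mul_right_cancel₀ hγ0.ne' this
    have h3 : (m : ℝ) = n := by linarith
    exact_mod_cast h3
  obtain ⟨S, hS1, hS2, hS3, hS4⟩ :=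
    BeurlingConstruction.exists_arithmeticalSemigroup_of_zeros hr (hrβ₀.trans hβ1) hβ1 (A.image z)
      (by
        intro ρ hρ
        obtain ⟨n, -, rfl⟩ := Finset.mem_image.1 hρ
        exact (hzre n).le)
      (by
        intro ρ hρ
        obtain ⟨n, -, rfl⟩ := Finset.mem_image.1 hρ
        exact hzim0 n)
  refine ⟨ℕ+, inferInstance, S, hS1, hS2, z 0, hzre 0, hzim0 0,
    hS3 _ (Finset.mem_image_of_mem z hA0) (by rw [hzre]; exact hrβ₀), ?_⟩
  have hz0 : 0 < ‖z 0‖ := norm_pos_iff.2 fun h => hzim0 0 (by rw [h, Complex.zero_im])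
  have hz0le : ‖z 0‖ ≤ γ + 1 := by
    refine (Complex.norm_le_abs_re_add_abs_im _).trans ?_
    rw [hzre, hzim, abs_of_pos (by linarith), abs_of_pos (by positivity)]
    norm_num
    linarith
  -- The sine polynomial gives `c = π / 2 + ε / 4` and the choice of `γ` another `ε / 4`. The
  -- remaining `ε / 2` absorbs the error `O(x ^ r) = o(x ^ β₀)`.
  have hmain : 2 * (Real.pi / 4 + ε / 8) / γ + 2 * A.card / γ ^ 2 ≤
      (Real.pi / 2 + ε / 2) / ‖z 0‖ := by
    refine le_trans ?_ (div_le_div_of_nonneg_left (by positivity) hz0 hz0le)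
    have e : 2 * (Real.pi / 4 + ε / 8) / γ + 2 * A.card / γ ^ 2 = (c * γ + 2 * A.card) / γ ^ 2 := by
      rw [hc]
      field_simp
      ring
    rw [e, div_le_div_iff₀ (by positivity) (by positivity)]
    have hcard : (0 : ℝ) ≤ A.card := by positivity
    have e2 : Real.pi / 2 + ε / 2 = c + ε / 4 := by rw [hc]; ring
    rw [e2]
    have h1 := mul_le_mul_of_nonneg_right hγε hγ0.le
    have h2 : (A.card : ℝ) ≤ A.card * γ := le_mul_of_one_le_right hcard hγ1
    nlinarith
  have hrpow : (fun x : ℝ => x ^ r) =o[Filter.atTop] fun x : ℝ => x ^ β₀ := by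
    refine (Asymptotics.isLittleO_iff_tendsto' ?_).2
      ((tendsto_rpow_neg_atTop (sub_pos.2 hrβ₀)).congr' ?_)
    · filter_upwards [Filter.eventually_gt_atTop 0] with x hx h
      exact absurd h (Real.rpow_pos_of_pos hx _).ne'
    · filter_upwards [Filter.eventually_gt_atTop 0] with x hx
      rw [← Real.rpow_sub hx, neg_sub]
  have hlittle := (hS4.trans_isLittleO hrpow).bound
    (show 0 < ε / 2 / ‖z 0‖ by positivity)
  filter_upwards [hlittle, Filter.eventually_gt_atTop 0] with x hx hx0
  have hosc := BeurlingConstruction.abs_sum_oscillation_le (β := β₀) ⟨by linarith, hβ1.le⟩ hγ0 hA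
    (Real.log x)
  have hpow : Real.exp (β₀ * Real.log x) = x ^ β₀ := by
    rw [Real.rpow_def_of_pos hx0, mul_comm]
  have hxβ : 0 < x ^ β₀ := Real.rpow_pos_of_pos hx0 _
  rw [hpow] at hosc
  have hosc2 := hosc.trans (mul_le_mul_of_nonneg_left hmain hxβ.le)
  rw [Finset.sum_image hinj.injOn, Real.norm_eq_abs, Real.norm_of_nonneg hxβ.le] at hx
  set O := ∑ n ∈ A, 2 * (Complex.exp (z n * Real.log x) / z n).re with hO
  have e1 : S.Delta x = (S.Delta x + O) + -O := by ring
  have e2 : (Real.pi / 2 + ε) * (x ^ β₀ / ‖z 0‖) =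
      ε / 2 / ‖z 0‖ * x ^ β₀ + x ^ β₀ * ((Real.pi / 2 + ε / 2) / ‖z 0‖) := by ring
  rw [e1, e2]
  refine (abs_add_le _ _).trans ?_
  rw [abs_neg]
  exact add_le_add hx hosc2
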